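/- Let $n\ge 1$, $k\ge 0$ and $m_1,\dots,m_n\ge 0$ be integers, let $K_i\subset\mathbb R^{m_i}$ $(1\le i\le n)$ be Borel sets, and let $\pi:\mathbb R^{m_1}\times\cdots\times\mathbb R^{m_n}\to\mathbb R^k$ be a surjective linear map. Write $\dim_H$ for Hausdorff dimension (with $\dim_H\emptyset=0$), regard each $\mathbb R^{m_i}$ as a coordinate subspace of the product, and put $$\mathfrak m=\min\Big\{\sum_{i\in I}\dim_H(K_i)+\dim\pi\Big(\bigoplus_{i\notin I}\mathbb R^{m_i}\Big)\;:\;\emptyset\ne I\subset\{1,\dots,n\}\Big\}.$$ For each $m$ let $\Lambda_m=\mathbb R\times SO(m)$ carry the product of Lebesgue measure on $\mathbb R$ and the Haar probability measure on $SO(m)$, and let $\Lambda=\Lambda_{m_1}\times\cdots\times\Lambda_{m_n}$ carry the product measure. For $\lambda=(t_1,O_1,\dots,t_n,O_n)\in\Lambda$ define $$\pi_\lambda(x^1,\dots,x^n)=\pi(t_1O_1x^1,\dots,t_nO_nx^n).$$ Then: (i) If $\mathfrak m>k$, then $\pi_\lambda(K_1\times\cdots\times K_n)$ has positive $k$-dimensional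 Lebesgue measure for almost every $\lambda\in\Lambda$. (ii) If $\mathfrak m\le k$ and $\dim_H(K_1\times\cdots\times K_n)=\dim_H(K_1)+\cdots+\dim_H(K_n)$, then $\dim_H\big(\pi_\lambda(K_1\times\cdots\times K_n)\big)=\mathfrak m$ for almost every $\lambda\in\Lambda$. -/

import Mathlib

open MeasureTheory
open scoped ENNReal

namespace Marstrand

/-- The special orthogonal group `SO(m)`, with the topology induced from real matrices. -/
abbrev SO (m : ℕ) : Type := ↥(Matrix.specialOrthogonalGroup (Fin m) ℝ)

instance instIsTopologicalGroupSO (m : ℕ) : IsTopologicalGroup (SO m) where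
  continuous_inv := by
    refine Continuous.subtype_mk (f := fun A : SO m => star (A : Matrix (Fin m) (Fin m) ℝ)) ?_ _
    exact continuous_star.comp continuous_subtype_val

instance instCompactSpaceSO (m : ℕ) : CompactSpace (SO m) := by
  apply isCompact_iff_compactSpace.mp
  have hK : IsCompact (Set.univ.pi fun _ : Fin m => Set.univ.pi fun _ : Fin m =>
      Metric.closedBall (0 : ℝ) 1) :=
    isCompact_univ_pi fun _ => isCompact_univ_pi fun _ => isCompact_closedBall 0 1
  refine IsCompact.of_isClosed_subset (X := Matrix (Fin m) (Fin m) ℝ) hK ?_ ?_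
  · have h : ((Matrix.specialOrthogonalGroup (Fin m) ℝ : Submonoid (Matrix (Fin m) (Fin m) ℝ)) :
        Set (Matrix (Fin m) (Fin m) ℝ)) = {A | A * star A = 1} ∩ {A | A.det = 1} := by
      ext A
      simp [Matrix.mem_specialOrthogonalGroup_iff, Matrix.mem_orthogonalGroup_iff,
        Matrix.star_eq_conjTranspose]
    rw [h]
    refine (isClosed_eq ?_ continuous_const).inter (isClosed_eq ?_ continuous_const)
    · exact continuous_id.mul continuous_star
    · exact Continuous.matrix_det continuous_id
  · intro A hA i _ j _
    have := entry_norm_bound_of_unitary (Matrix.mem_specialOrthogonalGroup_iff.mp hA).1 i j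
    simpa using this

instance instMeasurableSpaceSO (m : ℕ) : MeasurableSpace (SO m) := borel (SO m)

instance instBorelSpaceSO (m : ℕ) : BorelSpace (SO m) := ⟨rfl⟩

/-- The Haar probability measure on `SO(m)`. -/
noncomputable def haarSO (m : ℕ) : Measure (SO m) := Measure.haarMeasure ⊤

/-- `ℝ^{m_1} × ⋯ × ℝ^{m_n}` with its Euclidean norm. -/
abbrev ProdSpace {n : ℕ} (m : Fin n → ℕ) : Type :=
  PiLp 2 fun i : Fin n => EuclideanSpace ℝ (Fin (m i))

/-- The Cartesian product `K_1 × ⋯ × K_n`. -/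
def prodSet {n : ℕ} {m : Fin n → ℕ} (K : (i : Fin n) → Set (EuclideanSpace ℝ (Fin (m i)))) :
    Set (ProdSpace m) :=
  {x | ∀ i, x i ∈ K i}

/-- The subspace `⨁_{i ∈ J} ℝ^{m_i}` of `ℝ^{m_1} × ⋯ × ℝ^{m_n}`. -/
def coordSubspace {n : ℕ} (m : Fin n → ℕ) (J : Finset (Fin n)) : Submodule ℝ (ProdSpace m) where
  carrier := {x | ∀ i, i ∉ J → x i = 0}
  add_mem' := by
    intro x y hx hy i hi
    simp [hx i hi, hy i hi]
  zero_mem' := by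
    intro i _
    simp
  smul_mem' := by
    intro c x hx i hi
    simp [hx i hi]

/-- `𝔪(π, d_1, …, d_n)`, the minimum over the nonempty `I ⊆ {1, …, n}` of
`∑_{i ∈ I} d_i + dim π(⨁_{i ∉ I} ℝ^{m_i})`. -/
noncomputable def minDim {n k : ℕ} {m : Fin n → ℕ}
    (π : ProdSpace m →ₗ[ℝ] EuclideanSpace ℝ (Fin k)) (d : Fin n → ℝ≥0∞) : ℝ≥0∞ :=
  ⨅ (I : Finset (Fin n)) (_ : I.Nonempty),
    (∑ i ∈ I, d i + (Module.finrank ℝ ((coordSubspace m Iᶜ).map π) : ℝ≥0∞))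

/-- `Λ = Λ_{m_1} × ⋯ × Λ_{m_n}`, where `Λ_m = ℝ × SO(m)`. -/
abbrev Param {n : ℕ} (m : Fin n → ℕ) : Type := (i : Fin n) → ℝ × SO (m i)

/-- The product over `i` of the measures (Lebesgue on `ℝ`) × (Haar probability on `SO(m_i)`). -/
noncomputable def paramMeasure {n : ℕ} (m : Fin n → ℕ) : Measure (Param m) :=
  Measure.pi fun i => (volume : Measure ℝ).prod (haarSO (m i))

/-- `π_λ(x) = π(t_1 O_1 x^1, …, t_n O_n x^n)` for `λ = (t_1, O_1, …, t_n, O_n)`. -/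
noncomputable def projParam {n k : ℕ} {m : Fin n → ℕ}
    (π : ProdSpace m →ₗ[ℝ] EuclideanSpace ℝ (Fin k)) (l : Param m) (x : ProdSpace m) :
    EuclideanSpace ℝ (Fin k) :=
  π (WithLp.toLp 2 fun i =>
    (l i).1 • Matrix.toEuclideanLin ((l i).2 : Matrix (Fin (m i)) (Fin (m i)) ℝ) (x i))

end Marstrand

/-! The lower bounds come from a transversality estimate for random `λ`, the upper bound from an
inclusion valid for every `λ`.

Transversality. Restrict to scales `b⁻¹ ≤ |t_i| ≤ b`, and let `|z^i| ≤ 1` and `0 < r ≤ 1`. If `τ ≤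
∑_{i ∈ I} s_i + dim π(⨁_{i ∉ I} ℝ^{m_i})` for every `I`, the empty one included, then `{λ : |π_λ z|
≤ r}` has measure at most `C r^τ ∏ |z^i|^{-s_i}` (`exists_boundedParamMeasure_norm_projParam_le`).
Indeed `t_i O_i z^i` has density at most a constant times `|z^i|^{-m_i}` on a ball of radius
`b|z^i|`. With `ρ_i = max(|z^i|, r)` and an independent set `S` among the vectors `π(e)`, `e` a
standard basis vector, a volume count gives the bound `∏_{e ∈ S} r/ρ_e` up to a constant. Choosing
`S` greedily, largest `ρ` first, makes `S` count the dimension of `π(⨁_{ρ_i ≥ exp(-θ)} ℝ^{m_i})` for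
every `θ`. Integrating the hypothesis with `I = {i : ρ_i < exp(-θ)}` over `0 < θ ≤ log(1/r)` and
exponentiating yields `r^τ ∏ ρ_i^{-s_i}`.

Lower bounds. Take `s_i` and Frostman exponents `σ_i` just below `dim_H K_i`, with `s_i < σ_i`
unless `s_i = 0`, and let `ν` be the product of Frostman measures on compact subsets of the `K_i`.
By Fubini and the boundedness of Riesz potentials, the mean over `λ` of the correlation `(ν × ν){(x,
y) : |π_λ x - π_λ y| ≤ r}` is at most `M r^τ` (`exists_lintegral_correlation_le`). If `𝔪 > k`, take
`τ = k`: Fatou's lemma bounds the normalised correlation along infinitely many scales for almost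
every `λ`, which forces positive Lebesgue measure. If `𝔪 ≤ k`, take `τ' < τ < 𝔪`: the correlation
sums of exponent `τ'` converge almost surely, which forces dimension at least `τ'`.

Upper bound. The image lies in `π_λ(∏_{i ∈ I} K_i) + π(⨁_{i ∉ I} ℝ^{m_i})`, and adding a subspace
raises the dimension by at most its rank. Since `dim(A × B) ≥ dim A + dim B` for nonempty Borel
sets, additivity of dimension for the full product gives `dim ∏_{i ∈ I} K_i ≤ ∑_{i ∈ I} dim K_i`.

Frostman's lemma for Borel sets is proved from scratch: dyadic net contents are continuous along
increasing sequences, so analytic sets of positive content contain compact ones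
(`exists_isCompact_netContent_ne_zero`), and on a compact set the content dominates a conserved flow
down the dyadic tree, whose weak limit is the measure. -/

namespace Marstrand

open Set Filter Topology
open scoped NNReal Pointwise

/-! ### Covers and null sets for Hausdorff measure -/

section HausdorffTools

variable {X : Type*} [EMetricSpace X] [MeasurableSpace X] [BorelSpace X]

/-- A set has zero Hausdorff measure as soon as it has countable covers of arbitrarily small
total `t`-th power of the diameters. -/
theorem hausdorffMeasure_eq_zero_of_covers {t : ℝ} (ht : 0 < t) {A : Set X}
    (h : ∀ ε : ℝ≥0∞, 0 < ε → ∃ (ι : Type*) (_ : Countable ι) (U : ι → Set X),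
      A ⊆ ⋃ i, U i ∧ ∑' i, Metric.ediam (U i) ^ t ≤ ε) :
    μH[t] A = 0 := by
  have hpos : ∀ n : ℕ, (0 : ℝ≥0∞) < ((n : ℝ≥0∞) + 1)⁻¹ := by
    intro n; simp [ENNReal.add_eq_top]
  choose ι hι U hU hs using fun n : ℕ => h _ (hpos n)
  have hlim : Tendsto (fun n : ℕ => ((n : ℝ≥0∞) + 1)⁻¹) atTop (𝓝 0) := by
    have := (ENNReal.tendsto_inv_nat_nhds_zero).comp (tendsto_add_atTop_nat 1)
    refine this.congr fun n => ?_
    simp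
  -- A small total already forces small pieces: each diameter is at most the `t⁻¹`-th power of the
  -- total.
  have hlim2 : Tendsto (fun n : ℕ => (((n : ℝ≥0∞) + 1)⁻¹) ^ t⁻¹) atTop (𝓝 0) := by
    have := hlim.ennrpow_const t⁻¹
    rwa [ENNReal.zero_rpow_of_pos (inv_pos.2 ht)] at this
  have hle := Measure.hausdorffMeasure_le_liminf_tsum t A (l := atTop) _ hlim2 U
    (Eventually.of_forall fun n i => by
      rw [ENNReal.le_rpow_inv_iff ht]
      exact (ENNReal.le_tsum i).trans (hs n)) (Eventually.of_forall hU)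
  refine le_antisymm (hle.trans ?_) zero_le
  rw [← hlim.liminf_eq]
  exact liminf_le_liminf (Eventually.of_forall hs)

/-- The radii `r n` are made strictly positive by adding a summable `δ n` to the `t`-th powers of
the diameters, so that they can serve as side lengths when a second factor is subdivided. -/
theorem exists_cover_of_hausdorffMeasure_eq_zero {t : ℝ} (ht : 0 < t) {A : Set X}
    (h : μH[t] A = 0) {ε : ℝ≥0∞} (hε : 0 < ε) :
    ∃ (U : ℕ → Set X) (r : ℕ → ℝ≥0), A ⊆ ⋃ n, U n ∧ (∀ n, 0 < r n) ∧
      (∀ n, Metric.ediam (U n) ≤ r n) ∧ ∑' n, (r n : ℝ≥0∞) ^ t ≤ ε := by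
  wlog hε1 : ε ≤ 1 generalizing ε
  · obtain ⟨U, r, h1, h2, h3, h4⟩ := this (ε := min ε 1) (by simp [hε]) (min_le_right _ _)
    exact ⟨U, r, h1, h2, h3, h4.trans (min_le_left _ _)⟩
  have hε2 : ε / 2 ≠ 0 := by simp [hε.ne']
  obtain ⟨δ, hδ0, hδ⟩ := ENNReal.exists_pos_sum_of_countable hε2 ℕ
  rw [Measure.hausdorffMeasure_apply] at h
  have h1 : (⨅ (t' : ℕ → Set X) (_ : A ⊆ ⋃ n, t' n) (_ : ∀ n, Metric.ediam (t' n) ≤ 1),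
      ∑' n, ⨆ _ : (t' n).Nonempty, Metric.ediam (t' n) ^ t) < ε / 2 := by
    refine lt_of_le_of_lt ?_ (pos_iff_ne_zero.2 hε2)
    rw [← h]
    exact le_iSup₂ (f := fun (r : ℝ≥0∞) (_ : 0 < r) => ⨅ (t' : ℕ → Set X) (_ : A ⊆ ⋃ n, t' n)
      (_ : ∀ n, Metric.ediam (t' n) ≤ r),
      ∑' n, ⨆ _ : (t' n).Nonempty, Metric.ediam (t' n) ^ t) 1 one_pos
  simp only [iInf_lt_iff] at h1
  obtain ⟨U, hU, hd, hsum⟩ := h1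
  have hsum' : ∑' n, Metric.ediam (U n) ^ t < ε / 2 := by
    refine lt_of_le_of_lt (ENNReal.tsum_le_tsum fun n => ?_) hsum
    rcases (U n).eq_empty_or_nonempty with h0 | h0
    · simp [h0, ENNReal.zero_rpow_of_pos ht]
    · simp [h0]
  have htot : ∑' n, (Metric.ediam (U n) ^ t + δ n) ≤ ε := by
    rw [ENNReal.tsum_add]
    calc _ ≤ ε / 2 + ε / 2 := add_le_add hsum'.le hδ.le
      _ = ε := ENNReal.add_halves ε
  have hfin : ∀ n, (Metric.ediam (U n) ^ t + δ n) ^ t⁻¹ ≠ ∞ := by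
    intro n
    refine ENNReal.rpow_ne_top_of_nonneg (inv_nonneg.2 ht.le) ?_
    exact ne_top_of_le_ne_top ENNReal.one_ne_top ((ENNReal.le_tsum n).trans (htot.trans hε1))
  refine ⟨U, fun n => ((Metric.ediam (U n) ^ t + δ n) ^ t⁻¹).toNNReal, hU, ?_, ?_, ?_⟩
  · intro n
    rw [ENNReal.toNNReal_pos_iff]
    refine ⟨ENNReal.rpow_pos ?_ ?_, (hfin n).lt_top⟩
    · exact lt_of_lt_of_le (by exact_mod_cast hδ0 n) le_add_self
    · exact ne_top_of_le_ne_top ENNReal.one_ne_top ((ENNReal.le_tsum n).trans (htot.trans hε1))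
  · intro n
    rw [ENNReal.coe_toNNReal (hfin n), ENNReal.le_rpow_inv_iff ht]
    exact le_self_add
  · refine le_trans (le_of_eq ?_) htot
    refine tsum_congr fun n => ?_
    rw [ENNReal.coe_toNNReal (hfin n), ENNReal.rpow_inv_rpow ht.ne']

end HausdorffTools

/-! ### Mass distribution principle -/

theorem exists_two_inv_pow_near (r : ℝ) (h0 : 0 < r) (h1 : r ≤ 1) :
    ∃ j : ℕ, r ≤ (2⁻¹ : ℝ) ^ j ∧ (2⁻¹ : ℝ) ^ j ≤ 2 * r := by
  obtain ⟨n, hn1, hn2⟩ := exists_nat_pow_near_of_lt_one h0 h1 (y := (2⁻¹ : ℝ)) (by norm_num)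
    (by norm_num)
  refine ⟨n, hn2, ?_⟩
  rw [pow_succ] at hn1
  linarith

/-- Mass distribution principle. -/
theorem le_dimH_of_measure_closedBall_le {X : Type*} [MetricSpace X] [MeasurableSpace X]
    [BorelSpace X] {μ : Measure X} {A : Set X} (hA : MeasurableSet A) (hμA : μ A ≠ 0)
    {τ : ℝ≥0} {C : ℝ≥0} (hb : ∀ x ∈ A, ∀ j : ℕ,
      μ (Metric.closedBall x (2⁻¹ ^ j)) ≤ C * (2⁻¹ ^ j : ℝ≥0∞) ^ (τ : ℝ)) :
    (τ : ℝ≥0∞) ≤ dimH A := by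
  rcases eq_or_ne τ 0 with rfl | hτ
  · simp
  have hτ0 : (0 : ℝ) < τ := by positivity
  -- The factor `2 ^ τ` pays for rounding a diameter up to a dyadic radius; the `1` keeps `D`
  -- invertible.
  set D : ℝ≥0 := C * 2 ^ (τ : ℝ) + 1 with hD
  have hD0 : D ≠ 0 := by positivity
  have key : (D⁻¹ : ℝ≥0) • μ.restrict A ≤ μH[(τ : ℝ)] := by
    refine Measure.le_hausdorffMeasure _ _ 1 one_pos fun s hs => ?_
    rw [Measure.smul_apply, Measure.restrict_apply' hA]
    change ((D⁻¹ : ℝ≥0) : ℝ≥0∞) * μ (s ∩ A) ≤ _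
    rw [ENNReal.coe_inv hD0, mul_comm, ← div_eq_mul_inv]
    refine ENNReal.div_le_of_le_mul ?_
    rcases (s ∩ A).eq_empty_or_nonempty with h0 | ⟨x, hxs, hxA⟩
    · simp [h0]
    have hsub : ∀ r : ℝ, Metric.ediam s ≤ ENNReal.ofReal r → 0 ≤ r → s ⊆ Metric.closedBall x r := by
      intro r hr hr0 y hy
      rw [Metric.mem_closedBall, dist_edist]
      exact ENNReal.toReal_le_of_le_ofReal hr0 ((Metric.edist_le_ediam_of_mem hy hxs).trans hr)
    have hbound : ∀ j : ℕ, Metric.ediam s ≤ ENNReal.ofReal (2⁻¹ ^ j) →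
        μ (s ∩ A) ≤ C * (2⁻¹ ^ j : ℝ≥0∞) ^ (τ : ℝ) := fun j hj =>
      (measure_mono (inter_subset_left.trans (hsub _ hj (by positivity)))).trans (hb x hxA j)
    have hdfin : Metric.ediam s ≠ ∞ := ne_top_of_le_ne_top ENNReal.one_ne_top hs
    rcases eq_or_ne (Metric.ediam s) 0 with hd0 | hd0
    · have hlim : Tendsto (fun j : ℕ => (C : ℝ≥0∞) * ((2⁻¹ : ℝ≥0∞) ^ j) ^ (τ : ℝ)) atTop (𝓝 0) := by
        have h1 : Tendsto (fun j : ℕ => ((2⁻¹ : ℝ≥0∞) ^ j)) atTop (𝓝 0) :=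
          ENNReal.tendsto_pow_atTop_nhds_zero_of_lt_one (by simp)
        have h2 := h1.ennrpow_const (τ : ℝ)
        rw [ENNReal.zero_rpow_of_pos hτ0] at h2
        simpa using ENNReal.Tendsto.const_mul h2 (Or.inr ENNReal.coe_ne_top)
      have h0 : μ (s ∩ A) ≤ 0 := ge_of_tendsto' hlim fun j => hbound j (by simp [hd0])
      exact h0.trans zero_le
    · obtain ⟨j, hj1, hj2⟩ := exists_two_inv_pow_near (Metric.ediam s).toReal
        (ENNReal.toReal_pos hd0 hdfin) (by
          simpa using ENNReal.toReal_mono ENNReal.one_ne_top hs)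
      refine (hbound j ((ENNReal.le_ofReal_iff_toReal_le hdfin (by positivity)).2 hj1)).trans ?_
      have h3 : (2⁻¹ ^ j : ℝ≥0∞) ≤ 2 * Metric.ediam s := by
        rw [← ENNReal.ofReal_toReal hdfin]
        have : (2⁻¹ ^ j : ℝ≥0∞) = ENNReal.ofReal (2⁻¹ ^ j) := by
          rw [ENNReal.ofReal_pow (by norm_num), ENNReal.ofReal_inv_of_pos (by norm_num)]
          simp
        rw [this]
        have h2 : (2 : ℝ≥0∞) = ENNReal.ofReal 2 := by simp
        rw [h2, ← ENNReal.ofReal_mul (by norm_num)]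
        exact ENNReal.ofReal_le_ofReal hj2
      calc (C : ℝ≥0∞) * (2⁻¹ ^ j : ℝ≥0∞) ^ (τ : ℝ) ≤ C * (2 * Metric.ediam s) ^ (τ : ℝ) := by
            gcongr
        _ = (C * 2 ^ (τ : ℝ)) * Metric.ediam s ^ (τ : ℝ) := by
            rw [ENNReal.mul_rpow_of_nonneg _ _ hτ0.le, mul_assoc]
        _ ≤ Metric.ediam s ^ (τ : ℝ) * D := by
            rw [mul_comm]
            gcongr
            rw [hD]
            push_cast
            rw [ENNReal.coe_rpow_of_nonneg _ hτ0.le]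
            simp
  borelize X
  refine le_dimH_of_hausdorffMeasure_ne_zero fun h0 => hμA ?_
  have h1 := key A
  rw [h0, Measure.smul_apply, Measure.restrict_apply_self] at h1
  simpa [ENNReal.smul_def, hD0] using h1

/-! ### Dimension of a set thickened by a subspace -/

/-- Over a piece of radius `r n`, the interval `[-N, N]` is cut into about `2N / r n` intervals of
length `r n`. Since `r n ≤ 1`, these products cost at most `(2N + 1) (r n) ^ s` at exponent `s + 1`.
-/
theorem dimH_prod_univ_real_le {X : Type*} [MetricSpace X] [SecondCountableTopology X]
    (E : Set X) : dimH (E ×ˢ (univ : Set ℝ)) ≤ dimH E + 1 := by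
  borelize X
  refine ENNReal.le_of_forall_pos_le_add fun η hη hfin => ?_
  have hE : dimH E ≠ ∞ := fun h => by simp [h] at hfin
  lift dimH E to ℝ≥0 using hE with d hd
  set s : ℝ≥0 := d + η with hsdef
  have hs0 : (0 : ℝ) < s := by positivity
  have hnull : μH[(s : ℝ)] E = 0 := by
    apply hausdorffMeasure_of_dimH_lt
    rw [← hd]
    exact_mod_cast lt_add_of_pos_right d hη
  have hcov : (E ×ˢ (univ : Set ℝ)) = ⋃ N : ℕ, E ×ˢ Icc (-(N : ℝ)) N := by
    ext ⟨x, y⟩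
    simp only [mem_prod, mem_univ, and_true, mem_iUnion, mem_Icc]
    constructor
    · intro h
      obtain ⟨N, hN⟩ := exists_nat_ge |y|
      exact ⟨N, h, abs_le.1 hN⟩
    · rintro ⟨N, h, -⟩; exact h
  have hzero : ∀ N : ℕ, μH[((s + 1 : ℝ≥0) : ℝ)] (E ×ˢ Icc (-(N : ℝ)) N) = 0 := by
    intro N
    refine hausdorffMeasure_eq_zero_of_covers (by positivity) fun ε hε => ?_
    set c : ℝ≥0∞ := 2 * N + 1 with hc
    have hcfin : c ≠ ∞ := by rw [hc]; finiteness
    have hc0 : c ≠ 0 := by rw [hc]; positivity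
    obtain ⟨U, r, hU, hr0, hUr, hsum⟩ := exists_cover_of_hausdorffMeasure_eq_zero hs0 hnull
      (ε := min 1 (ε / c)) (lt_min one_pos (ENNReal.div_pos hε.ne' hcfin))
    have hr1 : ∀ n, (r n : ℝ) ≤ 1 := by
      intro n
      have h1 : (r n : ℝ≥0∞) ^ (s : ℝ) ≤ 1 :=
        (ENNReal.le_tsum n).trans (hsum.trans (min_le_left _ _))
      have h2 : (r n : ℝ≥0∞) ≤ 1 := by
        by_contra hcon
        exact absurd h1 (not_le.2 (ENNReal.one_lt_rpow (not_le.1 hcon) hs0))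
      exact_mod_cast h2
    let M : ℕ → ℕ := fun n => ⌊2 * (N : ℝ) / r n⌋₊ + 1
    refine ⟨Σ n, Fin (M n), inferInstance, fun p => U p.1 ×ˢ
      Icc (-(N : ℝ) + p.2 * r p.1) (-(N : ℝ) + (p.2 + 1) * r p.1), ?_, ?_⟩
    · rintro ⟨x, y⟩ ⟨hx, hy⟩
      obtain ⟨n, hn⟩ := mem_iUnion.1 (hU hx)
      have hrn : (0 : ℝ) < r n := hr0 n
      have hq0 : 0 ≤ (y + N) / r n := div_nonneg (by linarith [hy.1]) hrn.le
      refine mem_iUnion.2 ⟨⟨n, ⟨⌊(y + N) / r n⌋₊, ?_⟩⟩, hn, ?_⟩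
      · refine Nat.lt_succ_of_le (Nat.floor_le_floor ?_)
        gcongr
        linarith [hy.2]
      · have h1 := Nat.floor_le hq0
        have h2 := (Nat.lt_floor_add_one ((y + N) / r n)).le
        rw [le_div_iff₀ hrn] at h1
        rw [div_le_iff₀ hrn] at h2
        simp only [mem_Icc]
        constructor <;> linarith
    · have hdiam : ∀ p : Σ n, Fin (M n), Metric.ediam (U p.1 ×ˢ
          Icc (-(N : ℝ) + p.2 * r p.1) (-(N : ℝ) + (p.2 + 1) * r p.1)) ≤ r p.1 := by
        rintro ⟨n, j⟩
        refine Metric.ediam_le ?_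
        rintro ⟨x, y⟩ ⟨hx, hy⟩ ⟨x', y'⟩ ⟨hx', hy'⟩
        rw [Prod.edist_eq]
        refine max_le ((Metric.edist_le_ediam_of_mem hx hx').trans (hUr n)) ?_
        refine (Metric.edist_le_ediam_of_mem hy hy').trans ?_
        rw [Real.ediam_Icc]
        rw [show (-(N : ℝ) + ((j : ℕ) + 1) * r n - (-(N : ℝ) + (j : ℕ) * r n)) = r n by ring]
        simp
      rw [ENNReal.tsum_sigma']
      calc _ ≤ ∑' n, c * (r n : ℝ≥0∞) ^ (s : ℝ) := by
            refine ENNReal.tsum_le_tsum fun n => ?_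
            rw [tsum_fintype]
            calc _ ≤ ∑ _j : Fin (M n), (r n : ℝ≥0∞) ^ ((s + 1 : ℝ≥0) : ℝ) :=
                  Finset.sum_le_sum fun j _ => by gcongr; exact hdiam ⟨n, j⟩
              _ = (M n : ℝ≥0∞) * (r n * (r n : ℝ≥0∞) ^ (s : ℝ)) := by
                  rw [Finset.sum_const, Finset.card_univ, Fintype.card_fin, nsmul_eq_mul]
                  congr 1
                  rw [NNReal.coe_add, NNReal.coe_one, ENNReal.rpow_add_of_nonneg _ _ hs0.le
                    zero_le_one, ENNReal.rpow_one, mul_comm]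
              _ ≤ c * (r n : ℝ≥0∞) ^ (s : ℝ) := by
                  rw [← mul_assoc]
                  gcongr
                  have hrn : (0 : ℝ) < r n := hr0 n
                  have : (M n : ℝ) * r n ≤ 2 * N + 1 := by
                    have h1 : ((⌊2 * (N : ℝ) / r n⌋₊ : ℕ) : ℝ) ≤ 2 * N / r n :=
                      Nat.floor_le (by positivity)
                    rw [le_div_iff₀ hrn] at h1
                    simp only [M]
                    push_cast
                    nlinarith [hr1 n]
                  have h2 : (M n : ℝ≥0) * r n ≤ 2 * N + 1 := by exact_mod_cast this
                  rw [hc]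
                  exact_mod_cast h2
        _ = c * ∑' n, (r n : ℝ≥0∞) ^ (s : ℝ) := ENNReal.tsum_mul_left
        _ ≤ c * (ε / c) := by gcongr; exact hsum.trans (min_le_right _ _)
        _ = ε := ENNReal.mul_div_cancel hc0 hcfin
  rw [hcov, dimH_iUnion]
  refine iSup_le fun N => ?_
  refine (dimH_le_of_hausdorffMeasure_ne_top (d := s + 1) (by rw [hzero N]; simp)).trans ?_
  rw [hsdef]
  push_cast
  rw [add_right_comm]

theorem dimH_add_span_singleton_le {F : Type*} [NormedAddCommGroup F] [NormedSpace ℝ F]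
    [SecondCountableTopology F] (E : Set F) (v : F) :
    dimH (E + (Submodule.span ℝ {v} : Set F)) ≤ dimH E + 1 := by
  have hlip : LipschitzWith (1 + ‖v‖₊) (fun p : F × ℝ => p.1 + p.2 • v) := by
    have h1 : LipschitzWith 1 (fun p : F × ℝ => p.1) := LipschitzWith.prod_fst
    have h2 : LipschitzWith (‖v‖₊ * 1) (fun p : F × ℝ => p.2 • v) := by
      refine LipschitzWith.comp (g := fun p : F × ℝ => p.2) (f := fun c : ℝ => c • v) ?_
        LipschitzWith.prod_snd
      refine LipschitzWith.of_dist_le_mul fun a b => ?_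
      rw [dist_eq_norm, ← sub_smul, norm_smul, mul_comm, dist_eq_norm]
      rfl
    simpa using h1.add h2
  have hsub : E + (Submodule.span ℝ {v} : Set F) ⊆
      (fun p : F × ℝ => p.1 + p.2 • v) '' (E ×ˢ univ) := by
    rintro _ ⟨e, he, w, hw, rfl⟩
    obtain ⟨c, rfl⟩ := Submodule.mem_span_singleton.1 hw
    exact ⟨(e, c), ⟨he, mem_univ _⟩, rfl⟩
  exact (dimH_mono hsub).trans ((hlip.dimH_image_le _).trans (dimH_prod_univ_real_le E))

/-- The subspace is added one basis vector at a time, each costing at most one dimension. -/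
theorem dimH_add_submodule_le {F : Type*} [NormedAddCommGroup F] [NormedSpace ℝ F]
    [FiniteDimensional ℝ F] (E : Set F) (V : Submodule ℝ F) :
    dimH (E + (V : Set F)) ≤ dimH E + Module.finrank ℝ V := by
  have : SecondCountableTopology F := by
    have := FiniteDimensional.proper ℝ F
    infer_instance
  have key : ∀ s : Finset F, dimH (E + (Submodule.span ℝ (s : Set F) : Set F)) ≤
      dimH E + s.card := by
    classical
    intro s
    induction s using Finset.induction_on with
    | empty => simp
    | insert v s hv ih =>
      rw [Finset.coe_insert, Submodule.span_insert, sup_comm, Submodule.coe_sup, ← add_assoc,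
        Finset.card_insert_of_notMem hv]
      refine (dimH_add_span_singleton_le _ v).trans ?_
      push_cast
      rw [← add_assoc]
      gcongr
  classical
  let b := Module.finBasis ℝ V
  have hspan : Submodule.span ℝ ((Finset.univ.image fun i => (b i : F) : Finset F) : Set F) = V := by
    rw [Finset.coe_image, Finset.coe_univ, image_univ]
    have : (range fun i => (b i : F)) = V.subtype '' range b := by rw [← range_comp]; rfl
    rw [this, ← Submodule.map_span, b.span_eq, Submodule.map_top, Submodule.range_subtype]
  have h := key (Finset.univ.image fun i => (b i : F))
  rw [hspan] at h
  refine h.trans ?_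
  gcongr
  exact Finset.card_image_le.trans (by simp)

/-! ### Net contents and the increasing sets lemma -/

section NetContent

variable {X Z : Type*}

/-- The cell of level `p.1` with label `p.2` of the sequence of labellings `q`. -/
def cell (q : ℕ → X → Z) (p : ℕ × Z) : Set X := {x | q p.1 x = p.2}

noncomputable def netCost (w : ℕ → ℝ≥0∞) (W : Set (ℕ × Z)) : ℝ≥0∞ :=
  ∑' p, W.indicator (fun p => w p.1) p

/-- The content of a set computed with covers by cells, a cell of level `n` having weight `w n`. -/
noncomputable def netContent (q : ℕ → X → Z) (w : ℕ → ℝ≥0∞) (E : Set X) : ℝ≥0∞ :=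
  ⨅ (W : Set (ℕ × Z)) (_ : E ⊆ ⋃ p ∈ W, cell q p), netCost w W

variable {q : ℕ → X → Z} {w : ℕ → ℝ≥0∞}

theorem netContent_le_cost {E : Set X} {W : Set (ℕ × Z)} (h : E ⊆ ⋃ p ∈ W, cell q p) :
    netContent q w E ≤ netCost w W :=
  iInf₂_le W h

theorem exists_cover_cost_le {E : Set X} {δ : ℝ≥0∞} (hδ : δ ≠ 0) (hE : netContent q w E ≠ ∞) :
    ∃ W : Set (ℕ × Z), E ⊆ (⋃ p ∈ W, cell q p) ∧ netCost w W ≤ netContent q w E + δ := by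
  have h : netContent q w E < netContent q w E + δ := ENNReal.lt_add_right hE hδ
  conv_lhs at h => rw [netContent]
  simp only [iInf_lt_iff] at h
  obtain ⟨W, hW, hlt⟩ := h
  exact ⟨W, hW, hlt.le⟩

theorem netContent_mono {E F : Set X} (h : E ⊆ F) : netContent q w E ≤ netContent q w F :=
  le_iInf₂ fun _ hW => netContent_le_cost (h.trans hW)

theorem netCost_singleton (p : ℕ × Z) : netCost w {p} = w p.1 := by
  classical
  rw [netCost, tsum_eq_single p]
  · simp
  · intro p' hp'; simp [hp']

theorem netContent_cell_le (p : ℕ × Z) : netContent q w (cell q p) ≤ w p.1 := by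
  rw [← netCost_singleton (w := w) p]
  exact netContent_le_cost (by simp)

theorem netCost_iUnion_le {ι : Type*} (W : ι → Set (ℕ × Z)) :
    netCost w (⋃ i, W i) ≤ ∑' i, netCost w (W i) := by
  unfold netCost
  rw [ENNReal.tsum_comm]
  refine ENNReal.tsum_le_tsum fun p => ?_
  by_cases hp : p ∈ ⋃ i, W i
  · obtain ⟨i, hi⟩ := mem_iUnion.1 hp
    rw [indicator_of_mem hp]
    calc w p.1 = (W i).indicator (fun p => w p.1) p := by rw [indicator_of_mem hi]
      _ ≤ _ := ENNReal.le_tsum i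
  · simp [indicator_of_notMem hp]

theorem netContent_iUnion_le {ι : Type*} [Countable ι] (E : ι → Set X) :
    netContent q w (⋃ i, E i) ≤ ∑' i, netContent q w (E i) := by
  refine ENNReal.le_of_forall_pos_le_add fun ε hε hfin => ?_
  obtain ⟨δ, hδ0, hδ⟩ := ENNReal.exists_pos_sum_of_countable (ε := (ε : ℝ≥0∞))
    (by exact_mod_cast hε.ne') ι
  have hEfin : ∀ i, netContent q w (E i) ≠ ∞ := fun i =>
    ne_top_of_le_ne_top hfin.ne (ENNReal.le_tsum i)
  choose W hW hcost using fun i => exists_cover_cost_le (w := w) (q := q) (E := E i)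
    (δ := (δ i : ℝ≥0∞)) (by exact_mod_cast (hδ0 i).ne') (hEfin i)
  calc netContent q w (⋃ i, E i) ≤ netCost w (⋃ i, W i) := by
        refine netContent_le_cost (iUnion_subset fun i => (hW i).trans ?_)
        exact biUnion_mono (subset_iUnion W i) fun _ _ => le_rfl
    _ ≤ ∑' i, netCost w (W i) := netCost_iUnion_le W
    _ ≤ ∑' i, (netContent q w (E i) + δ i) := ENNReal.tsum_le_tsum hcost
    _ = ∑' i, netContent q w (E i) + ∑' i, (δ i : ℝ≥0∞) := ENNReal.tsum_add
    _ ≤ _ := by gcongr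

/-- The cells of a family that lie in no strictly coarser cell of the family. -/
def maximalCells (q : ℕ → X → Z) (W : Set (ℕ × Z)) : Set (ℕ × Z) :=
  {p ∈ W | ∀ p' ∈ W, ¬(p'.1 < p.1 ∧ cell q p ⊆ cell q p')}

/-- Levels are natural numbers, so among the cells of the family through a point there is one of
least level, and no strictly coarser cell of the family contains it. -/
theorem iUnion_maximalCells (W : Set (ℕ × Z)) : (⋃ p ∈ maximalCells q W, cell q p) = ⋃ p ∈ W, cell q p := by
  classical
  refine Subset.antisymm (biUnion_mono (fun p hp => hp.1) fun _ _ => le_rfl) ?_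
  intro x hx
  have hex : ∃ n, ∃ p ∈ W, p.1 = n ∧ x ∈ cell q p := by
    obtain ⟨p, hp, hxp⟩ := mem_iUnion₂.1 hx
    exact ⟨p.1, p, hp, rfl, hxp⟩
  obtain ⟨p, hp, hpn, hxp⟩ := Nat.find_spec hex
  refine mem_iUnion₂.2 ⟨p, ⟨hp, ?_⟩, hxp⟩
  rintro p' hp' ⟨hlt, hsub⟩
  rw [hpn] at hlt
  exact Nat.find_min hex hlt ⟨p', hp', rfl, hsub hxp⟩

/-- Strong subadditivity of the content, at the level of covers. -/
theorem netCost_maximalCells_add_le (hq : ∀ m n, m ≤ n → ∀ x y, q n x = q n y → q m x = q m y)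
    {U V : Set (ℕ × Z)} {E : Set X} (hU : E ⊆ ⋃ p ∈ U, cell q p) (hV : E ⊆ ⋃ p ∈ V, cell q p) :
    netCost w (maximalCells q (U ∪ V)) + netContent q w E ≤ netCost w U + netCost w V := by
  classical
  -- At each point of `E` the finer of the two covering cells lies in `B`, so `B` covers `E`. A cell
  -- that is both maximal and in `B` belongs to `U` and to `V`, hence is paid for twice on the
  -- right. Empty cells are excluded from `B` because containment is vacuous for them and their
  -- label is not recovered from a point.
  let B : Set (ℕ × Z) := {p | (cell q p).Nonempty ∧
    ((p ∈ U ∧ ∃ v ∈ V, v.1 ≤ p.1 ∧ cell q p ⊆ cell q v) ∨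
      (p ∈ V ∧ ∃ u ∈ U, u.1 ≤ p.1 ∧ cell q p ⊆ cell q u))}
  have hB : E ⊆ ⋃ p ∈ B, cell q p := by
    intro x hx
    obtain ⟨u, hu, hxu⟩ := mem_iUnion₂.1 (hU hx)
    obtain ⟨v, hv, hxv⟩ := mem_iUnion₂.1 (hV hx)
    have hsub : ∀ a b : ℕ × Z, x ∈ cell q a → x ∈ cell q b → b.1 ≤ a.1 → cell q a ⊆ cell q b := by
      intro a b ha hb hab y hy
      have h1 : q a.1 y = q a.1 x := (show q a.1 y = a.2 from hy).trans
        (show q a.1 x = a.2 from ha).symm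
      exact (hq _ _ hab _ _ h1).trans hb
    rcases le_total v.1 u.1 with h | h
    · exact mem_iUnion₂.2 ⟨u, ⟨⟨x, hxu⟩, Or.inl ⟨hu, v, hv, h, hsub u v hxu hxv h⟩⟩, hxu⟩
    · exact mem_iUnion₂.2 ⟨v, ⟨⟨x, hxv⟩, Or.inr ⟨hv, u, hu, h, hsub v u hxv hxu h⟩⟩, hxv⟩
  refine (add_le_add_right (netContent_le_cost hB) _).trans ?_
  unfold netCost
  rw [← ENNReal.tsum_add, ← ENNReal.tsum_add]
  refine ENNReal.tsum_le_tsum fun p => ?_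
  have hexcl : ∀ T : Set (ℕ × Z), p ∈ maximalCells q (U ∪ V) → T ⊆ U ∪ V → (cell q p).Nonempty →
      (∃ v ∈ T, v.1 ≤ p.1 ∧ cell q p ⊆ cell q v) → p ∈ T := by
    rintro T hp hT ⟨x, hx⟩ ⟨v, hv, hle, hsub⟩
    rcases hle.lt_or_eq with hlt | heq
    · exact absurd ⟨hlt, hsub⟩ (hp.2 v (hT hv))
    · have h1 : q v.1 x = v.2 := hsub hx
      have h2 : q p.1 x = p.2 := hx
      have : p = v := Prod.ext heq.symm (by rw [← h1, ← h2, heq])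
      rwa [this]
  by_cases hT : p ∈ maximalCells q (U ∪ V) <;> by_cases hpB : p ∈ B
  · have hpUV : p ∈ U ∧ p ∈ V := by
      obtain ⟨hne, ⟨hu, h⟩ | ⟨hv, h⟩⟩ := hpB
      · exact ⟨hu, hexcl V hT subset_union_right hne h⟩
      · exact ⟨hexcl U hT subset_union_left hne h, hv⟩
    simp [indicator_of_mem hT, indicator_of_mem hpB, indicator_of_mem hpUV.1,
      indicator_of_mem hpUV.2]
  · rw [indicator_of_mem hT, indicator_of_notMem hpB, add_zero]
    rcases hT.1 with h | h
    · rw [indicator_of_mem h]; exact le_self_add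
    · rw [indicator_of_mem h]; exact le_add_self
  · rw [indicator_of_notMem hT, indicator_of_mem hpB, zero_add]
    rcases hpB.2 with h | h
    · rw [indicator_of_mem h.1]; exact le_self_add
    · rw [indicator_of_mem h.1]; exact le_add_self
  · simp [indicator_of_notMem hT, indicator_of_notMem hpB]

/-- The increasing sets lemma for net contents. -/
theorem netContent_iUnion_of_monotone
    (hq : ∀ m n, m ≤ n → ∀ x y, q n x = q n y → q m x = q m y)
    {E : ℕ → Set X} (hE : Monotone E) :
    netContent q w (⋃ j, E j) ≤ ⨆ j, netContent q w (E j) := by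
  classical
  refine ENNReal.le_of_forall_pos_le_add fun ε hε hfin => ?_
  obtain ⟨δ, hδ0, hδ⟩ := ENNReal.exists_pos_sum_of_countable (ε := (ε : ℝ≥0∞))
    (by exact_mod_cast hε.ne') ℕ
  have hEfin : ∀ i, netContent q w (E i) ≠ ∞ := fun i =>
    ne_top_of_le_ne_top hfin.ne (le_iSup (fun j => netContent q w (E j)) i)
  choose U hU hcost using fun i => exists_cover_cost_le (w := w) (q := q) (E := E i)
    (δ := (δ i : ℝ≥0∞)) (by exact_mod_cast (hδ0 i).ne') (hEfin i)
  -- The near-optimal covers are merged one after the other. Strong subadditivity lets the errors `δ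
  -- j` accumulate additively, the content of the previous set cancelling at each stage.
  let V : ℕ → Set (ℕ × Z) := fun J => Nat.rec (U 0) (fun n S => maximalCells q (S ∪ U (n + 1))) J
  have hVsucc : ∀ J, V (J + 1) = maximalCells q (V J ∪ U (J + 1)) := fun J => rfl
  have hVU : ∀ J, V J ⊆ ⋃ j, U j := by
    intro J
    induction J with
    | zero => exact subset_iUnion U 0
    | succ J ih =>
      rw [hVsucc]
      exact fun p hp => hp.1.elim (fun h => ih h) fun h => mem_iUnion.2 ⟨_, h⟩
  have hV : ∀ J, E J ⊆ (⋃ p ∈ V J, cell q p) ∧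
      netCost w (V J) ≤ netContent q w (E J) + ∑ j ∈ Finset.range (J + 1), (δ j : ℝ≥0∞) := by
    intro J
    induction J with
    | zero => exact ⟨hU 0, by simpa [V] using hcost 0⟩
    | succ J ih =>
      constructor
      · rw [hVsucc, iUnion_maximalCells]
        exact (hU (J + 1)).trans (biUnion_mono subset_union_right fun _ _ => le_rfl)
      · have h1 := netCost_maximalCells_add_le (w := w) hq ih.1
          ((hE J.le_succ).trans (hU (J + 1)))
        rw [← hVsucc] at h1
        rw [Finset.sum_range_succ]
        refine ENNReal.le_of_add_le_add_right (hEfin J) (h1.trans ?_)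
        refine (add_le_add ih.2 (hcost (J + 1))).trans (le_of_eq ?_)
        ring
  let W := maximalCells q (⋃ j, U j)
  have hWcov : (⋃ j, E j) ⊆ ⋃ p ∈ W, cell q p := by
    rw [iUnion_maximalCells]
    refine iUnion_subset fun j => (hU j).trans ?_
    exact biUnion_mono (subset_iUnion U j) fun _ _ => le_rfl
  -- A cell maximal in the whole union stays maximal in every finite stage once it has appeared.
  -- Hence any finite part of the cost of `W` is bounded by the cost of a single `V J`.
  have hWV : ∀ p ∈ W, ∃ j, ∀ J, j ≤ J → p ∈ V J := by
    intro p hp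
    obtain ⟨j, hj⟩ := mem_iUnion.1 hp.1
    have hmax : ∀ J, p ∈ V J ∪ U (J + 1) → p ∈ V (J + 1) := by
      intro J hJ
      refine ⟨hJ, fun p' hp' => hp.2 p' ?_⟩
      exact hp'.elim (fun h => hVU J h) fun h => mem_iUnion.2 ⟨_, h⟩
    refine ⟨j, fun J hJ => ?_⟩
    induction J, hJ using Nat.le_induction with
    | base =>
      cases j with
      | zero => exact hj
      | succ j => exact hmax j (Or.inr hj)
    | succ J _ ih => exact hmax J (Or.inl ih)
  refine (netContent_le_cost hWcov).trans ?_
  rw [netCost, ENNReal.tsum_eq_iSup_sum]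
  refine iSup_le fun F => ?_
  have hJ : ∃ J, ∀ p ∈ F, p ∈ W → p ∈ V J := by
    choose! j hj using hWV
    exact ⟨F.sup j, fun p hp hpW => hj p hpW _ (Finset.le_sup hp)⟩
  obtain ⟨J, hJ⟩ := hJ
  calc ∑ p ∈ F, W.indicator (fun p => w p.1) p
      ≤ ∑ p ∈ F, (V J).indicator (fun p => w p.1) p := by
        refine Finset.sum_le_sum fun p hp => ?_
        by_cases hpW : p ∈ W
        · rw [indicator_of_mem hpW, indicator_of_mem (hJ p hp hpW)]
        · rw [indicator_of_notMem hpW]; exact zero_le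
    _ ≤ netCost w (V J) := ENNReal.sum_le_tsum F
    _ ≤ netContent q w (E J) + ∑ j ∈ Finset.range (J + 1), (δ j : ℝ≥0∞) := (hV J).2
    _ ≤ (⨆ j, netContent q w (E j)) + ε :=
        add_le_add (le_iSup (fun j => netContent q w (E j)) J)
          ((ENNReal.sum_le_tsum _).trans hδ.le)

end NetContent

/-! ### Compact approximation of images of the Baire space -/

section Capacitability

/-- Sequences whose first `n` terms are bounded by those of `k`. -/
def boundedPrefix (k : ℕ → ℕ) (n : ℕ) : Set (ℕ → ℕ) := {σ | ∀ i < n, σ i ≤ k i}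

/-- Bounding the `n`-th term by `a` gives sets increasing with `a` whose union drops that bound, so
some finite `a` keeps `M` above `c`. The bounds are fixed one coordinate at a time and never
revised. -/
theorem exists_bounds_of_continuous_increasing {X : Type*} (f : (ℕ → ℕ) → X)
    (M : Set X → ℝ≥0∞)
    (hM : ∀ E : ℕ → Set X, Monotone E → M (⋃ j, E j) ≤ ⨆ j, M (E j)) {c : ℝ≥0∞}
    (hc : c < M (range f)) :
    ∃ k : ℕ → ℕ, ∀ n, c < M (f '' boundedPrefix k n) := by
  classical
  have step : ∀ n (k : ℕ → ℕ), c < M (f '' boundedPrefix k n) →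
      ∃ a, c < M (f '' boundedPrefix (Function.update k n a) (n + 1)) := by
    intro n k hk
    have hun : f '' boundedPrefix k n =
        ⋃ a, f '' boundedPrefix (Function.update k n a) (n + 1) := by
      rw [← image_iUnion]
      congr 1
      ext σ
      simp only [boundedPrefix, mem_ofPred_eq, mem_iUnion]
      constructor
      · intro h
        refine ⟨σ n, fun i hi => ?_⟩
        rcases Nat.lt_succ_iff_lt_or_eq.1 hi with hi | rfl
        · rw [Function.update_of_ne hi.ne]; exact h i hi
        · simp
      · rintro ⟨a, h⟩ i hi
        simpa [Function.update_of_ne hi.ne] using h i (hi.trans n.lt_succ_self)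
    have hmono : Monotone fun a => f '' boundedPrefix (Function.update k n a) (n + 1) := by
      intro a b hab
      refine image_mono fun σ hσ i hi => (hσ i hi).trans ?_
      rcases eq_or_ne i n with rfl | hin
      · simpa using hab
      · simp [Function.update_of_ne hin]
    have h1 := hk
    rw [hun] at h1
    obtain ⟨a, ha⟩ := lt_iSup_iff.1 (h1.trans_le (hM _ hmono))
    exact ⟨a, ha⟩
  have h0 : c < M (f '' boundedPrefix (fun _ => 0) 0) := by
    simpa [boundedPrefix] using hc
  let T : (n : ℕ) → {k : ℕ → ℕ // c < M (f '' boundedPrefix k n)} := fun n =>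
    Nat.rec ⟨fun _ => 0, h0⟩ (fun n k => ⟨Function.update k.1 n (step n k.1 k.2).choose,
      (step n k.1 k.2).choose_spec⟩) n
  have hT : ∀ n, (T (n + 1)).1 = Function.update (T n).1 n (step n (T n).1 (T n).2).choose :=
    fun n => rfl
  have hstab : ∀ i n, i < n → (T n).1 i = (T (i + 1)).1 i := by
    intro i n hin
    induction n, hin using Nat.le_induction with
    | base => rfl
    | succ n hn ih => rw [hT, Function.update_of_ne (Nat.ne_of_lt hn), ih]
  refine ⟨fun i => (T (i + 1)).1 i, fun n => ?_⟩
  have : boundedPrefix (fun i => (T (i + 1)).1 i) n = boundedPrefix (T n).1 n := by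
    ext σ
    simp only [boundedPrefix, mem_ofPred_eq]
    exact forall₂_congr fun i hi => by rw [hstab i n hi]
  rw [this]
  exact (T n).2

theorem isCompact_setOf_forall_le (k : ℕ → ℕ) : IsCompact {σ : ℕ → ℕ | ∀ i, σ i ≤ k i} := by
  have : {σ : ℕ → ℕ | ∀ i, σ i ≤ k i} = univ.pi fun i => Iic (k i) := by
    ext σ; simp [Pi.le_def]
  rw [this]
  exact isCompact_univ_pi fun i => (finite_Iic (k i)).isCompact

/-- Sequences outside `U` with longer and longer bounded prefixes, truncated at `k`, have a
subsequence converging in the compact set. The untruncated subsequence agrees eventually in each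
coordinate, so it has the same limit, which lies in the open set `U`. -/
theorem exists_boundedPrefix_subset {k : ℕ → ℕ} {U : Set (ℕ → ℕ)} (hU : IsOpen U)
    (h : {σ : ℕ → ℕ | ∀ i, σ i ≤ k i} ⊆ U) : ∃ n, boundedPrefix k n ⊆ U := by
  by_contra! hcon
  simp only [not_subset] at hcon
  choose σ hσ hσU using hcon
  have hτ : ∀ n, (fun i => min (σ n i) (k i)) ∈ {σ : ℕ → ℕ | ∀ i, σ i ≤ k i} :=
    fun n i => min_le_right _ _
  obtain ⟨τ, hτk, φ, hφ, hlim⟩ := (isCompact_setOf_forall_le k).tendsto_subseq hτ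
  have hlim' : Tendsto (σ ∘ φ) atTop (𝓝 τ) := by
    rw [tendsto_pi_nhds] at hlim ⊢
    intro i
    refine (hlim i).congr' ?_
    filter_upwards [eventually_gt_atTop i] with n hn
    have : σ (φ n) i ≤ k i := hσ (φ n) i (hn.trans_le (hφ.id_le n))
    simp [this]
  obtain ⟨n, hn⟩ := (hlim'.eventually (hU.mem_nhds (h hτk))).exists
  exact hσU _ hn

end Capacitability

/-! ### Dyadic cubes and compact subsets of positive content -/

section Dyadic

variable {ι : Type*}

/-- The label of the half-open dyadic cube of side `2⁻ⁿ` containing `x`. -/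
noncomputable def dyadicLabel (n : ℕ) (x : ι → ℝ) : ι → ℤ := fun i => ⌊2 ^ n * x i⌋

/-- The label of the dyadic cube of twice the side containing the cube labelled `z`. -/
def dyadicParent (z : ι → ℤ) : ι → ℤ := fun i => z i / 2

/-- The weight `2^(-ns)` of a dyadic cube of level `n`. -/
noncomputable def dyadicWeight (s : ℝ≥0) (n : ℕ) : ℝ≥0∞ := ((2⁻¹ : ℝ≥0∞) ^ n) ^ (s : ℝ)

theorem dyadicParent_label (n : ℕ) (x : ι → ℝ) :
    dyadicParent (dyadicLabel (n + 1) x) = dyadicLabel n x := by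
  funext i
  have h := Int.floor_div_natCast ((2 : ℝ) ^ (n + 1) * x i) 2
  have e : (2 : ℝ) ^ (n + 1) * x i / (2 : ℕ) = 2 ^ n * x i := by push_cast; ring
  rw [e] at h
  exact h.symm

theorem dyadicParent_iterate_label (n j : ℕ) (x : ι → ℝ) :
    dyadicParent^[j] (dyadicLabel (n + j) x) = dyadicLabel n x := by
  induction j with
  | zero => rfl
  | succ j ih => rw [Function.iterate_succ_apply, ← add_assoc, dyadicParent_label, ih]

theorem dyadicLabel_eq_of_le (m n : ℕ) (h : m ≤ n) (x y : ι → ℝ)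
    (hxy : dyadicLabel n x = dyadicLabel n y) : dyadicLabel m x = dyadicLabel m y := by
  obtain ⟨j, rfl⟩ := Nat.exists_eq_add_of_le h
  rw [← dyadicParent_iterate_label m j x, ← dyadicParent_iterate_label m j y, hxy]

theorem finite_dyadicParent_fiber [Finite ι] (z : ι → ℤ) : {z' | dyadicParent z' = z}.Finite := by
  refine (Set.Finite.pi' (t := fun i => Icc (2 * z i) (2 * z i + 1))
    fun i => finite_Icc _ _).subset ?_
  intro z' hz' i
  have : z' i / 2 = z i := congrFun hz' i
  simp only [mem_Icc]
  omega

theorem dyadicWeight_ne_top (s : ℝ≥0) (n : ℕ) : dyadicWeight s n ≠ ∞ :=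
  ENNReal.rpow_ne_top_of_nonneg s.2 (by finiteness)

theorem ediam_cell_le [Fintype ι] (p : ℕ × (ι → ℤ)) :
    Metric.ediam (cell dyadicLabel p) ≤ (2⁻¹ : ℝ≥0∞) ^ p.1 := by
  refine Metric.ediam_le fun x hx y hy => ?_
  have hxy : dyadicLabel p.1 x = dyadicLabel p.1 y :=
    (show dyadicLabel p.1 x = p.2 from hx).trans (show dyadicLabel p.1 y = p.2 from hy).symm
  have h2 : ((2⁻¹ : ℝ≥0∞) ^ p.1) = ENNReal.ofReal ((2⁻¹ : ℝ) ^ p.1) := by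
    rw [ENNReal.ofReal_pow (by norm_num), ENNReal.ofReal_inv_of_pos (by norm_num)]; simp
  rw [h2, edist_dist]
  refine ENNReal.ofReal_le_ofReal ((dist_pi_le_iff (by positivity)).2 fun i => ?_)
  have h := Int.abs_sub_lt_one_of_floor_eq_floor (congrFun hxy i)
  rw [← mul_sub, abs_mul, abs_of_pos (by positivity : (0 : ℝ) < 2 ^ p.1)] at h
  rw [Real.dist_eq, inv_pow, ← one_div, le_div_iff₀ (by positivity)]
  linarith

/-- Scaled by `2 ^ n`, the coordinates differ by less than 2, so their floors differ by at most 2.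
The five possible differences are encoded in `Fin 5` with offset 2. -/
theorem exists_label_eq_of_dist_lt [Fintype ι] {n : ℕ} {x y : ι → ℝ}
    (h : dist x y < 2 * (2⁻¹ : ℝ) ^ n) :
    ∃ e : ι → Fin 5, dyadicLabel n x = fun i => dyadicLabel n y i + ((e i : ℕ) : ℤ) - 2 := by
  have key : ∀ i, -2 ≤ dyadicLabel n x i - dyadicLabel n y i ∧
      dyadicLabel n x i - dyadicLabel n y i ≤ 2 := by
    intro i
    have h1 : |x i - y i| < 2 * (2⁻¹ : ℝ) ^ n := (dist_le_pi_dist x y i).trans_lt h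
    have h3 : |2 ^ n * x i - 2 ^ n * y i| < 2 := by
      rw [← mul_sub, abs_mul, abs_of_pos (by positivity : (0 : ℝ) < 2 ^ n)]
      have : (2 : ℝ) ^ n * (2 * (2⁻¹ : ℝ) ^ n) = 2 := by
        rw [inv_pow]; field_simp
      calc (2 : ℝ) ^ n * |x i - y i| < 2 ^ n * (2 * (2⁻¹ : ℝ) ^ n) :=
            mul_lt_mul_of_pos_left h1 (by positivity)
        _ = 2 := this
    rw [abs_lt] at h3
    have a1 := Int.floor_le (2 ^ n * x i)
    have a2 := Int.lt_floor_add_one (2 ^ n * x i)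
    have b1 := Int.floor_le (2 ^ n * y i)
    have b2 := Int.lt_floor_add_one (2 ^ n * y i)
    simp only [dyadicLabel]
    constructor
    · have : (-3 : ℝ) < ((⌊2 ^ n * x i⌋ - ⌊2 ^ n * y i⌋ : ℤ) : ℝ) := by push_cast; linarith
      have : (-3 : ℤ) < ⌊2 ^ n * x i⌋ - ⌊2 ^ n * y i⌋ := by exact_mod_cast this
      omega
    · have : ((⌊2 ^ n * x i⌋ - ⌊2 ^ n * y i⌋ : ℤ) : ℝ) < 3 := by push_cast; linarith
      have : ⌊2 ^ n * x i⌋ - ⌊2 ^ n * y i⌋ < (3 : ℤ) := by exact_mod_cast this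
      omega
  refine ⟨fun i => ⟨(dyadicLabel n x i - dyadicLabel n y i + 2).toNat, ?_⟩, ?_⟩
  · have := key i; omega
  · funext i
    have := key i
    simp only
    omega

theorem measurableSet_cell_dyadicLabel [Fintype ι] (p : ℕ × (ι → ℤ)) :
    MeasurableSet (cell (dyadicLabel (ι := ι)) p) := by
  have : Measurable (dyadicLabel (ι := ι) p.1) := by
    refine measurable_pi_lambda _ fun i => ?_
    exact Int.measurable_floor.comp ((measurable_pi_apply i).const_mul _)
  exact this (measurableSet_singleton p.2)

/-- No bound on the scale of the cells is needed, because for `s > 0` a small total cost forces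
every cell used to be small. -/
theorem hausdorffMeasure_eq_zero_of_netContent [Fintype ι] {s : ℝ≥0} (hs : 0 < s)
    {A : Set (ι → ℝ)} (h : netContent dyadicLabel (dyadicWeight s) A = 0) :
    μH[(s : ℝ)] A = 0 := by
  refine hausdorffMeasure_eq_zero_of_covers (NNReal.coe_pos.2 hs) fun ε hε => ?_
  obtain ⟨W, hW, hcost⟩ := exists_cover_cost_le hε.ne' (by rw [h]; simp)
  rw [h, zero_add] at hcost
  refine ⟨W, inferInstance, fun p => cell dyadicLabel p.1, ?_, ?_⟩
  · rwa [iUnion_subtype]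
  · refine le_trans ?_ hcost
    rw [netCost, ← tsum_subtype]
    exact ENNReal.tsum_le_tsum fun p => ENNReal.rpow_le_rpow (ediam_cell_le _) s.2

theorem exists_isCompact_netContent_ne_zero [Fintype ι] {s : ℝ≥0} {A : Set (ι → ℝ)}
    (hA : AnalyticSet A) (h : netContent dyadicLabel (dyadicWeight s) A ≠ 0) :
    ∃ C ⊆ A, IsCompact C ∧ netContent dyadicLabel (dyadicWeight s) C ≠ 0 := by
  classical
  rw [AnalyticSet] at hA
  rcases hA with rfl | ⟨f, hf, rfl⟩
  · exact absurd (le_antisymm ((netContent_le_cost (W := ∅) (by simp)).trans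
      (by simp [netCost])) zero_le) h
  obtain ⟨c, hc0, hc⟩ := exists_between (pos_iff_ne_zero.2 h)
  obtain ⟨k, hk⟩ := exists_bounds_of_continuous_increasing f
    (netContent dyadicLabel (dyadicWeight s))
    (fun E hE => netContent_iUnion_of_monotone dyadicLabel_eq_of_le hE) hc
  refine ⟨f '' {σ | ∀ i, σ i ≤ k i}, image_subset_range _ _,
    (isCompact_setOf_forall_le k).image hf, fun h0 => ?_⟩
  -- A thickened cell is covered by `N` cells of its own level. A cover of the compact set of cost
  -- `c / N` would, after thickening to an open cover, also cover the image of some prefix set,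
  -- whose content would then be at most `c`.
  set N : ℝ≥0∞ := ((Fintype.card (ι → Fin 5) : ℕ) : ℝ≥0∞) with hN
  have hN0 : N ≠ 0 := by
    rw [hN]; exact_mod_cast Fintype.card_ne_zero
  have hNt : N ≠ ∞ := ENNReal.natCast_ne_top _
  have hδ : c / N ≠ 0 := (ENNReal.div_pos hc0.ne' hNt).ne'
  obtain ⟨W, hW, hcost⟩ := exists_cover_cost_le hδ (by rw [h0]; simp)
  rw [h0, zero_add] at hcost
  have hopen : IsOpen (⋃ p ∈ W, Metric.thickening ((2⁻¹ : ℝ) ^ p.1) (cell dyadicLabel p)) :=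
    isOpen_biUnion fun p _ => Metric.isOpen_thickening
  obtain ⟨n, hn⟩ := exists_boundedPrefix_subset (hopen.preimage hf) (k := k) (by
    intro σ hσ
    obtain ⟨p, hp, hxp⟩ := mem_iUnion₂.1 (hW (mem_image_of_mem f hσ))
    exact mem_iUnion₂.2 ⟨p, hp, Metric.self_subset_thickening (by positivity) _ hxp⟩)
  let V : (ι → Fin 5) → Set (ℕ × (ι → ℤ)) := fun e =>
    {p | (p.1, fun i => p.2 i - ((e i : ℕ) : ℤ) + 2) ∈ W}
  have hcov : f '' boundedPrefix k n ⊆ ⋃ p ∈ ⋃ e, V e, cell dyadicLabel p := by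
    rintro _ ⟨σ, hσ, rfl⟩
    obtain ⟨p, hp, hxp⟩ := mem_iUnion₂.1 (hn hσ)
    obtain ⟨y, hy, hd⟩ := Metric.mem_thickening_iff.1 hxp
    obtain ⟨e, he⟩ := exists_label_eq_of_dist_lt (n := p.1) (hd.trans_le
      (by linarith [show (0 : ℝ) < 2⁻¹ ^ p.1 by positivity]))
    refine mem_iUnion₂.2 ⟨(p.1, dyadicLabel p.1 (f σ)), mem_iUnion.2 ⟨e, ?_⟩, rfl⟩
    have : (p.1, fun i => dyadicLabel p.1 (f σ) i - ((e i : ℕ) : ℤ) + 2) = p := by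
      refine Prod.ext rfl ?_
      rw [← (show dyadicLabel p.1 y = p.2 from hy)]
      funext i
      simp only [he]
      ring
    change (p.1, fun i => dyadicLabel p.1 (f σ) i - ((e i : ℕ) : ℤ) + 2) ∈ W
    rwa [this]
  -- The weight depends only on the level, so shifting labels preserves the cost.
  have hVcost : ∀ e, netCost (dyadicWeight s) (V e) = netCost (dyadicWeight s) W := by
    intro e
    let E : ℕ × (ι → ℤ) ≃ ℕ × (ι → ℤ) := (Equiv.refl ℕ).prodCongr
      (Equiv.addRight (fun i => 2 - ((e i : ℕ) : ℤ)))
    unfold netCost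
    rw [← E.tsum_eq (W.indicator _)]
    refine tsum_congr fun p => ?_
    have hE : E p = (p.1, fun i => p.2 i - ((e i : ℕ) : ℤ) + 2) := by
      refine Prod.ext rfl ?_
      funext i
      simp [E]
      ring
    have hiff : p ∈ V e ↔ E p ∈ W := by rw [hE]; rfl
    by_cases hp : p ∈ V e
    · rw [indicator_of_mem hp, indicator_of_mem (hiff.1 hp), hE]
    · rw [indicator_of_notMem hp, indicator_of_notMem (mt hiff.2 hp)]
  refine absurd (hk n) (not_lt.2 ?_)
  calc netContent dyadicLabel (dyadicWeight s) (f '' boundedPrefix k n)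
      ≤ netCost (dyadicWeight s) (⋃ e, V e) := netContent_le_cost hcov
    _ ≤ ∑' e, netCost (dyadicWeight s) (V e) := netCost_iUnion_le V
    _ = N * netCost (dyadicWeight s) W := by
        simp only [hVcost]
        rw [tsum_fintype, Finset.sum_const, Finset.card_univ, nsmul_eq_mul]
    _ ≤ N * (c / N) := by gcongr
    _ = c := ENNReal.mul_div_cancel hN0 hNt

end Dyadic

/-! ### Conserved flows on a locally finite tree -/

section Flow

variable {Z : Type*} [DecidableEq Z]

/-- A subadditive function on a locally finite tree dominates a conserved flow with the same
value at the root. -/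
theorem exists_flow (par : Z → Z) (hfin : ∀ z, {z' | par z' = z}.Finite) (h : ℕ → Z → ℝ≥0∞)
    (hle : ∀ n z, h n z ≤ ∑' z', if par z' = z then h (n + 1) z' else 0)
    (htop : ∀ n z, h n z ≠ ∞) (z₀ : Z) :
    ∃ g : ℕ → Z → ℝ≥0∞, (∀ n z, g n z ≤ h n z) ∧
      (∀ n z, (∑' z', if par z' = z then g (n + 1) z' else 0) = g n z) ∧
      ∑' z, g 0 z = h 0 z₀ := by
  let H : ℕ → Z → ℝ≥0∞ := fun n z => ∑' z', if par z' = z then h (n + 1) z' else 0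
  have hH : ∀ n z, H n z ≠ ∞ := by
    intro n z
    have : H n z = ∑ z' ∈ (hfin z).toFinset, h (n + 1) z' := by
      simp only [H]
      rw [tsum_eq_sum (s := (hfin z).toFinset)]
      · refine Finset.sum_congr rfl fun z' hz' => ?_
        have : par z' = z := by simpa using hz'
        simp [this]
      · intro z' hz'
        have : par z' ≠ z := by simpa using hz'
        simp [this]
    rw [this]
    exact ENNReal.sum_ne_top.2 fun z' _ => htop _ _
  -- The flow through a vertex is shared among its children in proportion to `h`. The ratio is at
  -- most 1 because `g ≤ h ≤ H`, and where `H` vanishes so does `g`.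
  let g : ℕ → Z → ℝ≥0∞ := fun n => Nat.rec (fun z => if z = z₀ then h 0 z₀ else 0)
    (fun n gn z' => h (n + 1) z' * (gn (par z') / H n (par z'))) n
  have hg0 : g 0 = fun z => if z = z₀ then h 0 z₀ else 0 := rfl
  have hgs : ∀ n, g (n + 1) = fun z' => h (n + 1) z' * (g n (par z') / H n (par z')) :=
    fun n => rfl
  have hgh : ∀ n z, g n z ≤ h n z := by
    intro n
    induction n with
    | zero =>
      intro z
      rw [hg0]
      by_cases hz : z = z₀ <;> simp [hz]
    | succ n ih =>
      intro z
      rw [hgs]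
      refine mul_le_of_le_one_right' (ENNReal.div_le_of_le_mul ?_)
      rw [one_mul]
      exact (ih _).trans (hle _ _)
  refine ⟨g, hgh, fun n z => ?_, ?_⟩
  · have h1 : (∑' z', if par z' = z then g (n + 1) z' else 0) = H n z * (g n z / H n z) := by
      simp only [H]
      rw [← ENNReal.tsum_mul_right]
      refine tsum_congr fun z' => ?_
      by_cases hz : par z' = z
      · simp only [hgs, hz, H, if_true]
      · simp [hz]
    rw [h1]
    rcases eq_or_ne (H n z) 0 with h0 | h0
    · have : g n z = 0 := le_antisymm (((hgh n z).trans (hle n z)).trans h0.le) zero_le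
      simp [this]
    · exact ENNReal.mul_div_cancel h0 (hH n z)
  · rw [hg0, tsum_ite_eq]

theorem tsum_flow_iterate {par : Z → Z} {g : ℕ → Z → ℝ≥0∞}
    (hg : ∀ n z, (∑' z', if par z' = z then g (n + 1) z' else 0) = g n z) (n j : ℕ) (z : Z) :
    (∑' z', if par^[j] z' = z then g (n + j) z' else 0) = g n z := by
  induction j with
  | zero => simp
  | succ j ih =>
    rw [← ih]
    simp_rw [← hg (n + j), Function.iterate_succ_apply]
    have h1 : ∀ y, (if par^[j] y = z then (∑' z', if par z' = y then g (n + j + 1) z' else 0)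
        else 0) = ∑' z', if par z' = y then (if par^[j] y = z then g (n + j + 1) z' else 0)
          else 0 := by
      intro y
      by_cases hy : par^[j] y = z <;> simp [hy]
    simp_rw [h1]
    rw [ENNReal.tsum_comm]
    refine tsum_congr fun z' => ?_
    rw [tsum_eq_single (par z') (fun y hy => by simp [hy.symm])]
    simp only [if_true, add_assoc]
    by_cases h : par^[j] (par z') = z <;> simp [h]

theorem tsum_flow_level {par : Z → Z} {g : ℕ → Z → ℝ≥0∞}
    (hg : ∀ n z, (∑' z', if par z' = z then g (n + 1) z' else 0) = g n z)
    (n : ℕ) : ∑' z, g n z = ∑' z, g 0 z := by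
  induction n with
  | zero => rfl
  | succ n ih =>
    rw [← ih]
    have : ∀ z, g n z = ∑' z', if par z' = z then g (n + 1) z' else 0 := fun z => by
      rw [← hg n z]
    simp_rw [this]
    rw [ENNReal.tsum_comm]
    refine tsum_congr fun z' => ?_
    rw [tsum_eq_single (par z') (fun y hy => by simp [hy.symm])]
    simp

end Flow

/-! ### Frostman's lemma -/

section Frostman

theorem two_inv_pow_eq_ofReal (n : ℕ) : ((2⁻¹ : ℝ≥0∞) ^ n) = ENNReal.ofReal ((2⁻¹ : ℝ) ^ n) := by
  rw [ENNReal.ofReal_pow (by norm_num), ENNReal.ofReal_inv_of_pos (by norm_num)]; simp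

/-- `μ` is a probability measure carried by `C` with `μ(B(x, r)) ≲ r ^ s`. -/
structure IsFrostman {E : Type*} [PseudoMetricSpace E] [MeasurableSpace E] (μ : Measure E)
    (C : Set E) (s : ℝ≥0) : Prop where
  isProbabilityMeasure : IsProbabilityMeasure μ
  measure_compl : μ Cᶜ = 0
  exists_bound : ∃ M : ℝ≥0, ∀ x : E, ∀ r : ℝ, 0 < r →
    μ (Metric.closedBall x r) ≤ M * ENNReal.ofReal r ^ (s : ℝ)

theorem netContent_empty {X Z : Type*} {q : ℕ → X → Z} {w : ℕ → ℝ≥0∞} :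
    netContent q w ∅ = 0 :=
  le_antisymm ((netContent_le_cost (W := ∅) (by simp)).trans (by simp [netCost])) zero_le

/-- A flow along the dyadic cubes meeting a compact set is realised by a measure on that set. -/
theorem exists_measure_of_dyadic_flow {ι : Type*} [Fintype ι] {s : ℝ≥0} {C : Set (ι → ℝ)}
    (hC : IsCompact C) {g : ℕ → (ι → ℤ) → ℝ≥0∞}
    (hgC : ∀ n z, g n z ≠ 0 → (C ∩ cell dyadicLabel (n, z)).Nonempty)
    (hgw : ∀ n z, g n z ≤ dyadicWeight s n)
    (hg : ∀ n z, (∑' z', if dyadicParent z' = z then g (n + 1) z' else 0) = g n z)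
    (h0 : ∑' z, g 0 z ≠ 0) (htop : ∑' z, g 0 z ≠ ∞) :
    ∃ μ : Measure (ι → ℝ), IsFrostman μ C s := by
  classical
  set m := ∑' z, g 0 z with hm
  have hCne : C.Nonempty := by
    obtain ⟨z, hz⟩ : ∃ z, g 0 z ≠ 0 := by
      by_contra! hcon
      exact h0 (by rw [hm]; simp [hcon])
    exact (hgC 0 z hz).mono inter_subset_left
  have : CompactSpace C := isCompact_iff_compactSpace.1 hC
  have : Nonempty C := hCne.to_subtype
  have hpt : ∀ n z, ∃ x : C, g n z ≠ 0 → (x : ι → ℝ) ∈ cell dyadicLabel (n, z) := by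
    intro n z
    by_cases hz : g n z = 0
    · exact ⟨Classical.arbitrary C, fun h => absurd hz h⟩
    · obtain ⟨x, hxC, hx⟩ := hgC n z hz
      exact ⟨⟨x, hxC⟩, fun _ => hx⟩
  choose pt hpt using hpt
  -- At stage `n` the flow through each cube is concentrated at one point of `C` in that cube.
  -- Conservation of the flow then controls the mass of every coarser cube at all later stages.
  let ν : ℕ → Measure C := fun n => Measure.sum fun z => (g n z / m) • Measure.dirac (pt n z)
  have hν : ∀ n, IsProbabilityMeasure (ν n) := by
    intro n
    constructor
    simp only [ν]
    rw [Measure.sum_apply _ MeasurableSet.univ]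
    simp only [Measure.smul_apply, measure_univ, smul_eq_mul, mul_one, div_eq_mul_inv]
    rw [ENNReal.tsum_mul_right, tsum_flow_level hg n, ← hm, ENNReal.mul_inv_cancel h0 htop]
  have hνcell : ∀ j n, j ≤ n → ∀ z, ν n ((↑) ⁻¹' cell dyadicLabel (j, z)) ≤ g j z / m := by
    intro j n hjn z
    obtain ⟨l, rfl⟩ := Nat.exists_eq_add_of_le hjn
    have hmeas : MeasurableSet (((↑) : C → ι → ℝ) ⁻¹' cell dyadicLabel (j, z)) :=
      measurable_subtype_coe (measurableSet_cell_dyadicLabel _)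
    simp only [ν]
    rw [Measure.sum_apply _ hmeas, ← tsum_flow_iterate hg j l z, div_eq_mul_inv,
      ← ENNReal.tsum_mul_right]
    refine ENNReal.tsum_le_tsum fun z' => ?_
    rw [Measure.smul_apply, Measure.dirac_apply' _ hmeas, smul_eq_mul, div_eq_mul_inv]
    by_cases hz' : g (j + l) z' = 0
    · simp [hz']
    by_cases hmem : pt (j + l) z' ∈ ((↑) : C → ι → ℝ) ⁻¹' cell dyadicLabel (j, z)
    · have h1 : dyadicLabel (j + l) (pt (j + l) z' : ι → ℝ) = z' := hpt (j + l) z' hz'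
      have h2 : dyadicLabel j (pt (j + l) z' : ι → ℝ) = z := hmem
      have h3 : dyadicParent^[l] z' = z := by
        rw [← h2, ← dyadicParent_iterate_label j l, h1]
      simp [h3, hmem]
    · simp [hmem]
  let P : ℕ → ProbabilityMeasure C := fun n => ⟨ν n, hν n⟩
  obtain ⟨μ, -, φ, hφ, hlim⟩ := (isCompact_univ (X := ProbabilityMeasure C)).tendsto_subseq
    (x := P) fun n => mem_univ _
  have hball : ∀ x : ι → ℝ, ∀ j : ℕ, (μ : Measure C) ((↑) ⁻¹' Metric.closedBall x (2⁻¹ ^ j)) ≤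
      Fintype.card (ι → Fin 5) * m⁻¹ * dyadicWeight s j := by
    intro x j
    -- Weak convergence passes upper bounds to the limit only on open sets, so the closed ball is
    -- enclosed in an open ball of twice the radius.
    let G : Set C := (↑) ⁻¹' Metric.ball x (2 * 2⁻¹ ^ j)
    have hG : IsOpen G := Metric.isOpen_ball.preimage continuous_subtype_val
    have hsub : ((↑) ⁻¹' Metric.closedBall x (2⁻¹ ^ j) : Set C) ⊆ G :=
      preimage_mono (Metric.closedBall_subset_ball (by
        linarith [show (0 : ℝ) < 2⁻¹ ^ j by positivity]))
    have hGn : ∀ n, j ≤ n → ν n G ≤ Fintype.card (ι → Fin 5) * m⁻¹ * dyadicWeight s j := by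
      intro n hn
      have hGsub : G ⊆ ⋃ e : ι → Fin 5, ((↑) ⁻¹' cell dyadicLabel
          (j, fun i => dyadicLabel j x i + ((e i : ℕ) : ℤ) - 2) : Set C) := by
        intro y hy
        obtain ⟨e, he⟩ := exists_label_eq_of_dist_lt (n := j) (Metric.mem_ball.1 hy)
        exact mem_iUnion.2 ⟨e, he⟩
      refine (measure_mono hGsub).trans ((measure_iUnion_fintype_le _ _).trans ?_)
      calc _ ≤ ∑ _e : ι → Fin 5, dyadicWeight s j / m := Finset.sum_le_sum fun e _ =>
            (hνcell j n hn _).trans (ENNReal.div_le_div_right (hgw _ _) _)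
        _ = _ := by
            rw [Finset.sum_const, Finset.card_univ, nsmul_eq_mul, div_eq_mul_inv, mul_assoc,
              mul_comm (dyadicWeight s j)]
    refine (measure_mono hsub).trans
      ((ProbabilityMeasure.le_liminf_measure_open_of_tendsto hlim hG).trans ?_)
    refine liminf_le_of_frequently_le' (Eventually.frequently ?_)
    filter_upwards [eventually_ge_atTop j] with n hn
    exact hGn _ (hn.trans (hφ.id_le n))
  have hKtop : ((Fintype.card (ι → Fin 5) : ℕ) : ℝ≥0∞) * m⁻¹ ≠ ∞ :=
    ENNReal.mul_ne_top (ENNReal.natCast_ne_top _) (ENNReal.inv_ne_top.2 h0)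
  set K : ℝ≥0 := (((Fintype.card (ι → Fin 5) : ℕ) : ℝ≥0∞) * m⁻¹).toNNReal with hK
  have hprob : IsProbabilityMeasure ((μ : Measure C).map ((↑) : C → ι → ℝ)) :=
    Measure.isProbabilityMeasure_map measurable_subtype_coe.aemeasurable
  refine ⟨(μ : Measure C).map (↑), hprob, ?_, K * 2 ^ (s : ℝ) + 1, ?_⟩
  · rw [Measure.map_apply measurable_subtype_coe hC.measurableSet.compl]
    simp
  · intro x r hr
    rcases le_or_gt r 1 with hr1 | hr1
    · obtain ⟨j, hj1, hj2⟩ := exists_two_inv_pow_near r hr hr1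
      rw [Measure.map_apply measurable_subtype_coe Metric.isClosed_closedBall.measurableSet]
      calc _ ≤ (μ : Measure C) ((↑) ⁻¹' Metric.closedBall x (2⁻¹ ^ j)) :=
            measure_mono (preimage_mono (Metric.closedBall_subset_closedBall hj1))
        _ ≤ K * dyadicWeight s j := by
            rw [hK, ENNReal.coe_toNNReal hKtop]; exact hball x j
        _ ≤ K * (2 * ENNReal.ofReal r) ^ (s : ℝ) := by
            rw [dyadicWeight, two_inv_pow_eq_ofReal]
            gcongr
            refine (ENNReal.ofReal_le_ofReal hj2).trans ?_
            rw [ENNReal.ofReal_mul (by norm_num)]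
            simp
        _ ≤ _ := by
            rw [ENNReal.mul_rpow_of_nonneg _ _ s.coe_nonneg, ← mul_assoc]
            gcongr
            push_cast
            rw [ENNReal.coe_rpow_of_nonneg _ s.coe_nonneg]
            simp
    -- For `r > 1` the total mass 1 is bound enough; the summand 1 in the constant is there for this
    -- case.
    · refine prob_le_one.trans ?_
      have h1 : (1 : ℝ≥0∞) ≤ ENNReal.ofReal r ^ (s : ℝ) :=
        (ENNReal.one_rpow (s : ℝ)).symm.le.trans
          (ENNReal.rpow_le_rpow (by simpa using hr1.le) s.coe_nonneg)
      calc (1 : ℝ≥0∞) = 1 * 1 := (one_mul 1).symm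
        _ ≤ _ := mul_le_mul' (by push_cast; exact le_add_self) h1

/-- **Frostman's lemma** for Borel subsets of `ι → ℝ`. -/
theorem exists_isFrostman_pi {ι : Type*} [Fintype ι] {s : ℝ≥0} (hs : 0 < s) {A : Set (ι → ℝ)}
    (hA : MeasurableSet A) (h : μH[(s : ℝ)] A ≠ 0) :
    ∃ C ⊆ A, IsCompact C ∧ ∃ μ : Measure (ι → ℝ), IsFrostman μ C s := by
  classical
  -- Restricting to a single unit cube gives the tree one root.
  obtain ⟨z₀, hz₀⟩ : ∃ z₀, μH[(s : ℝ)] (A ∩ cell dyadicLabel (0, z₀)) ≠ 0 := by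
    by_contra! hcon
    refine h (measure_mono_null ?_ (measure_iUnion_null hcon))
    intro x hx
    exact mem_iUnion.2 ⟨dyadicLabel 0 x, hx, rfl⟩
  have hA0 : MeasurableSet (A ∩ cell dyadicLabel (0, z₀)) :=
    hA.inter (measurableSet_cell_dyadicLabel _)
  obtain ⟨C, hCA, hC, hC0⟩ := exists_isCompact_netContent_ne_zero (s := s) hA0.analyticSet
    (mt (hausdorffMeasure_eq_zero_of_netContent hs) hz₀)
  -- The content of the part of `C` in a cube is subadditive over the children and at most the
  -- weight of the cube, so a flow below it has the growth required of a Frostman measure.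
  let f : ℕ → (ι → ℤ) → ℝ≥0∞ := fun n z =>
    netContent dyadicLabel (dyadicWeight s) (C ∩ cell dyadicLabel (n, z))
  have hfw : ∀ n z, f n z ≤ dyadicWeight s n := fun n z =>
    (netContent_mono inter_subset_right).trans (netContent_cell_le (n, z))
  have hf0 : f 0 z₀ = netContent dyadicLabel (dyadicWeight s) C := by
    simp only [f]
    rw [inter_eq_left.2 (hCA.trans inter_subset_right)]
  obtain ⟨g, hgf, hg, hgsum⟩ := exists_flow dyadicParent finite_dyadicParent_fiber f (by
    intro n z
    have hsub : C ∩ cell dyadicLabel (n, z) ⊆ ⋃ z' : ι → ℤ,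
        if dyadicParent z' = z then C ∩ cell dyadicLabel (n + 1, z') else ∅ := by
      rintro x ⟨hxC, hx⟩
      refine mem_iUnion.2 ⟨dyadicLabel (n + 1) x, ?_⟩
      have hx' : dyadicLabel n x = z := hx
      rw [dyadicParent_label, if_pos hx']
      exact ⟨hxC, rfl⟩
    refine (netContent_mono hsub).trans ((netContent_iUnion_le _).trans ?_)
    refine ENNReal.tsum_le_tsum fun z' => ?_
    split_ifs
    · exact le_rfl
    · rw [netContent_empty])
    (fun n z => ne_top_of_le_ne_top (dyadicWeight_ne_top s n) (hfw n z)) z₀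
  refine ⟨C, hCA.trans inter_subset_left, hC, exists_measure_of_dyadic_flow hC (g := g) ?_
    (fun n z => (hgf n z).trans (hfw n z)) (fun n z => ?_) (by rwa [hgsum, hf0]) ?_⟩
  · intro n z hz
    by_contra hcon
    rw [not_nonempty_iff_eq_empty] at hcon
    refine hz (le_antisymm ((hgf n z).trans ?_) zero_le)
    simp only [f, hcon, netContent_empty, le_refl]
  · rw [← hg n z]
  · rw [hgsum]
    exact ne_top_of_le_ne_top (dyadicWeight_ne_top s 0) (hfw 0 z₀)

/-- **Frostman's lemma** for nonempty Borel sets in a finite-dimensional normed space. The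
compact set carrying the measure may be taken of diameter at most one. -/
theorem exists_isFrostman {E : Type*} [NormedAddCommGroup E] [NormedSpace ℝ E]
    [FiniteDimensional ℝ E] [MeasurableSpace E] [BorelSpace E] {A : Set E} (hA : MeasurableSet A)
    (hne : A.Nonempty) {s : ℝ≥0} (hs : s = 0 ∨ (s : ℝ≥0∞) < dimH A) :
    ∃ C ⊆ A, IsCompact C ∧ (∀ x ∈ C, ∀ y ∈ C, dist x y ≤ 1) ∧
      ∃ μ : Measure E, IsFrostman μ C s := by
  rcases eq_or_ne s 0 with rfl | hs0
  -- At exponent 0 a Dirac mass suffices, since the growth bound is then constant.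
  · obtain ⟨x, hx⟩ := hne
    refine ⟨{x}, by simpa using hx, isCompact_singleton, by simp, Measure.dirac x,
      inferInstance, by simp, 1, fun y r _ => ?_⟩
    simpa using prob_le_one (μ := Measure.dirac x)
  replace hs : (s : ℝ≥0∞) < dimH A := hs.resolve_left hs0
  have hspos : 0 < s := pos_iff_ne_zero.2 hs0
  have := FiniteDimensional.proper ℝ E
  have hAinf : μH[(s : ℝ)] A = ∞ := by
    have := hausdorffMeasure_of_lt_dimH hs
    convert this
  obtain ⟨x₀, hx₀⟩ : ∃ x₀ : E, μH[(s : ℝ)] (A ∩ Metric.closedBall x₀ 2⁻¹) ≠ 0 := by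
    by_contra! hcon
    have hcover : A ⊆ ⋃ i, A ∩ Metric.closedBall (TopologicalSpace.denseSeq E i) 2⁻¹ := by
      intro x hx
      obtain ⟨i, hi⟩ := (TopologicalSpace.denseRange_denseSeq E).exists_dist_lt x
        (ε := 2⁻¹) (by norm_num)
      exact mem_iUnion.2 ⟨i, hx, hi.le⟩
    have := measure_mono_null hcover (measure_iUnion_null fun i => hcon _)
    simp [hAinf] at this
  -- Linear coordinates are bi-Lipschitz, so they preserve null Hausdorff measure and change the
  -- Frostman constant only by a factor.
  let e : E ≃L[ℝ] (Fin (Module.finrank ℝ E) → ℝ) :=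
    ContinuousLinearEquiv.ofFinrankEq (by simp)
  have hA0 : MeasurableSet (A ∩ Metric.closedBall x₀ 2⁻¹) :=
    hA.inter Metric.isClosed_closedBall.measurableSet
  have heA : MeasurableSet (e '' (A ∩ Metric.closedBall x₀ 2⁻¹)) :=
    e.toHomeomorph.toMeasurableEquiv.measurableSet_image.2 hA0
  have heH : μH[(s : ℝ)] (e '' (A ∩ Metric.closedBall x₀ 2⁻¹)) ≠ 0 := by
    intro h0
    have h1 := e.symm.lipschitz.hausdorffMeasure_image_le s.coe_nonneg (e '' (A ∩ Metric.closedBall x₀ 2⁻¹))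
    rw [h0, mul_zero, ← image_comp] at h1
    refine hx₀ (le_antisymm ?_ zero_le)
    simpa using h1
  obtain ⟨C, hCA, hC, μ, hμ⟩ := exists_isFrostman_pi hspos heA heH
  have hsymm : e.symm '' C ⊆ A ∩ Metric.closedBall x₀ 2⁻¹ := by
    rintro _ ⟨y, hy, rfl⟩
    obtain ⟨x, hx, rfl⟩ := hCA hy
    simpa using hx
  refine ⟨e.symm '' C, hsymm.trans inter_subset_left, hC.image e.symm.continuous, ?_,
    μ.map e.symm, ?_⟩
  · intro x hx y hy
    have h1 := (hsymm hx).2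
    have h2 := (hsymm hy).2
    rw [Metric.mem_closedBall] at h1 h2
    linarith [dist_triangle_right x y x₀]
  · have hmeas : Measurable e.symm := e.symm.continuous.measurable
    have := hμ.isProbabilityMeasure
    obtain ⟨M, hM⟩ := hμ.exists_bound
    set L : ℝ≥0 := ‖(e : E →L[ℝ] (Fin (Module.finrank ℝ E) → ℝ))‖₊ + 1 with hL
    refine ⟨Measure.isProbabilityMeasure_map hmeas.aemeasurable, ?_, M * L ^ (s : ℝ), ?_⟩
    · rw [Measure.map_apply hmeas (hC.image e.symm.continuous).measurableSet.compl,
        preimage_compl, preimage_image_eq _ e.symm.injective]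
      exact hμ.measure_compl
    · intro x r hr
      rw [Measure.map_apply hmeas Metric.isClosed_closedBall.measurableSet]
      have hsub : e.symm ⁻¹' Metric.closedBall x r ⊆ Metric.closedBall (e x) (L * r) := by
        intro y hy
        rw [Metric.mem_closedBall]
        have h1 := e.lipschitz.dist_le_mul (e.symm y) x
        rw [e.apply_symm_apply] at h1
        refine h1.trans ?_
        have h2 : dist (e.symm y) x ≤ r := hy
        rw [hL]
        push_cast
        gcongr
        simp
      refine (measure_mono hsub).trans ((hM _ _ (by positivity)).trans (le_of_eq ?_))
      rw [ENNReal.ofReal_mul (by positivity), ENNReal.mul_rpow_of_nonneg _ _ s.coe_nonneg, ← mul_assoc]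
      congr 1
      push_cast
      rw [ENNReal.coe_rpow_of_nonneg _ s.coe_nonneg, ENNReal.ofReal_coe_nnreal]

end Frostman

/-! ### Dimension of products and Riesz potentials -/

theorem exists_nnreal_approx_below {a : ℝ≥0∞} (ha : a ≠ ∞) {ε : ℝ≥0} (hε : 0 < ε) :
    ∃ s : ℝ≥0, (s = 0 ∨ (s : ℝ≥0∞) < a) ∧ a ≤ s + ε := by
  lift a to ℝ≥0 using ha
  refine ⟨a - ε, ?_, ?_⟩
  · rcases le_or_gt a ε with h | h
    · exact Or.inl (tsub_eq_zero_of_le h)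
    · exact Or.inr (by exact_mod_cast tsub_lt_self (hε.trans h) hε)
  · exact_mod_cast le_tsub_add

theorem IsFrostman.measure_eq_one {E : Type*} [PseudoMetricSpace E] [MeasurableSpace E]
    {μ : Measure E} {C : Set E} {s : ℝ≥0} (h : IsFrostman μ C s) (hC : MeasurableSet C) :
    μ C = 1 := by
  have := h.isProbabilityMeasure
  rw [← prob_compl_eq_zero_iff hC]
  exact h.measure_compl

/-- In the sup metric a ball of the product is a product of balls, so the product of Frostman
measures of exponents `s` and `t` has growth exponent `s + t`, and the mass distribution principle
applies. -/
theorem dimH_add_le_dimH_prod {E F : Type*} [NormedAddCommGroup E] [NormedSpace ℝ E]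
    [FiniteDimensional ℝ E] [MeasurableSpace E] [BorelSpace E] [NormedAddCommGroup F]
    [NormedSpace ℝ F] [FiniteDimensional ℝ F] [MeasurableSpace F] [BorelSpace F]
    {A : Set E} {B : Set F} (hA : MeasurableSet A) (hB : MeasurableSet B) (hA0 : A.Nonempty)
    (hB0 : B.Nonempty) : dimH A + dimH B ≤ dimH (A ×ˢ B) := by
  have := FiniteDimensional.proper ℝ E
  have := FiniteDimensional.proper ℝ F
  have key : ∀ s t : ℝ≥0, (s = 0 ∨ (s : ℝ≥0∞) < dimH A) → (t = 0 ∨ (t : ℝ≥0∞) < dimH B) →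
      (s : ℝ≥0∞) + t ≤ dimH (A ×ˢ B) := by
    intro s t hs ht
    obtain ⟨C, hCA, hC, -, μ, hμ⟩ := exists_isFrostman hA hA0 hs
    obtain ⟨D, hDB, hD, -, ν, hν⟩ := exists_isFrostman hB hB0 ht
    have := hμ.isProbabilityMeasure
    have := hν.isProbabilityMeasure
    obtain ⟨M, hM⟩ := hμ.exists_bound
    obtain ⟨N, hN⟩ := hν.exists_bound
    rw [← ENNReal.coe_add]
    refine le_trans ?_ (dimH_mono (prod_mono hCA hDB))
    refine le_dimH_of_measure_closedBall_le (μ := μ.prod ν) (C := M * N)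
      (hC.measurableSet.prod hD.measurableSet) ?_ ?_
    · rw [Measure.prod_prod, hμ.measure_eq_one hC.measurableSet,
        hν.measure_eq_one hD.measurableSet]
      simp
    · rintro ⟨x, y⟩ - j
      rw [← closedBall_prod_same, Measure.prod_prod, two_inv_pow_eq_ofReal]
      refine (mul_le_mul' (hM x _ (by positivity)) (hN y _ (by positivity))).trans (le_of_eq ?_)
      rw [NNReal.coe_add, ENNReal.rpow_add_of_nonneg _ _ s.coe_nonneg t.coe_nonneg]
      push_cast
      ring
  refine ENNReal.le_of_forall_pos_le_add fun ε hε _ => ?_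
  obtain ⟨s, hs, hs'⟩ := exists_nnreal_approx_below (Real.dimH_ne_top A) (half_pos hε)
  obtain ⟨t, ht, ht'⟩ := exists_nnreal_approx_below (Real.dimH_ne_top B) (half_pos hε)
  calc dimH A + dimH B ≤ (s + (ε / 2 : ℝ≥0)) + (t + (ε / 2 : ℝ≥0)) := add_le_add hs' ht'
    _ = (s + t) + ((ε / 2 + ε / 2 : ℝ≥0) : ℝ≥0∞) := by push_cast; ring
    _ ≤ dimH (A ×ˢ B) + ε := by
      rw [add_halves]
      gcongr
      exact key s t hs ht

/-- The Riesz potential of order `s'` of a Frostman measure of exponent `s > s'` is bounded. -/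
theorem IsFrostman.exists_lintegral_edist_rpow_le {E : Type*} [MetricSpace E] [MeasurableSpace E]
    [OpensMeasurableSpace E] {μ : Measure E} {C : Set E} {s s' : ℝ≥0} (h : IsFrostman μ C s)
    (hs : s' = 0 ∨ s' < s) :
    ∃ K : ℝ≥0, ∀ x, ∫⁻ y, edist x y ^ (-(s' : ℝ)) ∂μ ≤ K := by
  have := h.isProbabilityMeasure
  rcases eq_or_ne s' 0 with rfl | hs0
  · exact ⟨1, fun x => by simp⟩
  replace hs := hs.resolve_left hs0
  have hs'pos : (0 : ℝ) < s' := by positivity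
  have hss : (0 : ℝ) < s - s' := sub_pos.2 (by exact_mod_cast hs)
  obtain ⟨M, hM⟩ := h.exists_bound
  let u : ℕ → ℝ≥0∞ := fun j => (2⁻¹ : ℝ≥0∞) ^ j
  have hu0 : ∀ j, u j ≠ 0 := fun j => by simp [u]
  have hut : ∀ j, u j ≠ ∞ := fun j => by simp [u]
  have hu1 : ∀ j, u j ≤ 1 := fun j => pow_le_one' (by simp) j
  -- If `2⁻ʲ ≤ 2 |x - y|`, then `|x - y|^(-s')` is at most `c j`; one dyadic shell term thus
  -- dominates the kernel.
  let c : ℕ → ℝ≥0∞ := fun j => 2 ^ (s' : ℝ) * u j ^ (-(s' : ℝ))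
  have hc1 : ∀ j, 1 ≤ c j := by
    intro j
    have h1 : (1 : ℝ≥0∞) ≤ 2 ^ (s' : ℝ) := ENNReal.one_le_rpow (by norm_num) hs'pos
    have h2 : (1 : ℝ≥0∞) ≤ u j ^ (-(s' : ℝ)) := by
      rw [ENNReal.rpow_neg]
      exact ENNReal.one_le_inv.2 (ENNReal.rpow_le_one (hu1 j) hs'pos.le)
    calc (1 : ℝ≥0∞) = 1 * 1 := (one_mul 1).symm
      _ ≤ _ := mul_le_mul' h1 h2
  have hpt : ∀ x y : E, edist x y ^ (-(s' : ℝ)) ≤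
      1 + ∑' j, (Metric.closedBall x (2⁻¹ ^ j)).indicator (fun _ => c j) y := by
    intro x y
    rcases eq_or_ne x y with rfl | hxy
    -- On the diagonal the kernel is infinite, but so is the sum, as all its terms are at least 1.
    · have : ∑' j, (Metric.closedBall x (2⁻¹ ^ j)).indicator (fun _ => c j) x = ∞ := by
        refine top_le_iff.1 ?_
        rw [← ENNReal.tsum_const_eq_top_of_ne_zero (α := ℕ) one_ne_zero]
        refine ENNReal.tsum_le_tsum fun j => ?_
        rw [indicator_of_mem (Metric.mem_closedBall_self (by positivity))]
        exact hc1 j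
      rw [this]
      simp
    have hd : 0 < dist x y := dist_pos.2 hxy
    rcases le_or_gt (dist x y) 1 with hd1 | hd1
    · obtain ⟨j, hj1, hj2⟩ := exists_two_inv_pow_near _ hd hd1
      refine le_trans ?_ le_add_self
      refine le_trans ?_ (ENNReal.le_tsum j)
      rw [indicator_of_mem (by rwa [Metric.mem_closedBall, dist_comm])]
      have h1 : u j ≤ 2 * edist x y := by
        simp only [u]
        rw [two_inv_pow_eq_ofReal, edist_dist]
        refine (ENNReal.ofReal_le_ofReal hj2).trans ?_
        rw [ENNReal.ofReal_mul (by norm_num)]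
        simp
      have h2 : u j ^ (s' : ℝ) ≤ 2 ^ (s' : ℝ) * edist x y ^ (s' : ℝ) := by
        rw [← ENNReal.mul_rpow_of_nonneg _ _ hs'pos.le]
        exact ENNReal.rpow_le_rpow h1 hs'pos.le
      have he0 : edist x y ^ (s' : ℝ) ≠ 0 :=
        (ENNReal.rpow_pos (edist_pos.2 hxy) (edist_ne_top x y)).ne'
      have het : edist x y ^ (s' : ℝ) ≠ ∞ :=
        ENNReal.rpow_ne_top_of_nonneg hs'pos.le (edist_ne_top x y)
      have hv0 : u j ^ (s' : ℝ) ≠ 0 :=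
        (ENNReal.rpow_pos (pos_iff_ne_zero.2 (hu0 j)) (hut j)).ne'
      have hvt : u j ^ (s' : ℝ) ≠ ∞ := ENNReal.rpow_ne_top_of_nonneg hs'pos.le (hut j)
      simp only [c, ENNReal.rpow_neg]
      rw [← div_eq_mul_inv, ENNReal.le_div_iff_mul_le (Or.inl hv0) (Or.inl hvt), mul_comm,
        ← div_eq_mul_inv]
      exact ENNReal.div_le_of_le_mul h2
    · refine le_trans ?_ le_self_add
      rw [ENNReal.rpow_neg]
      refine ENNReal.inv_le_one.2 ((ENNReal.one_rpow (s' : ℝ)).symm.le.trans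
        (ENNReal.rpow_le_rpow ?_ hs'pos.le))
      rw [edist_dist]
      simpa using hd1.le
  -- The `j`-th term is a constant times `2^(j s') 2^(-j s) = ρ ^ j`, and `ρ < 1` because `s' < s`.
  let ρ : ℝ≥0∞ := (2⁻¹ : ℝ≥0∞) ^ ((s : ℝ) - s')
  have hρ : ρ < 1 := ENNReal.rpow_lt_one (by simp) hss
  have hbound : ∀ x, ∫⁻ y, edist x y ^ (-(s' : ℝ)) ∂μ ≤
      1 + 2 ^ (s' : ℝ) * M * (1 - ρ)⁻¹ := by
    intro x
    calc ∫⁻ y, edist x y ^ (-(s' : ℝ)) ∂μ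
        ≤ ∫⁻ y, (1 + ∑' j, (Metric.closedBall x (2⁻¹ ^ j)).indicator (fun _ => c j) y) ∂μ :=
          lintegral_mono (hpt x)
      _ = 1 + ∑' j, c j * μ (Metric.closedBall x (2⁻¹ ^ j)) := by
          rw [lintegral_add_left measurable_const, lintegral_one, measure_univ, lintegral_tsum]
          · congr 1
            refine tsum_congr fun j => ?_
            rw [lintegral_indicator Metric.isClosed_closedBall.measurableSet,
              setLIntegral_const]
          · intro j
            exact (measurable_const.indicator
              Metric.isClosed_closedBall.measurableSet).aemeasurable
      _ ≤ 1 + ∑' j, 2 ^ (s' : ℝ) * M * ρ ^ j := by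
          refine add_le_add le_rfl (ENNReal.tsum_le_tsum fun j => ?_)
          refine (mul_le_mul_right (hM x _ (by positivity)) _).trans (le_of_eq ?_)
          rw [← two_inv_pow_eq_ofReal]
          have : u j ^ (-(s' : ℝ)) * u j ^ (s : ℝ) = ρ ^ j := by
            rw [← ENNReal.rpow_add _ _ (hu0 j) (hut j)]
            simp only [u, ρ]
            rw [← ENNReal.rpow_natCast, ← ENNReal.rpow_natCast, ← ENNReal.rpow_mul,
              ← ENNReal.rpow_mul]
            congr 1
            ring
          rw [← this]
          simp only [c, u]
          ring
      _ = _ := by rw [ENNReal.tsum_mul_left, ENNReal.tsum_geometric]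
  have hfin : (1 : ℝ≥0∞) + 2 ^ (s' : ℝ) * M * (1 - ρ)⁻¹ ≠ ∞ := by
    refine ENNReal.add_ne_top.2 ⟨ENNReal.one_ne_top, ENNReal.mul_ne_top (ENNReal.mul_ne_top
      (ENNReal.rpow_ne_top_of_nonneg hs'pos.le (by simp)) ENNReal.coe_ne_top) ?_⟩
    exact ENNReal.inv_ne_top.2 (tsub_pos_of_lt hρ).ne'
  exact ⟨_, fun x => (hbound x).trans (ENNReal.coe_toNNReal hfin).ge⟩

/-! ### Random rotations and scalings of a vector -/

section Rotations

variable {m : ℕ}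

instance : SecondCountableTopology (SO m) :=
  haveI : SecondCountableTopology (Matrix (Fin m) (Fin m) ℝ) :=
    inferInstanceAs (SecondCountableTopology (Fin m → Fin m → ℝ))
  inferInstanceAs (SecondCountableTopology
    ((Matrix.specialOrthogonalGroup (Fin m) ℝ : Set (Matrix (Fin m) (Fin m) ℝ))))

instance : IsProbabilityMeasure (haarSO m) :=
  ⟨by simpa [haarSO] using Measure.haarMeasure_self (G := SO m) (K₀ := ⊤)⟩

instance : (haarSO m).IsHaarMeasure := by unfold haarSO; infer_instance

/-- The image of the Haar probability under a right translation is again left invariant, so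
uniqueness applies. Right invariance makes averages over `SO(m)` constant along orbits. -/
instance : (haarSO m).IsMulRightInvariant := by
  refine ⟨fun g => ?_⟩
  have : IsProbabilityMeasure ((haarSO m).map (· * g)) :=
    Measure.isProbabilityMeasure_map (measurable_mul_const g).aemeasurable
  have : ((haarSO m).map (· * g)).IsMulLeftInvariant := isMulLeftInvariant_map_mul_right g
  have : ((haarSO m).map (· * g)).IsHaarMeasure :=
    Measure.isHaarMeasure_of_isCompact_nonempty_interior _ univ isCompact_univ (by simp)
      (by simp) (by simp)
  exact Measure.isHaarMeasure_eq_of_isProbabilityMeasure _ _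

/-- The action of `SO(m)` on `ℝ^m`. -/
noncomputable def rot (O : SO m) (x : EuclideanSpace ℝ (Fin m)) : EuclideanSpace ℝ (Fin m) :=
  Matrix.toEuclideanLin (O : Matrix (Fin m) (Fin m) ℝ) x

theorem rot_mul (O O' : SO m) (x : EuclideanSpace ℝ (Fin m)) :
    rot (O * O') x = rot O (rot O' x) := by
  simp [rot, Matrix.toLpLin_apply, Matrix.mulVec_mulVec]

theorem rot_smul (O : SO m) (t : ℝ) (x : EuclideanSpace ℝ (Fin m)) :
    rot O (t • x) = t • rot O x := map_smul _ _ _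

theorem rot_neg (O : SO m) (x : EuclideanSpace ℝ (Fin m)) : rot O (-x) = -rot O x := map_neg _ _

theorem norm_rot (O : SO m) (x : EuclideanSpace ℝ (Fin m)) : ‖rot O x‖ = ‖x‖ := by
  have h := (Matrix.mem_specialOrthogonalGroup_iff.1 O.2).1
  rw [Matrix.mem_orthogonalGroup_iff'] at h
  have h1 : ‖rot O x‖ ^ 2 = ‖x‖ ^ 2 := by
    rw [← real_inner_self_eq_norm_sq, ← real_inner_self_eq_norm_sq]
    simp only [rot, Matrix.toLpLin_apply, EuclideanSpace.inner_eq_star_dotProduct,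
      star_trivial]
    rw [Matrix.dotProduct_mulVec, Matrix.vecMul_mulVec]
    simp [h]
  exact (sq_eq_sq₀ (norm_nonneg _) (norm_nonneg _)).1 h1

theorem continuous_rot : Continuous fun p : SO m × EuclideanSpace ℝ (Fin m) => rot p.1 p.2 := by
  have h : Continuous fun p : SO m × EuclideanSpace ℝ (Fin m) =>
      (p.1 : Matrix (Fin m) (Fin m) ℝ).mulVec (WithLp.ofLp p.2) :=
    (continuous_subtype_val.comp continuous_fst).matrix_mulVec
      ((PiLp.continuous_ofLp 2 _).comp continuous_snd)
  exact (PiLp.continuous_toLp 2 _).comp h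

theorem measurePreserving_rot (O : SO m) : MeasurePreserving (rot O) := by
  have h : Function.Surjective (rot O) := fun y => ⟨rot O⁻¹ y, by
    rw [← rot_mul, mul_inv_cancel]
    simp [rot]⟩
  let e : EuclideanSpace ℝ (Fin m) ≃ₗᵢ[ℝ] EuclideanSpace ℝ (Fin m) :=
    LinearIsometryEquiv.ofSurjective
      ⟨Matrix.toEuclideanLin (O : Matrix (Fin m) (Fin m) ℝ), norm_rot O⟩ h
  exact e.measurePreserving

theorem exists_rot_eq_of_det_eq_one (f : EuclideanSpace ℝ (Fin m) ≃ₗᵢ[ℝ] EuclideanSpace ℝ (Fin m))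
    (hf : LinearMap.det (f.toLinearEquiv : EuclideanSpace ℝ (Fin m) →ₗ[ℝ] _) = 1) :
    ∃ O : SO m, ∀ x, rot O x = f x := by
  let A : Matrix (Fin m) (Fin m) ℝ :=
    Matrix.toEuclideanLin.symm (f.toLinearEquiv : EuclideanSpace ℝ (Fin m) →ₗ[ℝ] _)
  have hA : Matrix.toEuclideanLin A = (f.toLinearEquiv : EuclideanSpace ℝ (Fin m) →ₗ[ℝ] _) :=
    LinearEquiv.apply_symm_apply _ _
  have hdet : A.det = 1 := by
    rw [← hf, ← hA, Matrix.toEuclideanLin_eq_toLin_orthonormal, LinearMap.det_toLin]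
  have horth : Matrix.transpose A * A = 1 := by
    ext i j
    have h := f.inner_map_map (EuclideanSpace.single j (1 : ℝ)) (EuclideanSpace.single i (1 : ℝ))
    have hf' : ∀ x, f x = Matrix.toEuclideanLin A x := fun x => by rw [hA]; rfl
    rw [hf', hf'] at h
    simp only [Matrix.toLpLin_apply, EuclideanSpace.inner_eq_star_dotProduct,
      star_trivial] at h
    rw [Matrix.dotProduct_mulVec, Matrix.vecMul_mulVec] at h
    simpa [Matrix.one_apply, Pi.single_apply, eq_comm] using h.symm
  refine ⟨⟨A, Matrix.mem_specialOrthogonalGroup_iff.2 ⟨?_, hdet⟩⟩, fun x => ?_⟩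
  · rw [Matrix.mem_orthogonalGroup_iff', horth]
  · change Matrix.toEuclideanLin A x = f x
    rw [hA]; rfl

/-- The reflection exchanging `x` and `y`, followed by a reflection in the hyperplane orthogonal to
some `v ⊥ y`, fixes the image `y` and has determinant 1. If no such nonzero `v` exists, `y` spans
the space and, for `x ≠ y`, only `x = -y` remains; this is why the sign is needed. -/
theorem exists_rot_eq_or_eq_neg {x y : EuclideanSpace ℝ (Fin m)} (h : ‖x‖ = ‖y‖) :
    ∃ O : SO m, rot O x = y ∨ rot O x = -y := by
  have hone : ∀ z : EuclideanSpace ℝ (Fin m), rot (1 : SO m) z = z := fun z => by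
    simp [rot]
  rcases eq_or_ne x y with rfl | hxy
  · exact ⟨1, Or.inl (hone _)⟩
  by_cases hv : ∃ v : EuclideanSpace ℝ (Fin m), v ≠ 0 ∧ inner ℝ y v = 0
  · obtain ⟨v, hv0, hv⟩ := hv
    have hdet : ∀ w : EuclideanSpace ℝ (Fin m), w ≠ 0 →
        LinearMap.det ((Submodule.span ℝ {w})ᗮ.reflection.toLinearEquiv :
          EuclideanSpace ℝ (Fin m) →ₗ[ℝ] _) = -1 := by
      intro w hw
      have h1 := (Submodule.span ℝ {w})ᗮ.det_reflection
      rw [Submodule.orthogonal_orthogonal, finrank_span_singleton hw, pow_one] at h1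
      exact h1
    obtain ⟨O, hO⟩ := exists_rot_eq_of_det_eq_one
      ((Submodule.span ℝ {x - y})ᗮ.reflection.trans (Submodule.span ℝ {v})ᗮ.reflection) (by
        have := LinearMap.det_comp
          ((Submodule.span ℝ {v})ᗮ.reflection.toLinearEquiv :
            EuclideanSpace ℝ (Fin m) →ₗ[ℝ] EuclideanSpace ℝ (Fin m))
          ((Submodule.span ℝ {x - y})ᗮ.reflection.toLinearEquiv :
            EuclideanSpace ℝ (Fin m) →ₗ[ℝ] EuclideanSpace ℝ (Fin m))
        rw [hdet v hv0, hdet _ (sub_ne_zero.2 hxy)] at this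
        rw [show (1 : ℝ) = -1 * -1 by norm_num, ← this]
        rfl)
    refine ⟨O, Or.inl ?_⟩
    rw [hO, LinearIsometryEquiv.trans_apply, Submodule.reflection_sub h]
    refine Submodule.reflection_mem_subspace_eq_self ?_
    rw [Submodule.mem_orthogonal_singleton_iff_inner_left]
    exact hv
  · push Not at hv
    have htop : Submodule.span ℝ {y} = ⊤ := by
      rw [← Submodule.orthogonal_eq_bot_iff, Submodule.eq_bot_iff]
      intro v hv'
      by_contra hv0
      exact hv v hv0 ((Submodule.mem_orthogonal_singleton_iff_inner_right).1 hv')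
    obtain ⟨c, rfl⟩ := Submodule.mem_span_singleton.1 (htop ▸ Submodule.mem_top : x ∈ _)
    refine ⟨1, Or.inr ?_⟩
    rw [hone]
    rw [norm_smul] at h
    have hy0 : ‖y‖ ≠ 0 := fun h0 => hxy (by simp [norm_eq_zero.1 h0])
    have hc : |c| = 1 := by simpa [hy0] using h
    rcases (abs_eq zero_le_one).1 hc with rfl | rfl
    · simp at hxy
    · simp

/-- Polar coordinates: the punctured space is the product of the unit sphere and a half-line with
density `y ^ (dim - 1)`. -/
theorem lintegral_fun_norm_addHaar {E : Type*} [NormedAddCommGroup E] [NormedSpace ℝ E]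
    [FiniteDimensional ℝ E] [MeasurableSpace E] [BorelSpace E] [Nontrivial E] (μ : Measure E)
    [μ.IsAddHaarMeasure] {G : ℝ → ℝ≥0∞} (hG : Measurable G) :
    ∫⁻ x, G ‖x‖ ∂μ = μ.toSphere univ *
      ∫⁻ y in Ioi (0 : ℝ), ENNReal.ofReal (y ^ (Module.finrank ℝ E - 1)) * G y := by
  calc ∫⁻ x, G ‖x‖ ∂μ = ∫⁻ x : ({(0)}ᶜ : Set E), G ‖x.1‖ ∂(μ.comap (↑)) := by
        rw [lintegral_subtype_comap (measurableSet_singleton _).compl fun x => G ‖x‖,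
          restrict_compl_singleton]
    _ = ∫⁻ x, G x.2 ∂μ.toSphere.prod (.volumeIoiPow (Module.finrank ℝ E - 1)) := by
        rw [← μ.measurePreserving_homeomorphUnitSphereProd.lintegral_comp
          (f := fun x => G x.2) (by fun_prop)]
        simp
    _ = μ.toSphere univ * ∫⁻ y : Ioi (0 : ℝ), G y ∂.volumeIoiPow (Module.finrank ℝ E - 1) := by
        rw [lintegral_prod _ (by fun_prop)]
        simp only [lintegral_const]
        rw [mul_comm]
    _ = _ := by
        rw [Measure.volumeIoiPow, lintegral_withDensity_eq_lintegral_mul _ (by fun_prop)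
          (by fun_prop)]
        congr 1
        exact lintegral_subtype_comap measurableSet_Ioi
          fun y : ℝ => ENNReal.ofReal (y ^ (Module.finrank ℝ E - 1)) * G y

/-- The scaling factors `t` with `b⁻¹ ≤ |t| ≤ b`. -/
def scaleSet (b : ℝ) : Set ℝ := {t | b⁻¹ ≤ |t| ∧ |t| ≤ b}

theorem measurableSet_scaleSet (b : ℝ) : MeasurableSet (scaleSet b) :=
  (measurableSet_le measurable_const continuous_abs.measurable).inter
    (measurableSet_le continuous_abs.measurable measurable_const)

/-- The rotation spreads `z` over its sphere and the scaling supplies the radial direction. Of the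
factor `‖z‖ ^ (-m)`, `m - 1` powers come from the polar density and one from the substitution `y =
‖z‖ t`. -/
theorem lintegral_smul_rot_le (m : ℕ) {b : ℝ} (hb : 0 < b) :
    ∃ C : ℝ≥0, ∀ z : EuclideanSpace ℝ (Fin m), z ≠ 0 →
      ∀ f : EuclideanSpace ℝ (Fin m) → ℝ≥0∞, Measurable f →
      ∫⁻ t in scaleSet b, ∫⁻ O, f (t • rot O z) ∂(haarSO m) ≤
        C * (‖z‖ₑ ^ m)⁻¹ * ∫⁻ x, f x := by
  rcases subsingleton_or_nontrivial (EuclideanSpace ℝ (Fin m)) with hsub | hnt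
  · exact ⟨0, fun z hz => absurd (Subsingleton.elim z 0) hz⟩
  have hm : Module.finrank ℝ (EuclideanSpace ℝ (Fin m)) = m := by simp
  have hm0 : 0 < m := by rw [← hm]; exact Module.finrank_pos
  set σ := (volume : Measure (EuclideanSpace ℝ (Fin m))).toSphere univ with hσ
  set σ₁ := (volume : Measure ℝ).toSphere univ with hσ₁
  have hσ0 : σ ≠ 0 := by
    rw [hσ, Measure.toSphere_apply_univ, hm]
    exact mul_ne_zero (by exact_mod_cast hm0.ne') (Metric.measure_ball_pos _ _ one_pos).ne'
  have hσt : σ ≠ ∞ := measure_ne_top _ _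
  have hσ₁t : σ₁ ≠ ∞ := measure_ne_top _ _
  have hCt : σ₁ * ENNReal.ofReal (b ^ (m - 1)) * (σ⁻¹ * 2) ≠ ∞ :=
    ENNReal.mul_ne_top (ENNReal.mul_ne_top hσ₁t ENNReal.ofReal_ne_top)
      (ENNReal.mul_ne_top (ENNReal.inv_ne_top.2 hσ0) (by simp))
  refine ⟨(σ₁ * ENNReal.ofReal (b ^ (m - 1)) * (σ⁻¹ * 2)).toNNReal, fun z hz f hf => ?_⟩
  rw [ENNReal.coe_toNNReal hCt]
  have hcont : Measurable fun p : EuclideanSpace ℝ (Fin m) × SO m => rot p.2 p.1 :=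
    (continuous_rot.comp continuous_swap).measurable
  have hfm : Measurable fun p : EuclideanSpace ℝ (Fin m) × SO m =>
      f (rot p.2 p.1) + f (-rot p.2 p.1) :=
    (hf.comp hcont).add (hf.comp hcont.neg)
  -- Symmetrising under `x ↦ -x` makes the average radial even for `m = 1`, where `SO(1)` is
  -- trivial; the price is a factor 2 in the integral.
  let φ : EuclideanSpace ℝ (Fin m) → ℝ≥0∞ := fun x =>
    ∫⁻ O, (f (rot O x) + f (-rot O x)) ∂(haarSO m)
  have hφm : Measurable φ := hfm.lintegral_prod_right'
  have hφneg : ∀ x, φ (-x) = φ x := by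
    intro x
    simp only [φ, rot_neg, neg_neg]
    exact lintegral_congr fun O => add_comm _ _
  have hφrot : ∀ (O : SO m) x, φ (rot O x) = φ x := by
    intro O x
    simp only [φ, ← rot_mul]
    exact lintegral_mul_right_eq_self (fun O' => f (rot O' x) + f (-rot O' x)) O
  have hφrad : ∀ x y, ‖x‖ = ‖y‖ → φ x = φ y := by
    intro x y hxy
    obtain ⟨O, h | h⟩ := exists_rot_eq_or_eq_neg hxy
    · rw [← h, hφrot]
    · rw [← hφneg y, ← h, hφrot]
  have hz0 : 0 < ‖z‖ := norm_pos_iff.2 hz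
  let G : ℝ → ℝ≥0∞ := fun y => φ ((y * ‖z‖⁻¹) • z)
  have hGm : Measurable G := hφm.comp (by fun_prop)
  have hφG : ∀ x, φ x = G ‖x‖ := by
    intro x
    refine hφrad _ _ ?_
    rw [norm_smul, norm_mul, norm_inv, norm_norm, norm_norm]
    field_simp
  have hφint : ∫⁻ x, φ x = 2 * ∫⁻ x, f x := by
    simp only [φ]
    rw [lintegral_lintegral_swap hfm.aemeasurable]
    have : ∀ O : SO m, ∫⁻ x, (f (rot O x) + f (-rot O x)) = 2 * ∫⁻ x, f x := by
      intro O
      rw [lintegral_add_left (f := fun x => f (rot O x))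
        (hf.comp (measurePreserving_rot O).measurable),
        (measurePreserving_rot O).lintegral_comp hf]
      have h2 := (measurePreserving_rot O).lintegral_comp
        (f := fun x => f (-x)) (hf.comp measurable_neg)
      rw [h2, lintegral_neg_eq_self, two_mul]
    simp [this]
  let K : ℝ → ℝ≥0∞ := (Ioi (0 : ℝ)).indicator fun y => ENNReal.ofReal (y ^ (m - 1)) * G y
  have hKm : Measurable K := (by fun_prop : Measurable fun y : ℝ =>
    ENNReal.ofReal (y ^ (m - 1)) * G y).indicator measurableSet_Ioi
  have hKint : ∫⁻ y, K y = σ⁻¹ * (2 * ∫⁻ x, f x) := by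
    rw [← hφint]
    simp_rw [hφG]
    rw [lintegral_fun_norm_addHaar volume hGm, hm, ← hσ, ← mul_assoc,
      ENNReal.inv_mul_cancel hσ0 hσt, one_mul, lintegral_indicator measurableSet_Ioi]
  let H : ℝ → ℝ≥0∞ := (Icc b⁻¹ b).indicator fun y => G (‖z‖ * y)
  have hHm : Measurable H := (by fun_prop : Measurable fun y : ℝ => G (‖z‖ * y)).indicator
    measurableSet_Icc
  have hHK : ∀ y, H y ≤ ENNReal.ofReal (b ^ (m - 1)) * (‖z‖ₑ ^ (m - 1))⁻¹ * K (‖z‖ * y) := by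
    intro y
    by_cases hy : y ∈ Icc b⁻¹ b
    · have hy0 : 0 < y := (inv_pos.2 hb).trans_le hy.1
      have hzy : 0 < ‖z‖ * y := by positivity
      simp only [H, K, indicator_of_mem hy, indicator_of_mem (mem_Ioi.2 hzy)]
      rw [← mul_assoc]
      refine le_mul_of_one_le_left' ?_
      rw [← ofReal_norm, ← ENNReal.ofReal_pow hz0.le, ← ENNReal.ofReal_inv_of_pos
        (by positivity), ← ENNReal.ofReal_mul (by positivity), ← ENNReal.ofReal_mul (by positivity)]
      rw [ENNReal.one_le_ofReal, mul_pow]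
      have h1 : 1 ≤ b * y := by
        have := mul_le_mul_of_nonneg_left hy.1 hb.le
        rwa [mul_inv_cancel₀ hb.ne'] at this
      have : b ^ (m - 1) * (‖z‖ ^ (m - 1))⁻¹ * (‖z‖ ^ (m - 1) * y ^ (m - 1)) = (b * y) ^ (m - 1) := by
        rw [mul_pow]
        field_simp
      rw [this]
      exact one_le_pow₀ h1
    · simp [H, hy]
  calc ∫⁻ t in scaleSet b, ∫⁻ O, f (t • rot O z) ∂(haarSO m)
      ≤ ∫⁻ t in scaleSet b, φ (t • z) := by
        refine lintegral_mono fun t => lintegral_mono fun O => ?_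
        rw [rot_smul]
        exact le_self_add
    _ = ∫⁻ t, H ‖t‖ := by
        rw [← lintegral_indicator (measurableSet_scaleSet b)]
        refine lintegral_congr fun t => ?_
        by_cases ht : t ∈ scaleSet b
        · have ht' : ‖t‖ ∈ Icc b⁻¹ b := ht
          simp only [H, indicator_of_mem ht, indicator_of_mem ht', hφG, norm_smul]
          rw [mul_comm]
        · have ht' : ‖t‖ ∉ Icc b⁻¹ b := ht
          simp only [H, indicator_of_notMem ht, indicator_of_notMem ht']
    _ = σ₁ * ∫⁻ y in Ioi (0 : ℝ), H y := by
        rw [lintegral_fun_norm_addHaar volume hHm, ← hσ₁]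
        simp only [Module.finrank_self, Nat.sub_self, pow_zero, ENNReal.ofReal_one, one_mul]
    _ ≤ σ₁ * ∫⁻ y, ENNReal.ofReal (b ^ (m - 1)) * (‖z‖ₑ ^ (m - 1))⁻¹ * K (‖z‖ * y) := by
        refine mul_le_mul_right ?_ _
        exact (setLIntegral_le_lintegral _ _).trans (lintegral_mono hHK)
    _ = σ₁ * (ENNReal.ofReal (b ^ (m - 1)) * (‖z‖ₑ ^ (m - 1))⁻¹ *
          (‖z‖ₑ⁻¹ * (σ⁻¹ * (2 * ∫⁻ x, f x)))) := by
        rw [lintegral_const_mul _ (by fun_prop), ← hKint]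
        congr 2
        have h1 := Real.map_volume_mul_left hz0.ne'
        have h2 : ∫⁻ y, K (‖z‖ * y) = ∫⁻ y, K y ∂(volume.map (‖z‖ * ·)) :=
          (lintegral_map hKm (by fun_prop)).symm
        rw [h2, h1, lintegral_smul_measure, abs_inv, abs_of_pos hz0,
          ENNReal.ofReal_inv_of_pos hz0, ofReal_norm]
        rfl
    _ = _ := by
        have h1 : (‖z‖ₑ ^ m)⁻¹ = (‖z‖ₑ ^ (m - 1))⁻¹ * ‖z‖ₑ⁻¹ := by
          rw [← ENNReal.mul_inv (Or.inr (by simp)) (Or.inr (by simpa using hz)), ← pow_succ,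
            Nat.sub_add_cancel hm0]
        rw [h1]
        ring

/-- The law of `t O z`, for `t` in the scale set and `O` a random rotation, is dominated by a
multiple of Lebesgue measure on a ball. -/
theorem map_smul_rot_le (m : ℕ) {b : ℝ} (hb : 0 < b) :
    ∃ C : ℝ≥0, ∀ z : EuclideanSpace ℝ (Fin m), (m = 0 ∨ z ≠ 0) →
      (((volume.restrict (scaleSet b)).prod (haarSO m)).map fun p => p.1 • rot p.2 z) ≤
        (C * (‖z‖ₑ ^ m)⁻¹) • volume.restrict (Metric.closedBall 0 (b * ‖z‖)) := by
  have hmeas : ∀ z : EuclideanSpace ℝ (Fin m), Measurable fun p : ℝ × SO m => p.1 • rot p.2 z :=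
    fun z => (continuous_fst.smul (continuous_rot.comp
      (continuous_snd.prodMk continuous_const))).measurable
  have hsupp : ∀ (z : EuclideanSpace ℝ (Fin m)) (S : Set (EuclideanSpace ℝ (Fin m))),
      MeasurableSet S →
      (((volume.restrict (scaleSet b)).prod (haarSO m)).map fun p => p.1 • rot p.2 z) S =
      ∫⁻ t in scaleSet b, ∫⁻ O, (S ∩ Metric.closedBall 0 (b * ‖z‖)).indicator 1
        (t • rot O z) ∂(haarSO m) := by
    intro z S hS
    rw [← lintegral_indicator_one hS, lintegral_map (measurable_one.indicator hS) (hmeas z),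
      lintegral_prod (fun p : ℝ × SO m => S.indicator 1 (p.1 • rot p.2 z))
        ((measurable_one.indicator hS).comp (hmeas z)).aemeasurable]
    refine setLIntegral_congr_fun (measurableSet_scaleSet b) fun t ht => ?_
    refine lintegral_congr fun O => ?_
    have hball : t • rot O z ∈ Metric.closedBall (0 : EuclideanSpace ℝ (Fin m)) (b * ‖z‖) := by
      rw [mem_closedBall_zero_iff, norm_smul, norm_rot]
      exact mul_le_mul_of_nonneg_right ht.2 (norm_nonneg z)
    by_cases h : t • rot O z ∈ S <;> simp [h, hball]
  -- In dimension 0 the space is a point of volume 1, and the law is a point mass of weight `volume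
  -- (scaleSet b)`.
  rcases Nat.eq_zero_or_pos m with rfl | hm
  · have hfin : volume (scaleSet b) ≠ ∞ := by
      refine ne_top_of_le_ne_top ?_ (measure_mono (t := Icc (-b) b) fun t ht => abs_le.1 ht.2)
      simp
    refine ⟨(volume (scaleSet b)).toNNReal, fun z _ => ?_⟩
    refine Measure.le_iff.2 fun S hS => ?_
    rw [hsupp z S hS, ENNReal.coe_toNNReal hfin, Measure.smul_apply, Measure.restrict_apply hS]
    have hcongr : ∀ t : ℝ, ∀ O : SO 0, t • rot O z = 0 := fun t O => Subsingleton.elim _ _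
    simp only [hcongr, lintegral_const, measure_univ, mul_one, Measure.restrict_apply,
      MeasurableSet.univ, univ_inter, pow_zero, inv_one, smul_eq_mul]
    rw [mul_comm]
    gcongr
    by_cases h : (0 : EuclideanSpace ℝ (Fin 0)) ∈ S ∩ Metric.closedBall 0 (b * ‖z‖)
    · have huniv : S ∩ Metric.closedBall (0 : EuclideanSpace ℝ (Fin 0)) (b * ‖z‖) = univ := by
        ext x; simp only [Subsingleton.elim x 0, h, mem_univ]
      have hvol := (PiLp.volume_preserving_ofLp (Fin 0)).measure_preimage
        (MeasurableSet.univ).nullMeasurableSet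
      rw [preimage_univ] at hvol
      rw [huniv, hvol, volume_pi, Measure.pi_univ]
      simp
    · simp [h]
  · obtain ⟨C, hC⟩ := lintegral_smul_rot_le m hb
    refine ⟨C, fun z hz => Measure.le_iff.2 fun S hS => ?_⟩
    rw [hsupp z S hS, Measure.smul_apply, Measure.restrict_apply hS, smul_eq_mul]
    have hSB := hS.inter (Metric.isClosed_closedBall (x := (0 : EuclideanSpace ℝ (Fin m)))
      (ε := b * ‖z‖)).measurableSet
    refine (hC z (hz.resolve_left hm.ne') _ (measurable_one.indicator hSB)).trans ?_
    rw [lintegral_indicator_one hSB]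

end Rotations

/-! ### Greedy choice of an independent subfamily -/

section Greedy

variable {ι V : Type*} [AddCommGroup V] [Module ℝ V]

/-- A finite family weighted by `a` has a maximal independent subfamily spanning the same space
as the whole family below every threshold of the weight. -/
theorem exists_linearIndepOn_span_sublevel [Fintype ι] (u : ι → V) (a : ι → ℝ) :
    ∃ S : Finset ι, LinearIndepOn ℝ u (S : Set ι) ∧ ∀ θ : ℝ,
      Submodule.span ℝ (u '' {e | e ∈ S ∧ a e ≤ θ}) = Submodule.span ℝ (u '' {e | a e ≤ θ}) := by
  classical
  suffices h : ∀ T : Finset ι, ∃ S ⊆ T, LinearIndepOn ℝ u (S : Set ι) ∧ ∀ θ : ℝ,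
      Submodule.span ℝ (u '' {e | e ∈ S ∧ a e ≤ θ}) =
        Submodule.span ℝ (u '' {e | e ∈ T ∧ a e ≤ θ}) by
    obtain ⟨S, -, h1, h2⟩ := h Finset.univ
    exact ⟨S, h1, by simpa using h2⟩
  intro T
  -- Vectors are examined in order of increasing weight, and a new one is kept exactly when it lies
  -- outside the span of those already kept.
  induction T using Finset.induction_on_max_value a with
  | empty => exact ⟨∅, le_rfl, by simp, fun θ => by simp⟩
  | insert x T hx hmax ih =>
    obtain ⟨S, hST, hS, hspan⟩ := ih
    have hspanT : Submodule.span ℝ (u '' (S : Set ι)) = Submodule.span ℝ (u '' (T : Set ι)) := by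
      have h := hspan (a x)
      have e1 : {e | e ∈ S ∧ a e ≤ a x} = (S : Set ι) := by
        ext e; exact ⟨fun h => h.1, fun h => ⟨h, hmax e (hST h)⟩⟩
      have e2 : {e | e ∈ T ∧ a e ≤ a x} = (T : Set ι) := by
        ext e; exact ⟨fun h => h.1, fun h => ⟨h, hmax e h⟩⟩
      rwa [e1, e2] at h
    have hins : ∀ (Q : Finset ι) θ, a x ≤ θ →
        {e | e ∈ insert x Q ∧ a e ≤ θ} = insert x {e | e ∈ Q ∧ a e ≤ θ} := by
      intro Q θ hθ
      ext e
      simp only [Finset.mem_insert, mem_ofPred_eq, mem_insert_iff]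
      constructor
      · rintro ⟨rfl | h, h'⟩
        · exact Or.inl rfl
        · exact Or.inr ⟨h, h'⟩
      · rintro (rfl | ⟨h, h'⟩)
        · exact ⟨Or.inl rfl, hθ⟩
        · exact ⟨Or.inr h, h'⟩
    have hnot : ∀ (Q : Finset ι) θ, ¬ a x ≤ θ →
        {e | e ∈ insert x Q ∧ a e ≤ θ} = {e | e ∈ Q ∧ a e ≤ θ} := by
      intro Q θ hθ
      ext e
      simp only [Finset.mem_insert, mem_ofPred_eq]
      constructor
      · rintro ⟨rfl | h, h'⟩
        · exact absurd h' hθ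
        · exact ⟨h, h'⟩
      · rintro ⟨h, h'⟩; exact ⟨Or.inr h, h'⟩
    by_cases hux : u x ∈ Submodule.span ℝ (u '' (S : Set ι))
    · refine ⟨S, hST.trans (Finset.subset_insert _ _), hS, fun θ => ?_⟩
      by_cases hθ : a x ≤ θ
      · rw [hins T θ hθ, image_insert_eq, Submodule.span_insert, ← hspan θ, eq_comm, sup_eq_right,
          Submodule.span_singleton_le_iff_mem]
        refine Submodule.span_mono (image_mono fun e he => ?_) hux
        exact ⟨he, (hmax e (hST he)).trans hθ⟩
      · rw [hnot T θ hθ, hspan θ]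
    · refine ⟨insert x S, Finset.insert_subset_insert _ hST, ?_, fun θ => ?_⟩
      · rw [Finset.coe_insert]
        exact hS.insert hux
      · by_cases hθ : a x ≤ θ
        · rw [hins T θ hθ, hins S θ hθ, image_insert_eq, image_insert_eq, Submodule.span_insert,
            Submodule.span_insert, hspan θ]
        · rw [hnot T θ hθ, hnot S θ hθ, hspan θ]

theorem exists_linearIndepOn_card_sublevel [Fintype ι] (u : ι → V) (a : ι → ℝ) :
    ∃ S : Finset ι, LinearIndepOn ℝ u (S : Set ι) ∧ ∀ θ : ℝ,
      (S.filter fun e => a e ≤ θ).card =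
        Module.finrank ℝ (Submodule.span ℝ (u '' {e | a e ≤ θ})) := by
  classical
  obtain ⟨S, hS, hspan⟩ := exists_linearIndepOn_span_sublevel u a
  refine ⟨S, hS, fun θ => ?_⟩
  rw [← hspan θ]
  have hsub : {e | e ∈ S ∧ a e ≤ θ} = ((S.filter fun e => a e ≤ θ : Finset ι) : Set ι) := by
    ext e; simp
  have hind : LinearIndepOn ℝ u ((S.filter fun e => a e ≤ θ : Finset ι) : Set ι) :=
    hS.mono (Finset.coe_subset.2 (Finset.filter_subset _ _))
  rw [hsub, image_eq_range]
  have := finrank_span_eq_card hind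
  rw [this]
  simp

end Greedy

/-! ### Threshold integration, volume of sliced boxes, products of measures -/

/-- Integrating a family of threshold inequalities over the thresholds in `[0, R]`. -/
theorem mul_le_sum_of_threshold {ι κ : Type*} [Fintype ι] (S : Finset κ) (a s : ι → ℝ) (c : κ → ℝ)
    {τ R : ℝ} (hR : 0 ≤ R) (ha : ∀ i, 0 ≤ a i ∧ a i ≤ R) (hc : ∀ e, 0 ≤ c e ∧ c e ≤ R)
    (h : ∀ θ : ℝ, τ ≤ (∑ i with θ < a i, s i) + ((S.filter fun e => c e ≤ θ).card : ℝ)) :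
    τ * R ≤ ∑ i, a i * s i + ∑ e ∈ S, (R - c e) := by
  classical
  let μ : Measure ℝ := volume.restrict (Ioc 0 R)
  have hμ : ∀ x, 0 ≤ x → x ≤ R → μ.real (Iio x) = x := by
    intro x hx hxR
    rw [measureReal_restrict_apply measurableSet_Iio]
    have : Iio x ∩ Ioc 0 R = Ioo 0 x := by
      ext y
      simp only [mem_inter_iff, mem_Iio, mem_Ioc, mem_Ioo]
      constructor
      · rintro ⟨h1, h2, -⟩; exact ⟨h2, h1⟩
      · rintro ⟨h1, h2⟩; exact ⟨h2, h1, (h2.le.trans hxR)⟩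
    rw [this, Real.volume_real_Ioo_of_le hx, sub_zero]
  have hint : ∀ x : ℝ, Integrable ((Iio x).indicator (1 : ℝ → ℝ)) μ := fun x =>
    (integrable_const (1 : ℝ)).indicator measurableSet_Iio
  -- Over `(0, R]`, the indicator of `θ < a i` has integral `a i`, and that of `c e ≤ θ` has
  -- integral `R - c e`.
  let f : ℝ → ℝ := fun θ => ∑ i, s i * (Iio (a i)).indicator 1 θ +
    ∑ e ∈ S, (1 - (Iio (c e)).indicator 1 θ)
  have hf : ∀ θ, τ ≤ f θ := by
    intro θ
    refine (h θ).trans (le_of_eq ?_)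
    simp only [f]
    congr 1
    · rw [Finset.sum_filter]
      refine Finset.sum_congr rfl fun i _ => ?_
      by_cases hi : θ < a i <;> simp [hi]
    · rw [Finset.card_filter, Nat.cast_sum]
      refine Finset.sum_congr rfl fun e _ => ?_
      by_cases he : c e ≤ θ
      · simp [he]
      · simp [he, not_le.1 he]
  have hi1 : Integrable (fun θ => ∑ i, s i * (Iio (a i)).indicator (1 : ℝ → ℝ) θ) μ :=
    integrable_finsetSum _ fun i _ => (hint _).const_mul _
  have hi2 : Integrable (fun θ => ∑ e ∈ S, (1 - (Iio (c e)).indicator (1 : ℝ → ℝ) θ)) μ :=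
    integrable_finsetSum _ fun e _ => (integrable_const _).sub (hint _)
  have hμuniv : μ.real univ = R := by
    simp only [μ]
    rw [measureReal_restrict_apply MeasurableSet.univ, univ_inter,
      Real.volume_real_Ioc_of_le hR, sub_zero]
  calc τ * R = ∫ _θ, τ ∂μ := by rw [integral_const, hμuniv, smul_eq_mul, mul_comm]
    _ ≤ ∫ θ, f θ ∂μ := integral_mono (integrable_const _) (hi1.add hi2) hf
    _ = _ := by
      simp only [f]
      rw [integral_add hi1 hi2, integral_finsetSum _ fun i _ => (hint _).const_mul _,
        integral_finsetSum S (f := fun e θ => 1 - (Iio (c e)).indicator (1 : ℝ → ℝ) θ)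
          fun e _ => (integrable_const _).sub (hint _)]
      congr 1
      · refine Finset.sum_congr rfl fun i _ => ?_
        rw [integral_const_mul, integral_indicator_one measurableSet_Iio, hμ _ (ha i).1 (ha i).2,
          mul_comm]
      · refine Finset.sum_congr rfl fun e _ => ?_
        rw [integral_sub (integrable_const _) (hint _), integral_const, hμuniv,
          integral_indicator_one measurableSet_Iio, hμ _ (hc e).1 (hc e).2, smul_eq_mul, mul_one]

/-- The volume of the part of a box mapped by a linear map into a ball of radius `r`, in terms of
an independent set of coordinate directions. -/
theorem exists_volume_box_inter_preimage_ball_le {ι V : Type*} [Fintype ι] [NormedAddCommGroup V]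
    [NormedSpace ℝ V] (u : ι → V) {p : ι → Prop} [DecidablePred p]
    (hp : LinearIndependent ℝ fun e : {e // p e} => u e) :
    ∃ C : ℝ≥0, ∀ (ρ : ι → ℝ≥0) (r : ℝ≥0),
      volume {w : ι → ℝ | (∀ e, |w e| ≤ ρ e) ∧ ‖∑ e, w e • u e‖ ≤ r} ≤
        C * (∏ e with ¬p e, (ρ e : ℝ≥0∞)) * (r : ℝ≥0∞) ^ Fintype.card {e // p e} := by
  let L : ({e // p e} → ℝ) →ₗ[ℝ] V := Fintype.linearCombination ℝ fun e : {e // p e} => u e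
  obtain ⟨K, -, hK⟩ := L.exists_antilipschitzWith (LinearMap.ker_eq_bot.2
    (hp.fintypeLinearCombination_injective))
  refine ⟨(2 * K) ^ Fintype.card {e // p e} * 2 ^ Fintype.card {e // ¬p e}, fun ρ r => ?_⟩
  set A : Set (ι → ℝ) := {w | (∀ e, |w e| ≤ ρ e) ∧ ‖∑ e, w e • u e‖ ≤ r} with hA
  have hAm : MeasurableSet A := by
    have h1 : IsClosed A := by
      refine IsClosed.inter (s₁ := {w : ι → ℝ | ∀ e, |w e| ≤ ρ e})
        (s₂ := {w | ‖∑ e, w e • u e‖ ≤ r}) ?_ (isClosed_le (by fun_prop) continuous_const)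
      rw [Set.ofPred_forall]
      exact isClosed_iInter fun e => isClosed_le (by fun_prop) continuous_const
    exact h1.measurableSet
  let E := MeasurableEquiv.piEquivPiSubtypeProd (fun _ : ι => ℝ) p
  have hE : MeasurePreserving E.symm :=
    (volume_preserving_piEquivPiSubtypeProd (fun _ : ι => ℝ) p).symm
  have hEin : ∀ (x : {e // p e} → ℝ) (y : {e // ¬p e} → ℝ) (e : {e // p e}),
      E.symm (x, y) e = x e := by
    intro x y e
    have := congrArg (fun p => p.1 e) (E.apply_symm_apply (x, y))
    exact this
  have hEout : ∀ (x : {e // p e} → ℝ) (y : {e // ¬p e} → ℝ) (e : {e // ¬p e}),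
      E.symm (x, y) e = y e := by
    intro x y e
    have := congrArg (fun p => p.2 e) (E.apply_symm_apply (x, y))
    exact this
  have hsum : ∀ (x : {e // p e} → ℝ) (y : {e // ¬p e} → ℝ),
      ∑ e, E.symm (x, y) e • u e = L x + ∑ e : {e // ¬p e}, y e • u e := by
    intro x y
    rw [← Fintype.sum_subtype_add_sum_subtype p]
    simp only [hEin, hEout]
    rfl
  let B : Set ({e // ¬p e} → ℝ) := univ.pi fun e => Icc (-(ρ e : ℝ)) (ρ e)
  have hB : volume B = 2 ^ Fintype.card {e // ¬p e} * ∏ e with ¬p e, (ρ e : ℝ≥0∞) := by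
    rw [volume_pi_pi]
    simp only [Real.volume_Icc]
    have : ∀ e : {e // ¬p e}, ENNReal.ofReal ((ρ e : ℝ) - -(ρ e : ℝ)) = 2 * (ρ e : ℝ≥0∞) := by
      intro e
      rw [sub_neg_eq_add, ← two_mul, ENNReal.ofReal_mul (by norm_num)]
      simp
    simp only [this]
    rw [Finset.prod_mul_distrib, Finset.prod_const, Finset.card_univ]
    congr 1
    exact (Finset.prod_subtype (Finset.univ.filter fun e => ¬p e) (by simp)
      fun e => (ρ e : ℝ≥0∞)).symm
  -- With the remaining coordinates `y` fixed, two points of the slice have images under `L` at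
  -- distance at most `2 r`; injectivity of `L` then bounds the diameter of the slice by `2 K r`.
  have hslice : ∀ y, volume ((fun x => (x, y)) ⁻¹' (E.symm ⁻¹' A)) ≤
      B.indicator (fun _ => (2 * K * r : ℝ≥0∞) ^ Fintype.card {e // p e}) y := by
    intro y
    by_cases hy : y ∈ B
    · rw [indicator_of_mem hy]
      refine (Real.volume_pi_le_diam_pow _).trans ?_
      gcongr
      refine Metric.ediam_le fun x hx x' hx' => ?_
      have h1 : ‖L x + ∑ e : {e // ¬p e}, y e • u e‖ ≤ r := by
        rw [← hsum]; exact hx.2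
      have h2 : ‖L x' + ∑ e : {e // ¬p e}, y e • u e‖ ≤ r := by
        rw [← hsum]; exact hx'.2
      have h3 : dist (L x) (L x') ≤ 2 * r := by
        rw [dist_eq_norm]
        calc ‖L x - L x'‖ = ‖(L x + ∑ e : {e // ¬p e}, y e • u e) -
              (L x' + ∑ e : {e // ¬p e}, y e • u e)‖ := by congr 1; abel
          _ ≤ r + r := (norm_sub_le _ _).trans (add_le_add h1 h2)
          _ = 2 * r := by ring
      have h4 := (hK.le_mul_dist x x').trans (mul_le_mul_of_nonneg_left h3 K.coe_nonneg)
      rw [edist_dist]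
      refine (ENNReal.ofReal_le_ofReal h4).trans (le_of_eq ?_)
      rw [ENNReal.ofReal_mul K.coe_nonneg, ENNReal.ofReal_mul (by norm_num)]
      simp
      ring
    · rw [indicator_of_notMem hy]
      have hempty : ((fun x => (x, y)) ⁻¹' (E.symm ⁻¹' A)) = ∅ := by
        refine eq_empty_of_forall_notMem fun x hx => hy ?_
        intro e _
        have := hx.1 e
        rw [hEout x y e] at this
        exact abs_le.1 this
      simp [hempty]
  calc volume A = volume (E.symm ⁻¹' A) := (hE.measure_preimage hAm.nullMeasurableSet).symm
    _ = ∫⁻ y, volume ((fun x => (x, y)) ⁻¹' (E.symm ⁻¹' A)) := by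
        rw [Measure.volume_eq_prod, Measure.prod_apply_symm (E.symm.measurable hAm)]
    _ ≤ ∫⁻ y, B.indicator (fun _ => (2 * K * r : ℝ≥0∞) ^ Fintype.card {e // p e}) y := lintegral_mono hslice
    _ = (2 * K * r : ℝ≥0∞) ^ Fintype.card {e // p e} * volume B := by
        rw [lintegral_indicator (MeasurableSet.univ_pi fun _ => measurableSet_Icc),
          setLIntegral_const]
    _ = _ := by
        rw [hB]
        push_cast
        ring

/-- Domination of measures passes to finite products. -/
theorem pi_le_prod_smul_pi {ι : Type*} [Fintype ι] {X : ι → Type*} [∀ i, MeasurableSpace (X i)]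
    {μ ν : ∀ i, Measure (X i)} [∀ i, SigmaFinite (μ i)] {c : ι → ℝ≥0∞} (hc0 : ∀ i, c i ≠ 0)
    (hct : ∀ i, c i ≠ ∞) (h : ∀ i, μ i ≤ c i • ν i) :
    Measure.pi μ ≤ (∏ i, c i) • Measure.pi ν := by
  have hp0 : ∏ i, c i ≠ 0 := Finset.prod_ne_zero_iff.2 fun i _ => hc0 i
  have hpt : ∏ i, c i ≠ ∞ := ENNReal.prod_ne_top fun i _ => hct i
  have key : ((∏ i, c i)⁻¹ • Measure.pi μ).toOuterMeasure ≤
      OuterMeasure.pi fun i => (ν i).toOuterMeasure := by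
    rw [OuterMeasure.le_pi]
    intro s _
    change (∏ i, c i)⁻¹ * Measure.pi μ (univ.pi s) ≤ _
    rw [Measure.pi_pi, mul_comm, ← div_eq_mul_inv]
    refine ENNReal.div_le_of_le_mul ?_
    rw [← Finset.prod_mul_distrib]
    refine Finset.prod_le_prod' fun i _ => ?_
    rw [mul_comm]
    exact h i (s i)
  refine Measure.le_iff.2 fun s hs => ?_
  have h1 : (∏ i, c i)⁻¹ * Measure.pi μ s ≤ Measure.pi ν s := by
    have h2 : Measure.pi ν s = OuterMeasure.pi (fun i => (ν i).toOuterMeasure) s := by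
      rw [Measure.pi, toMeasure_apply _ _ hs]
    rw [h2]
    exact key s
  rw [Measure.smul_apply, smul_eq_mul]
  calc Measure.pi μ s = (∏ i, c i) * ((∏ i, c i)⁻¹ * Measure.pi μ s) := by
        rw [← mul_assoc, ENNReal.mul_inv_cancel hp0 hpt, one_mul]
    _ ≤ _ := by gcongr

/-- The concatenation of the coordinates of a product of Euclidean spaces preserves volume. -/
theorem measurePreserving_sigma_coords {ι : Type*} [Fintype ι] (m : ι → ℕ) :
    MeasurePreserving (fun (w : ∀ i, EuclideanSpace ℝ (Fin (m i))) (e : Σ i, Fin (m i)) => w e.1 e.2)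
      (Measure.pi fun _ => volume) volume := by
  have hmeas : Measurable fun (w : ∀ i, EuclideanSpace ℝ (Fin (m i))) (e : Σ i, Fin (m i)) =>
      w e.1 e.2 := by
    refine measurable_pi_lambda _ fun e => ?_
    have h1 : Measurable fun x : EuclideanSpace ℝ (Fin (m e.1)) => x e.2 := by fun_prop
    exact h1.comp (measurable_pi_apply e.1)
  refine ⟨hmeas, ?_⟩
  rw [volume_pi]
  refine (Measure.pi_eq fun s hs => ?_).symm
  rw [Measure.map_apply hmeas (MeasurableSet.univ_pi hs)]
  have hpre : (fun (w : ∀ i, EuclideanSpace ℝ (Fin (m i))) (e : Σ i, Fin (m i)) => w e.1 e.2) ⁻¹'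
      (univ.pi s) = univ.pi fun i => WithLp.ofLp ⁻¹' (univ.pi fun j => s ⟨i, j⟩) := by
    ext w
    simp [Sigma.forall]
  rw [hpre, Measure.pi_pi, Fintype.prod_sigma]
  refine Finset.prod_congr rfl fun i _ => ?_
  rw [(PiLp.volume_preserving_ofLp (Fin (m i))).measure_preimage
    (MeasurableSet.univ_pi fun j => hs ⟨i, j⟩).nullMeasurableSet, volume_pi_pi]

/-! ### The map `π` in coordinates -/

section Coordinates

variable {n k : ℕ} {m : Fin n → ℕ}

/-- The images of the standard basis vectors of `ℝ^{m_1} × ⋯ × ℝ^{m_n}` under `π`. -/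
noncomputable def basisImage (π : ProdSpace m →ₗ[ℝ] EuclideanSpace ℝ (Fin k))
    (e : Σ i, Fin (m i)) : EuclideanSpace ℝ (Fin k) :=
  π (WithLp.toLp 2 (Pi.single e.1 (EuclideanSpace.single e.2 1)))

theorem eq_sum_basis (x : ProdSpace m) :
    x = ∑ e : Σ i, Fin (m i), x e.1 e.2 •
      (WithLp.toLp 2 (Pi.single e.1 (EuclideanSpace.single e.2 (1 : ℝ))) : ProdSpace m) := by
  ext i j
  have h : ∀ f : (Σ i, Fin (m i)) → ProdSpace m, (∑ e, f e) i j = ∑ e, f e i j := by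
    intro f
    simp
  rw [h, Finset.sum_eq_single ⟨i, j⟩]
  · simp
  · rintro ⟨i', j'⟩ - hne
    by_cases hi : i' = i
    · subst hi
      have hj : j ≠ j' := fun hj => hne (by rw [hj])
      simp [hj]
    · simp [Pi.single_eq_of_ne (Ne.symm hi)]
  · simp

theorem map_eq_sum_basisImage (π : ProdSpace m →ₗ[ℝ] EuclideanSpace ℝ (Fin k)) (x : ProdSpace m) :
    π x = ∑ e : Σ i, Fin (m i), x e.1 e.2 • basisImage π e := by
  conv_lhs => rw [eq_sum_basis x]
  simp only [map_sum, map_smul, basisImage]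

theorem map_coordSubspace_eq_span (π : ProdSpace m →ₗ[ℝ] EuclideanSpace ℝ (Fin k))
    (J : Finset (Fin n)) :
    (coordSubspace m J).map π = Submodule.span ℝ (basisImage π '' {e | e.1 ∈ J}) := by
  apply le_antisymm
  · rintro _ ⟨x, hx, rfl⟩
    rw [map_eq_sum_basisImage]
    refine Submodule.sum_mem _ fun e _ => ?_
    by_cases he : e.1 ∈ J
    · exact Submodule.smul_mem _ _ (Submodule.subset_span ⟨e, he, rfl⟩)
    · have : x e.1 = 0 := hx e.1 he
      simp [this]
  · rw [Submodule.span_le]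
    rintro _ ⟨e, he, rfl⟩
    refine ⟨_, fun i hi => ?_, rfl⟩
    have hne : i ≠ e.1 := fun h => hi (h ▸ he)
    simp [Pi.single_eq_of_ne hne]

theorem projParam_eq_sum (π : ProdSpace m →ₗ[ℝ] EuclideanSpace ℝ (Fin k)) (l : Param m)
    (x : ProdSpace m) :
    projParam π l x =
      ∑ e : Σ i, Fin (m i), ((l e.1).1 • rot (l e.1).2 (x e.1)) e.2 • basisImage π e := by
  rw [projParam, map_eq_sum_basisImage]
  rfl

theorem norm_map_le_of_norm_le (π : ProdSpace m →ₗ[ℝ] EuclideanSpace ℝ (Fin k)) {x : ProdSpace m}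
    {c : ℝ} (hx : ∀ i, ‖x i‖ ≤ c) : ‖π x‖ ≤ c * ∑ e, ‖basisImage π e‖ := by
  rw [map_eq_sum_basisImage, Finset.mul_sum]
  refine (norm_sum_le _ _).trans (Finset.sum_le_sum fun e _ => ?_)
  rw [norm_smul]
  gcongr
  exact (PiLp.norm_apply_le (x e.1) e.2).trans (hx e.1)

end Coordinates

/-! ### Transversality of the family `π_λ` -/

section Transversality

variable {n k : ℕ} {m : Fin n → ℕ}

/-- The restriction of the measure on parameters to scales `b⁻¹ ≤ |t_i| ≤ b`. -/
noncomputable def boundedParamMeasure (m : Fin n → ℕ) (b : ℝ) : Measure (Param m) :=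
  Measure.pi fun i => (volume.restrict (scaleSet b)).prod (haarSO (m i))

theorem volume_scaleSet_lt_top (b : ℝ) : volume (scaleSet b) < ∞ := by
  have h : scaleSet b ⊆ Icc (-b) b := fun t ht => abs_le.1 ht.2
  exact (measure_mono h).trans_lt (by simp)

instance (b : ℝ) : IsFiniteMeasure (volume.restrict (scaleSet b)) :=
  ⟨by simpa using volume_scaleSet_lt_top b⟩

instance (b : ℝ) : IsFiniteMeasure (boundedParamMeasure m b) := by
  unfold boundedParamMeasure
  infer_instance

theorem ae_abs_le_boundedParamMeasure (m : Fin n → ℕ) (b : ℝ) :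
    ∀ᵐ l ∂boundedParamMeasure m b, ∀ i, |(l i).1| ≤ b := by
  rw [ae_all_iff]
  intro i
  have h1 : ∀ᵐ t ∂(volume.restrict (scaleSet b)), |t| ≤ b :=
    (ae_restrict_mem (measurableSet_scaleSet b)).mono fun t ht => ht.2
  have h2 : ∀ᵐ p ∂((volume.restrict (scaleSet b)).prod (haarSO (m i))), |p.1| ≤ b :=
    Measure.quasiMeasurePreserving_fst.ae h1
  exact (Measure.tendsto_eval_ae_ae (μ := fun i =>
    (volume.restrict (scaleSet b)).prod (haarSO (m i))) (i := i)).eventually h2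

/-- The joint law of the rotated and scaled components of a vector. -/
theorem exists_map_boundedParamMeasure_le (m : Fin n → ℕ) {b : ℝ} (hb : 0 < b) :
    ∃ C : ℝ≥0, ∀ z : ∀ i, EuclideanSpace ℝ (Fin (m i)), (∀ i, m i = 0 ∨ z i ≠ 0) →
      (boundedParamMeasure m b).map (fun l i => (l i).1 • rot (l i).2 (z i)) ≤
        (C * ∏ i, (‖z i‖ₑ ^ m i)⁻¹) • (Measure.pi fun _ => volume).restrict
          (univ.pi fun i => Metric.closedBall 0 (b * ‖z i‖)) := by
  choose C hC using fun i => map_smul_rot_le (m i) hb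
  refine ⟨∏ i, (C i + 1), fun z hz => ?_⟩
  have hf : ∀ i, Measurable fun p : ℝ × SO (m i) => p.1 • rot p.2 (z i) := fun i =>
    (continuous_fst.smul (continuous_rot.comp
      (continuous_snd.prodMk continuous_const))).measurable
  have hmap : (boundedParamMeasure m b).map (fun l i => (l i).1 • rot (l i).2 (z i)) =
      Measure.pi fun i => ((volume.restrict (scaleSet b)).prod (haarSO (m i))).map
        fun p => p.1 • rot p.2 (z i) := by
    rw [boundedParamMeasure, Measure.pi_map_pi fun i => (hf i).aemeasurable]
  rw [hmap, Measure.restrict_pi_pi]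
  have hpow : ∀ i, ‖z i‖ₑ ^ m i ≠ 0 := fun i => by
    rcases hz i with h | h
    · simp [h]
    · exact pow_ne_zero _ (by simpa using h)
  have hpow' : ∀ i, ‖z i‖ₑ ^ m i ≠ ∞ := fun i => ENNReal.pow_ne_top enorm_ne_top
  have hle := pi_le_prod_smul_pi
    (μ := fun i => ((volume.restrict (scaleSet b)).prod (haarSO (m i))).map
      fun p => p.1 • rot p.2 (z i))
    (ν := fun i => volume.restrict (Metric.closedBall 0 (b * ‖z i‖)))
    (c := fun i => ((C i + 1 : ℝ≥0) : ℝ≥0∞) * (‖z i‖ₑ ^ m i)⁻¹)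
    (fun i => mul_ne_zero (by simp) (ENNReal.inv_ne_zero.2 (hpow' i)))
    (fun i => ENNReal.mul_ne_top ENNReal.coe_ne_top (ENNReal.inv_ne_top.2 (hpow i)))
    (fun i => (hC i (z i) (hz i)).trans (by
      refine Measure.le_iff.2 fun s _ => ?_
      simp only [Measure.smul_apply, smul_eq_mul]
      gcongr
      exact le_self_add))
  rw [Finset.prod_mul_distrib] at hle
  simpa using hle

/-- The joint density contributes one factor `(ρ e.1)⁻¹` per coordinate `e`, and the volume estimate
contributes `r` for `e ∈ S` and `b * ρ e.1` otherwise, so only the factors `r / ρ e.1` with `e ∈ S`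
survive. When `m i = 0` there are no coordinates and `ρ i` is irrelevant. -/
theorem exists_boundedParamMeasure_le_of_linearIndepOn
    (π : ProdSpace m →ₗ[ℝ] EuclideanSpace ℝ (Fin k)) {b : ℝ} (hb : 0 < b) :
    ∃ C : ℝ≥0, ∀ (ρ : Fin n → ℝ≥0) (z : ProdSpace m), (∀ i, 0 < ρ i) →
      (∀ i, m i = 0 ∨ ‖z i‖₊ = ρ i) → ∀ S : Finset (Σ i, Fin (m i)),
      LinearIndepOn ℝ (basisImage π) (S : Set (Σ i, Fin (m i))) → ∀ r : ℝ≥0,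
      boundedParamMeasure m b {l | ‖projParam π l z‖ ≤ r} ≤
        (C * ∏ e ∈ S, (r / ρ e.1) : ℝ≥0) := by
  classical
  obtain ⟨C₁, hC₁⟩ := exists_map_boundedParamMeasure_le m hb
  have hvol : ∀ S : Finset (Σ i, Fin (m i)), ∃ C : ℝ≥0,
      LinearIndepOn ℝ (basisImage π) (S : Set (Σ i, Fin (m i))) →
      ∀ (ρ : (Σ i, Fin (m i)) → ℝ≥0) (r : ℝ≥0),
        volume {w : (Σ i, Fin (m i)) → ℝ | (∀ e, |w e| ≤ ρ e) ∧
          ‖∑ e, w e • basisImage π e‖ ≤ r} ≤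
        C * (∏ e with e ∉ S, (ρ e : ℝ≥0∞)) * (r : ℝ≥0∞) ^ S.card := by
    intro S
    by_cases hS : LinearIndepOn ℝ (basisImage π) (S : Set (Σ i, Fin (m i)))
    · obtain ⟨C, hC⟩ := exists_volume_box_inter_preimage_ball_le (basisImage π)
        (p := fun e => e ∈ S) hS
      refine ⟨C, fun _ ρ r => ?_⟩
      have := hC ρ r
      rwa [Fintype.card_coe] at this
    · exact ⟨0, fun h => absurd h hS⟩
  choose C₂ hC₂ using hvol
  let B : ℝ≥0 := ⟨b, hb.le⟩
  -- Summing over the finitely many `S` makes the constant independent of `S`.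
  refine ⟨∑ S, C₁ * C₂ S * ∏ e with e ∉ S, B, fun ρ z hρ hz S hS r => ?_⟩
  have hz' : ∀ i, m i = 0 ∨ z i ≠ 0 := fun i => (hz i).imp_right fun h h0 => by
    rw [h0, nnnorm_zero] at h
    exact (hρ i).ne h
  let T : Param m → ∀ i, EuclideanSpace ℝ (Fin (m i)) := fun l i => (l i).1 • rot (l i).2 (z i)
  have hf : ∀ i, Measurable fun p : ℝ × SO (m i) => p.1 • rot p.2 (z i) := fun i =>
    (continuous_fst.smul (continuous_rot.comp
      (continuous_snd.prodMk continuous_const))).measurable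
  have hT : Measurable T := measurable_pi_lambda _ fun i => (hf i).comp (measurable_pi_apply i)
  let φ : (∀ i, EuclideanSpace ℝ (Fin (m i))) → ((Σ i, Fin (m i)) → ℝ) := fun w e => w e.1 e.2
  have hφ : MeasurePreserving φ (Measure.pi fun _ => volume) volume :=
    measurePreserving_sigma_coords m
  let A : Set ((Σ i, Fin (m i)) → ℝ) := {w | ‖∑ e, w e • basisImage π e‖ ≤ r}
  have hA : IsClosed A := isClosed_le (by fun_prop) continuous_const
  let Q : Set ((Σ i, Fin (m i)) → ℝ) :=
    {w | (∀ e, |w e| ≤ (B * ρ e.1 : ℝ≥0)) ∧ ‖∑ e, w e • basisImage π e‖ ≤ r}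
  have hQ : IsClosed Q := by
    have h : Q = (⋂ e, {w : (Σ i, Fin (m i)) → ℝ | |w e| ≤ ((B * ρ e.1 : ℝ≥0) : ℝ)}) ∩ A := by
      ext w
      simp [Q, A]
    rw [h]
    exact (isClosed_iInter fun e => isClosed_le (by fun_prop) continuous_const).inter hA
  have hbox : MeasurableSet (univ.pi fun i =>
      Metric.closedBall (0 : EuclideanSpace ℝ (Fin (m i))) (b * ‖z i‖)) :=
    MeasurableSet.univ_pi fun i => Metric.isClosed_closedBall.measurableSet
  have hsub : φ ⁻¹' A ∩ (univ.pi fun i =>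
      Metric.closedBall (0 : EuclideanSpace ℝ (Fin (m i))) (b * ‖z i‖)) ⊆ φ ⁻¹' Q := by
    rintro w ⟨hw, hw'⟩
    refine ⟨fun e => ?_, hw⟩
    have h1 := hw' e.1 (mem_univ _)
    rw [mem_closedBall_zero_iff] at h1
    have h2 : ‖z e.1‖ = ρ e.1 := by
      rcases hz e.1 with h | h
      · exact absurd e.2.2 (by omega)
      · rw [← h]; rfl
    rw [h2] at h1
    exact (PiLp.norm_apply_le (w e.1) e.2).trans h1
  have hset : {l | ‖projParam π l z‖ ≤ r} = T ⁻¹' (φ ⁻¹' A) := by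
    ext l
    change ‖projParam π l z‖ ≤ r ↔ _
    rw [projParam_eq_sum]
    rfl
  have hfac : ∏ i, (‖z i‖ₑ ^ m i)⁻¹ = ((∏ e : Σ i, Fin (m i), (ρ e.1)⁻¹ : ℝ≥0) : ℝ≥0∞) := by
    rw [Fintype.prod_sigma, ENNReal.ofNNReal_finsetProd]
    refine Finset.prod_congr rfl fun i _ => ?_
    change _ = ((∏ _j : Fin (m i), (ρ i)⁻¹ : ℝ≥0) : ℝ≥0∞)
    rw [Finset.prod_const, Finset.card_univ, Fintype.card_fin, ENNReal.coe_pow,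
      ENNReal.coe_inv (hρ i).ne', ← ENNReal.inv_pow]
    rcases hz i with h | h
    · simp [h]
    · rw [enorm_eq_nnnorm, h]
  calc boundedParamMeasure m b {l | ‖projParam π l z‖ ≤ r}
      = (boundedParamMeasure m b).map T (φ ⁻¹' A) := by
        rw [hset, Measure.map_apply hT (hφ.measurable hA.measurableSet)]
    _ ≤ (C₁ * ∏ i, (‖z i‖ₑ ^ m i)⁻¹) * (Measure.pi fun _ => volume) (φ ⁻¹' Q) := by
        refine (hC₁ _ hz' _).trans ?_
        rw [Measure.smul_apply, smul_eq_mul, Measure.restrict_apply' hbox]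
        gcongr
    _ ≤ (C₁ * ∏ i, (‖z i‖ₑ ^ m i)⁻¹) *
        (C₂ S * (∏ e with e ∉ S, ((B * ρ e.1 : ℝ≥0) : ℝ≥0∞)) * (r : ℝ≥0∞) ^ S.card) := by
        rw [hφ.measure_preimage hQ.measurableSet.nullMeasurableSet]
        gcongr
        exact hC₂ S hS (fun e => B * ρ e.1) r
    _ = ((C₁ * C₂ S * ∏ e with e ∉ S, B) * ∏ e ∈ S, (r / ρ e.1) : ℝ≥0) := by
        rw [hfac]
        norm_cast
        rw [← Finset.prod_filter_mul_prod_filter_not Finset.univ (fun e => e ∈ S),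
          Finset.prod_mul_distrib]
        simp only [Finset.filter_mem_eq_inter, Finset.univ_inter, div_eq_mul_inv,
          Finset.prod_mul_distrib, Finset.prod_inv_distrib, Finset.prod_const r]
        have h1 : (∏ e with e ∉ S, ρ e.1 : ℝ≥0) ≠ 0 :=
          Finset.prod_ne_zero_iff.2 fun e _ => (hρ e.1).ne'
        field_simp
    _ ≤ _ := by
        gcongr
        exact Finset.single_le_sum (f := fun S => C₁ * C₂ S * ∏ e with e ∉ S, B)
          (fun _ _ => zero_le) (Finset.mem_univ S)

/-- With `a_i = -log ρ_i` and `R = -log r`, the threshold inequalities integrate to the logarithm of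
the claim. -/
theorem prod_div_le_rpow_mul_prod_rpow {κ ι : Type*} [Fintype ι] (S : Finset κ) (j : κ → ι)
    {ρ : ι → ℝ} {s : ι → ℝ} {r τ : ℝ} (hr : 0 < r) (hr1 : r ≤ 1) (hρ : ∀ i, r ≤ ρ i) 
    (hρ1 : ∀ i, ρ i ≤ 1) (h : ∀ θ : ℝ, τ ≤ (∑ i with θ < -Real.log (ρ i), s i) +
      (S.filter fun e => -Real.log (ρ (j e)) ≤ θ).card) :
    ∏ e ∈ S, r / ρ (j e) ≤ r ^ τ * ∏ i, ρ i ^ (-s i) := by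
  have hρ0 : ∀ i, 0 < ρ i := fun i => hr.trans_le (hρ i)
  have hlog : ∀ i, -Real.log (ρ i) ≤ -Real.log r := fun i =>
    neg_le_neg (Real.log_le_log hr (hρ i))
  have hlog0 : ∀ i, 0 ≤ -Real.log (ρ i) := fun i =>
    neg_nonneg.2 (Real.log_nonpos (hρ0 i).le (hρ1 i))
  have hR : 0 ≤ -Real.log r := neg_nonneg.2 (Real.log_nonpos hr.le hr1)
  have key := mul_le_sum_of_threshold S (fun i => -Real.log (ρ i)) s
    (fun e => -Real.log (ρ (j e))) hR (fun i => ⟨hlog0 i, hlog i⟩)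
    (fun e => ⟨hlog0 _, hlog _⟩) h
  have h1 : ∏ e ∈ S, r / ρ (j e) =
      Real.exp (-∑ e ∈ S, (-Real.log r - -Real.log (ρ (j e)))) := by
    rw [← Finset.sum_neg_distrib, Real.exp_sum]
    refine Finset.prod_congr rfl fun e _ => ?_
    rw [← Real.exp_log (div_pos hr (hρ0 (j e))), Real.log_div hr.ne' (hρ0 _).ne']
    congr 1
    ring
  have h2 : r ^ τ * ∏ i, ρ i ^ (-s i) =
      Real.exp (-(τ * -Real.log r) + ∑ i, -Real.log (ρ i) * s i) := by
    rw [Real.exp_add, Real.exp_sum, Real.rpow_def_of_pos hr]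
    congr 1
    · congr 1
      ring
    · refine Finset.prod_congr rfl fun i _ => ?_
      rw [Real.rpow_def_of_pos (hρ0 i)]
      congr 1
      ring
  rw [h1, h2]
  exact Real.exp_le_exp.2 (by linarith)

/-- Components shorter than `r`, possibly zero, are replaced by vectors of length exactly `r`. This
changes `π_λ z` by `O(r)` for bounded scales and makes the density bound applicable. -/
theorem exists_norm_sub_le_of_nnnorm_eq_max (z : ProdSpace m) (r : ℝ≥0) :
    ∃ z' : ProdSpace m, (∀ i, ‖z' i - z i‖ ≤ 2 * r) ∧ ∀ i, m i = 0 ∨ ‖z' i‖₊ = max ‖z i‖₊ r := by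
  have h : ∀ i, ∃ y : EuclideanSpace ℝ (Fin (m i)), ‖y - z i‖ ≤ 2 * r ∧
      (m i = 0 ∨ ‖y‖₊ = max ‖z i‖₊ r) := by
    intro i
    rcases Nat.eq_zero_or_pos (m i) with hm | hm
    · exact ⟨z i, by simp, Or.inl hm⟩
    rcases le_total r ‖z i‖₊ with hr | hr
    · exact ⟨z i, by simp, Or.inr (max_eq_left hr).symm⟩
    · have : Nonempty (Fin (m i)) := ⟨⟨0, hm⟩⟩
      obtain ⟨y, hy⟩ := exists_norm_eq (EuclideanSpace ℝ (Fin (m i))) r.coe_nonneg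
      refine ⟨y, ?_, Or.inr ?_⟩
      · have h1 := norm_sub_le y (z i)
        have h2 : ‖z i‖ ≤ r := hr
        linarith
      · rw [max_eq_right hr]
        exact NNReal.coe_injective hy
  choose y hy using h
  exact ⟨WithLp.toLp 2 y, fun i => (hy i).1, fun i => (hy i).2⟩

theorem projParam_add (π : ProdSpace m →ₗ[ℝ] EuclideanSpace ℝ (Fin k)) (l : Param m)
    (x y : ProdSpace m) : projParam π l (x + y) = projParam π l x + projParam π l y := by
  rw [projParam, projParam, projParam, ← map_add]
  congr 1
  ext i : 2
  simp

theorem projParam_smul (π : ProdSpace m →ₗ[ℝ] EuclideanSpace ℝ (Fin k)) (l : Param m)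
    (c : ℝ) (x : ProdSpace m) : projParam π l (c • x) = c • projParam π l x := by
  rw [projParam, projParam, ← map_smul]
  congr 1
  refine PiLp.ext fun i => ?_
  change (l i).1 • rot (l i).2 (c • x i) = c • (l i).1 • rot (l i).2 (x i)
  rw [rot_smul, smul_comm]

/-- `π_λ` as a linear map. -/
noncomputable def projLinear (π : ProdSpace m →ₗ[ℝ] EuclideanSpace ℝ (Fin k)) (l : Param m) :
    ProdSpace m →ₗ[ℝ] EuclideanSpace ℝ (Fin k) where
  toFun := projParam π l
  map_add' := projParam_add π l
  map_smul' := projParam_smul π l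

theorem projParam_sub (π : ProdSpace m →ₗ[ℝ] EuclideanSpace ℝ (Fin k)) (l : Param m)
    (x y : ProdSpace m) : projParam π l (x - y) = projParam π l x - projParam π l y :=
  map_sub (projLinear π l) x y

/-- The transversality estimate for the family `π_λ`. -/
theorem exists_boundedParamMeasure_norm_projParam_le
    (π : ProdSpace m →ₗ[ℝ] EuclideanSpace ℝ (Fin k)) {b : ℝ} (hb : 0 < b) {s : Fin n → ℝ≥0}
    {τ : ℝ} (hτ : ∀ I : Finset (Fin n),
      τ ≤ ∑ i ∈ I, (s i : ℝ) + Module.finrank ℝ ((coordSubspace m Iᶜ).map π)) :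
    ∃ C : ℝ≥0, ∀ z : ProdSpace m, (∀ i, ‖z i‖ ≤ 1) → ∀ r : ℝ≥0, 0 < r → r ≤ 1 →
      boundedParamMeasure m b {l | ‖projParam π l z‖ ≤ r} ≤
        C * (r : ℝ≥0∞) ^ τ * ∏ i, ‖z i‖ₑ ^ (-(s i : ℝ)) := by
  obtain ⟨C, hC⟩ := exists_boundedParamMeasure_le_of_linearIndepOn π hb
  -- `D - 1` bounds the displacement of `π_λ z`, in units of `r`, when each component moves by at
  -- most `2 r` and `|t_i| ≤ b`.
  have hD0 : 0 ≤ 1 + b * 2 * ∑ e, ‖basisImage π e‖ := by positivity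
  let D : ℝ≥0 := ⟨1 + b * 2 * ∑ e, ‖basisImage π e‖, hD0⟩
  have hD : (D : ℝ) = 1 + b * 2 * ∑ e, ‖basisImage π e‖ := rfl
  have hD1 : 1 ≤ D := by
    rw [← NNReal.coe_le_coe, hD, NNReal.coe_one]
    have : 0 ≤ b * 2 * ∑ e, ‖basisImage π e‖ := by positivity
    linarith
  refine ⟨C * D ^ Fintype.card (Σ i, Fin (m i)), fun z hz r hr hr1 => ?_⟩
  obtain ⟨z', hz', hz''⟩ := exists_norm_sub_le_of_nnnorm_eq_max z r
  let ρ : Fin n → ℝ≥0 := fun i => max ‖z i‖₊ r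
  have hrρ : ∀ i, r ≤ ρ i := fun i => le_max_right _ _
  have hρ1 : ∀ i, ρ i ≤ 1 := fun i => max_le (hz i) hr1
  have hρ0 : ∀ i, 0 < ρ i := fun i => hr.trans_le (hrρ i)
  obtain ⟨S, hS, hcard⟩ := exists_linearIndepOn_card_sublevel (basisImage π)
    fun e => -Real.log (ρ e.1)
  have hreal : ∏ e ∈ S, (r : ℝ) / ρ e.1 ≤ (r : ℝ) ^ τ * ∏ i, (ρ i : ℝ) ^ (-(s i : ℝ)) := by
    refine prod_div_le_rpow_mul_prod_rpow S (fun e => e.1) (ρ := fun i => (ρ i : ℝ)) hr hr1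
      hrρ hρ1 fun θ => ?_
    rw [hcard]
    -- The hypothesis is used for the set `I` of indices with `ρ i < exp (-θ)`; the greedy `S`
    -- counts exactly the rank of `π` on the complementary coordinates.
    refine (hτ (Finset.univ.filter fun i => θ < -Real.log (ρ i))).trans_eq ?_
    have h1 : {e : Σ i, Fin (m i) | e.1 ∈ (Finset.univ.filter fun i => θ < -Real.log (ρ i))ᶜ} =
        {e | -Real.log (ρ e.1) ≤ θ} := by
      ext e
      rw [mem_ofPred_eq, mem_ofPred_eq, Finset.mem_compl, Finset.mem_filter]
      simp only [Finset.mem_univ, true_and, not_lt]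
    rw [map_coordSubspace_eq_span, h1]
  have hnn : ∏ e ∈ S, r / ρ e.1 ≤ r ^ τ * ∏ i, ρ i ^ (-(s i : ℝ)) := by
    rw [← NNReal.coe_le_coe]
    push_cast
    exact hreal
  have hincl : boundedParamMeasure m b {l | ‖projParam π l z‖ ≤ r} ≤
      boundedParamMeasure m b {l | ‖projParam π l z'‖ ≤ (D * r : ℝ≥0)} := by
    refine measure_mono_ae ?_
    filter_upwards [ae_abs_le_boundedParamMeasure m b] with l hl hlz
    have h1 : ‖projParam π l (z' - z)‖ ≤ b * (2 * r) * ∑ e, ‖basisImage π e‖ := by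
      refine norm_map_le_of_norm_le π fun i => ?_
      change ‖(l i).1 • rot (l i).2 ((z' - z) i)‖ ≤ _
      rw [norm_smul, norm_rot]
      exact mul_le_mul (hl i) (hz' i) (norm_nonneg _) hb.le
    have h2 : projParam π l z' = projParam π l z + projParam π l (z' - z) := by
      rw [← projParam_add]
      congr 1
      abel
    have h3 : ‖projParam π l z‖ ≤ r := hlz
    change ‖projParam π l z'‖ ≤ (D * r : ℝ≥0)
    rw [h2, NNReal.coe_mul, hD]
    refine (norm_add_le _ _).trans ?_
    linarith
  calc boundedParamMeasure m b {l | ‖projParam π l z‖ ≤ r}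
      ≤ (C * ∏ e ∈ S, ((D * r) / ρ e.1) : ℝ≥0) := hincl.trans (hC ρ z' hρ0 hz'' S hS (D * r))
    _ ≤ (C * D ^ Fintype.card (Σ i, Fin (m i)) * (r ^ τ * ∏ i, ρ i ^ (-(s i : ℝ))) : ℝ≥0) := by
        rw [ENNReal.coe_le_coe, mul_assoc C]
        simp only [mul_div_assoc, Finset.prod_mul_distrib, Finset.prod_const]
        gcongr
        exact Finset.card_le_univ S
    _ = ((C * D ^ Fintype.card (Σ i, Fin (m i)) : ℝ≥0) : ℝ≥0∞) * (r : ℝ≥0∞) ^ τ *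
        ∏ i, (ρ i : ℝ≥0∞) ^ (-(s i : ℝ)) := by
        rw [ENNReal.coe_mul _ (r ^ τ * _), ENNReal.coe_mul (r ^ τ), mul_assoc,
          ENNReal.coe_rpow_of_ne_zero hr.ne', ENNReal.ofNNReal_finsetProd]
        congr 2
        refine Finset.prod_congr rfl fun i _ => ?_
        rw [ENNReal.coe_rpow_of_ne_zero (hρ0 i).ne']
    -- Negative powers decrease, and `‖z i‖ ≤ ρ i`.
    _ ≤ _ := by
        refine mul_le_mul_right (Finset.prod_le_prod' fun i _ => ?_) _
        rw [ENNReal.rpow_neg, ENNReal.rpow_neg, ENNReal.inv_le_inv]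
        refine ENNReal.rpow_le_rpow ?_ (s i).coe_nonneg
        rw [enorm_eq_nnnorm]
        exact ENNReal.coe_le_coe.2 (le_max_left _ _)

end Transversality

/-! ### From correlation integrals to dimension and positive measure -/

section Correlation

/-- A measure whose dyadic correlation sums of exponent `τ` converge lives on a set of dimension at
least `τ`. -/
theorem le_dimH_of_tsum_correlation_ne_top {X : Type*} [MetricSpace X] [SecondCountableTopology X]
    [MeasurableSpace X] [BorelSpace X] {ν : Measure X} [IsProbabilityMeasure ν] {Z : Set X}
    (hZ : MeasurableSet Z) (hνZ : ν Z = 1) {τ : ℝ≥0}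
    (h : ∑' j : ℕ, ((2⁻¹ ^ j : ℝ≥0∞) ^ (τ : ℝ))⁻¹ *
      (ν.prod ν) {p | dist p.1 p.2 ≤ 2⁻¹ ^ j} ≠ ∞) :
    (τ : ℝ≥0∞) ≤ dimH Z := by
  let c : ℕ → ℝ≥0∞ := fun j => (2⁻¹ ^ j : ℝ≥0∞) ^ (τ : ℝ)
  have hc0 : ∀ j, c j ≠ 0 := fun j => by
    simp [c, ENNReal.rpow_eq_zero_iff]
  have hct : ∀ j, c j ≠ ∞ := fun j =>
    ENNReal.rpow_ne_top_of_nonneg τ.coe_nonneg (ENNReal.pow_ne_top (by simp))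
  have hset : ∀ j : ℕ, MeasurableSet {p : X × X | dist p.1 p.2 ≤ 2⁻¹ ^ j} := fun j =>
    (isClosed_le continuous_dist continuous_const).measurableSet
  have hball : ∀ (j : ℕ) (x : X), Prod.mk x ⁻¹' {p : X × X | dist p.1 p.2 ≤ 2⁻¹ ^ j} =
      Metric.closedBall x (2⁻¹ ^ j) := fun j x => by
    ext y
    simp [dist_comm]
  have hmeas : ∀ j : ℕ, Measurable fun x => ν (Metric.closedBall x (2⁻¹ ^ j)) := fun j => by
    have := measurable_measure_prodMk_left (ν := ν) (hset j)
    simpa only [hball] using this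
  -- By hypothesis `f` is `ν`-integrable, so it is bounded by some `N` on a part of `Z` of positive
  -- measure. There every dyadic ball satisfies `ν(B) ≤ N * 2^(-jτ)`, as the mass distribution
  -- principle requires.
  let f : X → ℝ≥0∞ := fun x => ∑' j : ℕ, (c j)⁻¹ * ν (Metric.closedBall x (2⁻¹ ^ j))
  have hf : Measurable f := Measurable.tsum fun j => (hmeas j).const_mul _
  have hint : ∫⁻ x, f x ∂ν ≠ ∞ := by
    rw [lintegral_tsum fun j => ((hmeas j).const_mul _).aemeasurable]
    convert h using 4 with j
    rw [lintegral_const_mul _ (hmeas j), Measure.prod_apply (hset j)]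
    simp only [hball, c]
  have hfin : ∀ᵐ x ∂ν, f x < ∞ := ae_lt_top hf hint
  have hex : ∃ N : ℕ, ν (Z ∩ {x | f x ≤ N}) ≠ 0 := by
    by_contra! hcon
    have h1 : ν (⋃ N : ℕ, Z ∩ {x | f x ≤ N}) = 0 := measure_iUnion_null hcon
    have h2 : Z ≤ᵐ[ν] (⋃ N : ℕ, Z ∩ {x | f x ≤ N}) := by
      filter_upwards [hfin] with x hx hxZ
      obtain ⟨N, hN⟩ := ENNReal.exists_nat_gt hx.ne
      exact mem_iUnion.2 ⟨N, hxZ, hN.le⟩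
    have := measure_mono_ae h2
    rw [h1, hνZ] at this
    simp at this
  obtain ⟨N, hN⟩ := hex
  refine le_trans ?_ (dimH_mono (inter_subset_left : Z ∩ {x | f x ≤ N} ⊆ Z))
  refine le_dimH_of_measure_closedBall_le (C := N)
    (hZ.inter (measurableSet_le hf measurable_const)) hN fun x hx j => ?_
  have h1 : (c j)⁻¹ * ν (Metric.closedBall x (2⁻¹ ^ j)) ≤ N :=
    (ENNReal.le_tsum j).trans hx.2
  have h2 : ν (Metric.closedBall x (2⁻¹ ^ j)) / c j ≤ N := by
    rwa [div_eq_mul_inv, mul_comm]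
  have h3 := (ENNReal.div_le_iff (hc0 j) (hct j)).1 h2
  simpa using h3

variable {E : Type*} [NormedAddCommGroup E] [NormedSpace ℝ E] [FiniteDimensional ℝ E]
  [MeasurableSpace E] [BorelSpace E]

/-- The function `g x = ν (closedBall x r)` has integral `V = κ (closedBall 0 r)`, vanishes off the
`r`-neighbourhood of `Z`, and has square integral at most `V * Q`. A Cauchy–Schwarz argument then
gives the neighbourhood measure at least of order `V / Q`. -/
theorem addHaar_closedBall_le_of_correlation_le (κ : Measure E) [κ.IsAddHaarMeasure]
    {ν : Measure E} [IsProbabilityMeasure ν] {Z : Set E} (hνZ : ν Zᶜ = 0) {r : ℝ}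
    {Q : ℝ≥0} (hQ : 0 < Q) (h : (ν.prod ν) {p | dist p.1 p.2 ≤ 2 * r} ≤ Q) :
    κ (Metric.closedBall 0 r) ≤ 4 * Q * κ (Metric.cthickening r Z) := by
  have := FiniteDimensional.proper ℝ E
  let V : ℝ≥0∞ := κ (Metric.closedBall 0 r)
  have hVt : V ≠ ∞ := measure_closedBall_lt_top.ne
  have hVx : ∀ x, κ (Metric.closedBall x r) = V := fun x => Measure.addHaar_closedBall_center κ x r
  let D : Set (E × E) := {p | dist p.1 p.2 ≤ r}
  have hD : MeasurableSet D := (isClosed_le continuous_dist continuous_const).measurableSet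
  let g : E → ℝ≥0∞ := fun x => ν (Metric.closedBall x r)
  have hsec : ∀ x, Prod.mk x ⁻¹' D = Metric.closedBall x r := fun x => by
    ext y
    simp [D, dist_comm]
  have hsec' : ∀ y, (fun x => (x, y)) ⁻¹' D = Metric.closedBall y r := fun y => by
    ext x
    simp [D]
  have hg : Measurable g := by
    have := measurable_measure_prodMk_left (ν := ν) hD
    simpa only [hsec] using this
  have hg0 : ∀ x, x ∉ Metric.cthickening r Z → g x = 0 := by
    intro x hx
    have hsub : Metric.closedBall x r ⊆ Zᶜ := fun y hy hyZ => hx ?_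
    · exact measure_mono_null hsub hνZ
    exact Metric.mem_cthickening_of_dist_le x y r Z hyZ (by rwa [dist_comm])
  have hint : ∫⁻ x, g x ∂κ = V := by
    have h1 := Measure.prod_apply (μ := κ) (ν := ν) hD
    rw [Measure.prod_apply_symm hD] at h1
    simp only [hsec, hsec', hVx, lintegral_const, measure_univ, mul_one] at h1
    exact h1.symm
  have hint2 : ∫⁻ x, g x * g x ∂κ ≤ V * Q := by
    let W : Set (E × (E × E)) := {q | dist q.1 q.2.1 ≤ r ∧ dist q.1 q.2.2 ≤ r}
    have hW : MeasurableSet W := by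
      refine IsClosed.measurableSet ?_
      exact (isClosed_le (continuous_fst.dist (continuous_fst.comp continuous_snd))
        continuous_const).inter
        (isClosed_le (continuous_fst.dist (continuous_snd.comp continuous_snd)) continuous_const)
    have h1 := Measure.prod_apply (μ := κ) (ν := ν.prod ν) hW
    have hW1 : ∀ x, Prod.mk x ⁻¹' W = Metric.closedBall x r ×ˢ Metric.closedBall x r := fun x => by
      ext y
      simp [W, dist_comm]
    simp only [hW1, Measure.prod_prod] at h1
    change ∫⁻ x, ν (Metric.closedBall x r) * ν (Metric.closedBall x r) ∂κ ≤ _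
    rw [← h1, Measure.prod_apply_symm hW]
    have hT : MeasurableSet {p : E × E | dist p.1 p.2 ≤ 2 * r} :=
      (isClosed_le continuous_dist continuous_const).measurableSet
    calc ∫⁻ p, κ ((fun x => (x, p)) ⁻¹' W) ∂(ν.prod ν)
        ≤ ∫⁻ p, {p : E × E | dist p.1 p.2 ≤ 2 * r}.indicator (fun _ => V) p ∂(ν.prod ν) := by
          refine lintegral_mono fun p => ?_
          by_cases hp : dist p.1 p.2 ≤ 2 * r
          · rw [indicator_of_mem (by exact hp), ← hVx p.1]
            exact measure_mono fun x hx => hx.1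
          · rw [indicator_of_notMem (by exact hp), nonpos_iff_eq_zero]
            refine measure_mono_null (fun x hx => hp ?_) measure_empty
            have := dist_triangle_left p.1 p.2 x
            have h1 := hx.1
            have h2 := hx.2
            simp only at h1 h2
            linarith
      _ = V * (ν.prod ν) {p | dist p.1 p.2 ≤ 2 * r} := by
          rw [lintegral_indicator hT, setLIntegral_const]
      _ ≤ V * Q := by gcongr
  have hQ0 : (2 * Q : ℝ≥0∞) ≠ 0 := by simp [hQ.ne']
  have hQt : (2 * Q : ℝ≥0∞) ≠ ∞ := ENNReal.mul_ne_top (by simp) (by simp)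
  -- Either `g ≤ 2Q`, or `g ≤ g² / (2Q)`. After integration the second term is at most `V / 2` and
  -- is absorbed on the left.
  have hpt : ∀ x, g x ≤ (Metric.cthickening r Z).indicator (fun _ => 2 * (Q : ℝ≥0∞)) x +
      (2 * Q : ℝ≥0∞)⁻¹ * (g x * g x) := by
    intro x
    by_cases hx : x ∈ Metric.cthickening r Z
    · rw [indicator_of_mem hx]
      rcases le_total (g x) (2 * Q) with h1 | h1
      · exact h1.trans le_self_add
      · refine le_add_left ?_
        calc g x = (2 * Q : ℝ≥0∞)⁻¹ * (g x * (2 * Q)) := by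
              rw [mul_comm (g x), ← mul_assoc, ENNReal.inv_mul_cancel hQ0 hQt, one_mul]
          _ ≤ _ := by gcongr
    · rw [hg0 x hx]
      exact zero_le
  have hmain : V ≤ 2 * Q * κ (Metric.cthickening r Z) + V / 2 := by
    calc V = ∫⁻ x, g x ∂κ := hint.symm
      _ ≤ ∫⁻ x, ((Metric.cthickening r Z).indicator (fun _ => 2 * (Q : ℝ≥0∞)) x +
            (2 * Q : ℝ≥0∞)⁻¹ * (g x * g x)) ∂κ := lintegral_mono hpt
      _ = 2 * Q * κ (Metric.cthickening r Z) + (2 * Q : ℝ≥0∞)⁻¹ * ∫⁻ x, g x * g x ∂κ := by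
          have hgg : Measurable fun x => g x * g x := hg.mul hg
          rw [lintegral_add_right _ (hgg.const_mul _),
            lintegral_indicator Metric.isClosed_cthickening.measurableSet, setLIntegral_const,
            lintegral_const_mul _ hgg]
      _ ≤ 2 * Q * κ (Metric.cthickening r Z) + (2 * Q : ℝ≥0∞)⁻¹ * (V * Q) := by gcongr
      _ = _ := by
          congr 1
          rw [ENNReal.mul_inv (by simp) (by simp), ENNReal.div_eq_inv_mul, mul_assoc]
          congr 1
          rw [mul_comm V, ← mul_assoc, ENNReal.inv_mul_cancel (by simp [hQ.ne']) (by simp), one_mul]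
  have hhalf : V / 2 ≤ 2 * Q * κ (Metric.cthickening r Z) := by
    have h1 : V / 2 + V / 2 ≤ 2 * Q * κ (Metric.cthickening r Z) + V / 2 := by
      rwa [ENNReal.add_halves]
    exact (ENNReal.add_le_add_iff_right (ENNReal.div_ne_top hVt (by simp))).1 h1
  calc V = 2 * (V / 2) := by rw [ENNReal.mul_div_cancel (by simp) (by simp)]
    _ ≤ 2 * (2 * Q * κ (Metric.cthickening r Z)) := by gcongr
    _ = _ := by ring

/-- A compact set carrying a measure with correlation integrals of order `r ^ dim E` along a
sequence of scales has positive Haar measure. -/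
theorem addHaar_pos_of_frequently_correlation_le (κ : Measure E) [κ.IsAddHaarMeasure]
    {ν : Measure E} [IsProbabilityMeasure ν] {Z : Set E} (hZ : IsCompact Z) (hνZ : ν Zᶜ = 0)
    {M : ℝ≥0} (h : ∃ᶠ j : ℕ in atTop, (ν.prod ν) {p | dist p.1 p.2 ≤ 2⁻¹ ^ j} ≤
      M * (2⁻¹ ^ j : ℝ≥0∞) ^ Module.finrank ℝ E) :
    0 < κ Z := by
  have := FiniteDimensional.proper ℝ E
  by_contra hcon
  have hZ0 : κ Z = 0 := by simpa using hcon
  set d := Module.finrank ℝ E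
  have hlim : Tendsto (fun j : ℕ => 4 * ((M + 1) * 2 ^ d) *
      κ (Metric.cthickening ((2⁻¹ : ℝ) ^ (j + 1)) Z)) atTop (𝓝 0) := by
    have h1 := tendsto_measure_cthickening_of_isCompact (μ := κ) hZ
    have h2 : Tendsto (fun j : ℕ => (2⁻¹ : ℝ) ^ (j + 1)) atTop (𝓝 0) :=
      (tendsto_pow_atTop_nhds_zero_of_lt_one (by norm_num) (by norm_num)).comp
        (tendsto_add_atTop_nat 1)
    have h3 := ENNReal.Tendsto.const_mul (a := 4 * (((M : ℝ≥0∞) + 1) * 2 ^ d)) (h1.comp h2)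
      (Or.inr (by finiteness))
    rw [hZ0, mul_zero] at h3
    exact h3
  have hpos : 0 < κ (Metric.closedBall 0 1) :=
    Metric.measure_closedBall_pos κ 0 one_pos
  have hev := hlim.eventually (gt_mem_nhds hpos)
  obtain ⟨j, hj, hj'⟩ := (h.and_eventually hev).exists
  have hr : (2⁻¹ : ℝ) ^ j = 2 * 2⁻¹ ^ (j + 1) := by rw [pow_succ]; ring
  -- The radius is half of `2⁻ʲ` because the correlation enters at scale `2 r`; `M + 1` replaces `M`
  -- to keep `Q` positive. After cancelling the scaling factor `R`, the neighbourhoods have measure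
  -- bounded below, although they shrink to the null set `Z`.
  have h1 := addHaar_closedBall_le_of_correlation_le κ hνZ (r := 2⁻¹ ^ (j + 1))
    (Q := (M + 1) * (2⁻¹ ^ j) ^ d) (by positivity) (by
      rw [← hr]
      refine hj.trans ?_
      push_cast
      gcongr
      exact le_self_add)
  rw [Measure.addHaar_closedBall' κ 0 (by positivity)] at h1
  refine absurd hj' (not_lt.2 ?_)
  set R := ENNReal.ofReal (((2⁻¹ : ℝ) ^ (j + 1)) ^ d) with hR
  have hR0 : R ≠ 0 := (ENNReal.ofReal_pos.2 (by positivity)).ne'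
  have h2 : (((M + 1) * (2⁻¹ ^ j) ^ d : ℝ≥0) : ℝ≥0∞) = R * ((M + 1) * 2 ^ d) := by
    have h3 : (((2⁻¹ ^ j) ^ d : ℝ≥0) : ℝ≥0∞) = R * 2 ^ d := by
      rw [hR, ← ENNReal.ofReal_coe_nnreal, ← ENNReal.ofReal_ofNat 2, ← ENNReal.ofReal_pow (by simp),
        ← ENNReal.ofReal_mul (by positivity), ← mul_pow]
      congr 2
      push_cast
      rw [hr]
      ring
    rw [ENNReal.coe_mul, h3]
    push_cast
    ring
  rw [h2] at h1
  have h4 : R * κ (Metric.closedBall 0 1) ≤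
      R * (4 * ((M + 1) * 2 ^ d) * κ (Metric.cthickening (2⁻¹ ^ (j + 1)) Z)) := by
    calc _ ≤ _ := h1
      _ = _ := by ring
  exact (ENNReal.mul_le_mul_iff_right hR0 ENNReal.ofReal_ne_top).1 h4

end Correlation

/-! ### Averaging the correlation over parameters -/

section Parameters

variable {n k : ℕ} {m : Fin n → ℕ}

theorem boundedParamMeasure_eq_restrict (m : Fin n → ℕ) (b : ℝ) :
    boundedParamMeasure m b =
      (paramMeasure m).restrict (univ.pi fun _ => scaleSet b ×ˢ univ) := by
  rw [paramMeasure, Measure.restrict_pi_pi, boundedParamMeasure]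
  congr 1
  ext1 i
  rw [← Measure.prod_restrict, Measure.restrict_univ]

/-- The parameters with some `t_i = 0` are null, and all others satisfy `b⁻¹ ≤ |t_i| ≤ b` for some
integer `b ≥ 1`. -/
theorem ae_paramMeasure_of_forall_boundedParamMeasure {P : Param m → Prop}
    (h : ∀ b : ℝ, 0 < b → ∀ᵐ l ∂boundedParamMeasure m b, P l) : ∀ᵐ l ∂paramMeasure m, P l := by
  have hS : ∀ b : ℝ, MeasurableSet
      (univ.pi fun i : Fin n => scaleSet b ×ˢ (univ : Set (SO (m i)))) := fun b =>
    MeasurableSet.univ_pi fun i => (measurableSet_scaleSet b).prod MeasurableSet.univ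
  have h1 : ∀ᵐ l ∂paramMeasure m, ∀ N : ℕ,
      l ∈ (univ.pi fun i : Fin n => scaleSet ((N : ℝ) + 1) ×ˢ (univ : Set (SO (m i)))) → P l := by
    rw [ae_all_iff]
    intro N
    have h2 := h (N + 1) (by positivity)
    rwa [boundedParamMeasure_eq_restrict, ae_restrict_iff' (hS _)] at h2
  have h3 : ∀ᵐ l ∂paramMeasure m, ∀ i, (l i).1 ≠ 0 := by
    rw [ae_all_iff]
    intro i
    have h4 : ∀ᵐ p ∂((volume : Measure ℝ).prod (haarSO (m i))), p.1 ≠ 0 :=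
      Measure.quasiMeasurePreserving_fst.ae (Measure.ae_ne volume 0)
    exact (Measure.tendsto_eval_ae_ae (μ := fun i =>
      (volume : Measure ℝ).prod (haarSO (m i))) (i := i)).eventually h4
  filter_upwards [h1, h3] with l hl hl0
  obtain ⟨N, hN⟩ := exists_nat_ge (∑ i, (|(l i).1| + |(l i).1|⁻¹))
  refine hl N fun i _ => ⟨?_, mem_univ _⟩
  have hpos := abs_pos.2 (hl0 i)
  have h5 : |(l i).1| + |(l i).1|⁻¹ ≤ N := (Finset.single_le_sum (f := fun i =>
    |(l i).1| + |(l i).1|⁻¹) (fun j _ => by positivity) (Finset.mem_univ i)).trans hN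
  have h6 : 0 < |(l i).1|⁻¹ := by positivity
  refine ⟨?_, by linarith⟩
  rw [inv_le_comm₀ (by positivity) hpos]
  linarith

/-- The map `π_λ` on tuples. -/
noncomputable def projTuple (π : ProdSpace m →ₗ[ℝ] EuclideanSpace ℝ (Fin k)) (l : Param m)
    (x : ∀ i, EuclideanSpace ℝ (Fin (m i))) : EuclideanSpace ℝ (Fin k) :=
  projParam π l (WithLp.toLp 2 x)

theorem continuous_projTuple (π : ProdSpace m →ₗ[ℝ] EuclideanSpace ℝ (Fin k)) :
    Continuous fun p : Param m × (∀ i, EuclideanSpace ℝ (Fin (m i))) => projTuple π p.1 p.2 := by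
  simp only [projTuple, projParam_eq_sum]
  refine continuous_finsetSum _ fun e _ => ?_
  have h1 : Continuous fun p : Param m × (∀ i, EuclideanSpace ℝ (Fin (m i))) => p.1 e.1 :=
    (continuous_apply e.1).comp continuous_fst
  have h2 : Continuous fun p : Param m × (∀ i, EuclideanSpace ℝ (Fin (m i))) => p.2 e.1 :=
    (continuous_apply e.1).comp continuous_snd
  have h3 : Continuous fun p : Param m × (∀ i, EuclideanSpace ℝ (Fin (m i))) =>
      (p.1 e.1).1 • rot (p.1 e.1).2 (p.2 e.1) :=
    (continuous_fst.comp h1).smul (continuous_rot.comp ((continuous_snd.comp h1).prodMk h2))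
  exact ((PiLp.continuous_apply 2 _ e.2).comp h3).smul continuous_const

theorem image_projTuple_pi_subset (π : ProdSpace m →ₗ[ℝ] EuclideanSpace ℝ (Fin k)) (l : Param m)
    {C K : ∀ i, Set (EuclideanSpace ℝ (Fin (m i)))} (h : ∀ i, C i ⊆ K i) :
    projTuple π l '' univ.pi C ⊆ projParam π l '' prodSet K := by
  rintro _ ⟨x, hx, rfl⟩
  exact ⟨WithLp.toLp 2 x, fun i => h i (hx i (mem_univ i)), rfl⟩

theorem lintegral_pi_prod_eq_prod_lintegral {ι : Type*} [Fintype ι] {X : ι → Type*}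
    [∀ i, MeasurableSpace (X i)] {μ : ∀ i, Measure (X i)} [∀ i, IsProbabilityMeasure (μ i)]
    {f : ∀ i, X i → ℝ≥0∞} (hf : ∀ i, Measurable (f i)) :
    ∫⁻ x, ∏ i, f i (x i) ∂Measure.pi μ = ∏ i, ∫⁻ y, f i y ∂μ i := by
  rw [ProbabilityTheory.lintegral_prod_eq_prod_lintegral_of_indepFun Finset.univ
    (fun i (x : ∀ i, X i) => f i (x i)) (ProbabilityTheory.iIndepFun_pi fun i => (hf i).aemeasurable)
    fun i => (hf i).comp (measurable_pi_apply i)]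
  exact Finset.prod_congr rfl fun i _ => (measurePreserving_eval μ i).lintegral_comp (hf i)

/-- The average over the parameters of the correlation integral of a product of Frostman
measures. -/
theorem exists_lintegral_correlation_le (π : ProdSpace m →ₗ[ℝ] EuclideanSpace ℝ (Fin k))
    {b : ℝ} (hb : 0 < b) {C : ∀ i, Set (EuclideanSpace ℝ (Fin (m i)))}
    (hC : ∀ i, ∀ x ∈ C i, ∀ y ∈ C i, dist x y ≤ 1)
    {μ : ∀ i, Measure (EuclideanSpace ℝ (Fin (m i)))} {σ s : Fin n → ℝ≥0}
    (hμ : ∀ i, IsFrostman (μ i) (C i) (σ i)) (hs : ∀ i, s i = 0 ∨ s i < σ i) {τ : ℝ}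
    (hτ : ∀ I : Finset (Fin n),
      τ ≤ ∑ i ∈ I, (s i : ℝ) + Module.finrank ℝ ((coordSubspace m Iᶜ).map π)) :
    ∃ M : ℝ≥0, ∀ r : ℝ≥0, 0 < r → r ≤ 1 →
      ∫⁻ l, ((Measure.pi μ).prod (Measure.pi μ))
        {p | dist (projTuple π l p.1) (projTuple π l p.2) ≤ r} ∂boundedParamMeasure m b ≤
      M * (r : ℝ≥0∞) ^ τ := by
  have hprob : ∀ i, IsProbabilityMeasure (μ i) := fun i => (hμ i).isProbabilityMeasure
  obtain ⟨M, hM⟩ := exists_boundedParamMeasure_norm_projParam_le π hb hτ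
  choose L hL using fun i => (hμ i).exists_lintegral_edist_rpow_le (hs i)
  refine ⟨M * ∏ i, L i, fun r hr hr1 => ?_⟩
  set ν := Measure.pi μ with hν
  let X := ∀ i, EuclideanSpace ℝ (Fin (m i))
  let W : Set (Param m × (X × X)) :=
    {q | dist (projTuple π q.1 q.2.1) (projTuple π q.1 q.2.2) ≤ r}
  have hW : MeasurableSet W := by
    refine IsClosed.measurableSet (isClosed_le (Continuous.dist ?_ ?_) continuous_const)
    · exact (continuous_projTuple π).comp
        (continuous_fst.prodMk (continuous_fst.comp continuous_snd))
    · exact (continuous_projTuple π).comp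
        (continuous_fst.prodMk (continuous_snd.comp continuous_snd))
  have hmem : ∀ᵐ x ∂ν, ∀ i, x i ∈ C i := by
    rw [ae_all_iff]
    intro i
    have h1 : ∀ᵐ y ∂μ i, y ∈ C i := by
      rw [ae_iff]
      exact (hμ i).measure_compl
    exact (Measure.tendsto_eval_ae_ae (μ := μ) (i := i)).eventually h1
  have hmem1 : ∀ᵐ p ∂ν.prod ν, ∀ i, p.1 i ∈ C i := Measure.quasiMeasurePreserving_fst.ae hmem
  have hmem2 : ∀ᵐ p ∂ν.prod ν, ∀ i, p.2 i ∈ C i := Measure.quasiMeasurePreserving_snd.ae hmem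
  have hmeas : Measurable fun p : X × X => ∏ i, edist (p.1 i) (p.2 i) ^ (-(s i : ℝ)) := by
    refine Finset.measurable_prod _ fun i _ => Measurable.pow_const ?_ _
    exact ((measurable_pi_apply i).comp measurable_fst).edist
      ((measurable_pi_apply i).comp measurable_snd)
  calc ∫⁻ l, (ν.prod ν) {p | dist (projTuple π l p.1) (projTuple π l p.2) ≤ r}
        ∂boundedParamMeasure m b
      = ((boundedParamMeasure m b).prod (ν.prod ν)) W := (Measure.prod_apply hW).symm
    _ = ∫⁻ p, boundedParamMeasure m b ((fun l => (l, p)) ⁻¹' W) ∂(ν.prod ν) :=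
        Measure.prod_apply_symm hW
    -- After Fubini, transversality is applied to `z = x - y`; its components have norm at most 1
    -- because the supports have diameter at most 1.
    _ ≤ ∫⁻ p, M * (r : ℝ≥0∞) ^ τ * ∏ i, edist (p.1 i) (p.2 i) ^ (-(s i : ℝ)) ∂(ν.prod ν) := by
        refine lintegral_mono_ae ?_
        filter_upwards [hmem1, hmem2] with p hp1 hp2
        have h1 := hM (WithLp.toLp 2 p.1 - WithLp.toLp 2 p.2) (fun i => by
          have := hC i _ (hp1 i) _ (hp2 i)
          rwa [dist_eq_norm] at this) r hr hr1
        have h2 : (fun l => (l, p)) ⁻¹' W =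
            {l | ‖projParam π l (WithLp.toLp 2 p.1 - WithLp.toLp 2 p.2)‖ ≤ r} := by
          ext l
          rw [mem_ofPred_eq, projParam_sub, ← dist_eq_norm]
          rfl
        rw [h2]
        refine h1.trans_eq ?_
        congr 1
        refine Finset.prod_congr rfl fun i _ => ?_
        rw [edist_eq_enorm_sub]
        rfl
    _ = M * (r : ℝ≥0∞) ^ τ *
        ∫⁻ x, ∫⁻ y, ∏ i, edist (x i) (y i) ^ (-(s i : ℝ)) ∂ν ∂ν := by
        rw [lintegral_const_mul _ hmeas, lintegral_prod _ hmeas.aemeasurable]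
    _ ≤ M * (r : ℝ≥0∞) ^ τ * ∫⁻ _x, ∏ i, (L i : ℝ≥0∞) ∂ν := by
        refine mul_le_mul_right (lintegral_mono fun x => ?_) _
        rw [hν, lintegral_pi_prod_eq_prod_lintegral
          (f := fun i y => edist (x i) y ^ (-(s i : ℝ)))
          fun i => (measurable_const.edist measurable_id).pow_const _]
        exact Finset.prod_le_prod' fun i _ => hL i (x i)
    _ = _ := by
        rw [lintegral_const, measure_univ, mul_one]
        push_cast
        ring

/-- Existence of exponents just below the dimensions satisfying the transversality condition. -/
theorem exists_exponents {K : ∀ i, Set (EuclideanSpace ℝ (Fin (m i)))}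
    {π : ProdSpace m →ₗ[ℝ] EuclideanSpace ℝ (Fin k)} (hπ : Function.Surjective π) {τ : ℝ≥0}
    (hτk : τ ≤ k) (hτ : (τ : ℝ≥0∞) < minDim π fun i => dimH (K i)) :
    ∃ σ s : Fin n → ℝ≥0, (∀ i, σ i = 0 ∨ (σ i : ℝ≥0∞) < dimH (K i)) ∧
      (∀ i, s i = 0 ∨ s i < σ i) ∧ ∀ I : Finset (Fin n),
      (τ : ℝ) ≤ ∑ i ∈ I, (s i : ℝ) + Module.finrank ℝ ((coordSubspace m Iᶜ).map π) := by
  obtain ⟨δ, hδ, hδτ⟩ := ENNReal.lt_iff_exists_add_pos_lt.1 hτ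
  -- Each index loses `ε` twice, in passing from the dimension to `σ` and from `σ` to `s`. At most
  -- `n` indices lose at most `δ` in all.
  let ε : ℝ≥0 := δ / (2 * (n + 1))
  have hε : 0 < ε := by positivity
  choose σ hσ hσ' using fun i => exists_nnreal_approx_below (Real.dimH_ne_top (s := K i)) hε
  choose s hs hs' using fun i => exists_nnreal_approx_below (ENNReal.coe_ne_top (r := σ i)) hε
  refine ⟨σ, s, hσ, fun i => (hs i).imp_right ENNReal.coe_lt_coe.1, fun I => ?_⟩
  rcases I.eq_empty_or_nonempty with rfl | hI
  -- The empty set is absent from the minimum; its inequality is `τ ≤ k`, by surjectivity of `π`.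
  · have h1 : coordSubspace m (∅ : Finset (Fin n))ᶜ = ⊤ := by
      rw [eq_top_iff]
      intro x _ i hi
      simp at hi
    rw [h1, Submodule.map_top, LinearMap.range_eq_top.2 hπ, finrank_top, finrank_euclideanSpace]
    have : (τ : ℝ) ≤ k := by exact_mod_cast hτk
    simpa using this
  · have h1 : minDim π (fun i => dimH (K i)) ≤ ∑ i ∈ I, dimH (K i) +
        (Module.finrank ℝ ((coordSubspace m Iᶜ).map π) : ℝ≥0∞) := iInf₂_le I hI
    have h2 : ∑ i ∈ I, dimH (K i) ≤ ∑ i ∈ I, ((s i : ℝ≥0∞) + (2 * ε : ℝ≥0)) := by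
      refine Finset.sum_le_sum fun i _ => (hσ' i).trans ?_
      calc (σ i : ℝ≥0∞) + ε ≤ s i + ε + ε := by gcongr; exact hs' i
        _ = _ := by push_cast; ring
    have h3 : ∑ i ∈ I, ((s i : ℝ≥0∞) + (2 * ε : ℝ≥0)) ≤ ((∑ i ∈ I, s i + δ : ℝ≥0) : ℝ≥0∞) := by
      rw [Finset.sum_add_distrib, Finset.sum_const, nsmul_eq_mul]
      push_cast
      gcongr
      have h4 : (I.card : ℝ≥0) * (2 * ε) ≤ δ := by
        have h5 : (I.card : ℝ≥0) ≤ n + 1 := by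
          have : I.card ≤ n := by simpa using Finset.card_le_univ I
          exact_mod_cast this.trans (Nat.le_succ n)
        calc (I.card : ℝ≥0) * (2 * ε) ≤ (n + 1) * (2 * ε) := by gcongr
          _ = δ := by
            simp only [ε]
            field_simp
      have h6 := ENNReal.coe_le_coe.2 h4
      push_cast at h6
      exact h6
    have h5 := hδτ.le.trans (h1.trans (add_le_add_left (h2.trans h3) _))
    have h6 : τ + δ ≤ ∑ i ∈ I, s i + δ + Module.finrank ℝ ((coordSubspace m Iᶜ).map π) := by
      exact_mod_cast h5
    have h7 : (τ : ℝ) + δ ≤ ∑ i ∈ I, (s i : ℝ) + δ +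
        Module.finrank ℝ ((coordSubspace m Iᶜ).map π) := by exact_mod_cast h6
    linarith

end Parameters

/-! ### Lower bounds for almost every parameter -/

section LowerBounds

variable {n k : ℕ} {m : Fin n → ℕ}

/-- The correlation integral of the image of `ν` under `π_λ` at scale `r`. -/
noncomputable def correlation (π : ProdSpace m →ₗ[ℝ] EuclideanSpace ℝ (Fin k))
    (ν : Measure (∀ i, EuclideanSpace ℝ (Fin (m i)))) (l : Param m) (r : ℝ) : ℝ≥0∞ :=
  (ν.prod ν) {p | dist (projTuple π l p.1) (projTuple π l p.2) ≤ r}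

theorem measurable_correlation (π : ProdSpace m →ₗ[ℝ] EuclideanSpace ℝ (Fin k))
    (ν : Measure (∀ i, EuclideanSpace ℝ (Fin (m i)))) [SFinite ν] (r : ℝ) :
    Measurable fun l => correlation π ν l r := by
  have hW : MeasurableSet {q : Param m × ((∀ i, EuclideanSpace ℝ (Fin (m i))) ×
      (∀ i, EuclideanSpace ℝ (Fin (m i)))) |
      dist (projTuple π q.1 q.2.1) (projTuple π q.1 q.2.2) ≤ r} := by
    refine IsClosed.measurableSet (isClosed_le (Continuous.dist ?_ ?_) continuous_const)
    · exact (continuous_projTuple π).comp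
        (continuous_fst.prodMk (continuous_fst.comp continuous_snd))
    · exact (continuous_projTuple π).comp
        (continuous_fst.prodMk (continuous_snd.comp continuous_snd))
  exact measurable_measure_prodMk_left (ν := ν.prod ν) hW

theorem continuous_projTuple_right (π : ProdSpace m →ₗ[ℝ] EuclideanSpace ℝ (Fin k))
    (l : Param m) : Continuous (projTuple π l) :=
  (continuous_projTuple π).comp (continuous_const.prodMk continuous_id)

theorem map_projTuple_prod_eq_correlation (π : ProdSpace m →ₗ[ℝ] EuclideanSpace ℝ (Fin k))
    (ν : Measure (∀ i, EuclideanSpace ℝ (Fin (m i)))) [SFinite ν] (l : Param m) (r : ℝ) :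
    ((ν.map (projTuple π l)).prod (ν.map (projTuple π l))) {p | dist p.1 p.2 ≤ r} =
      correlation π ν l r := by
  have hm := (continuous_projTuple_right π l).measurable
  rw [Measure.map_prod_map _ _ hm hm, Measure.map_apply (hm.prodMap hm)
    (isClosed_le continuous_dist continuous_const).measurableSet]
  rfl

variable {K : ∀ i, Set (EuclideanSpace ℝ (Fin (m i)))}
  {π : ProdSpace m →ₗ[ℝ] EuclideanSpace ℝ (Fin k)}

/-- The compact sets and the measure are chosen before `b`; only the constant depends on the range
of scales. -/
theorem exists_measure_lintegral_correlation_le (hK : ∀ i, MeasurableSet (K i))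
    (hne : ∀ i, (K i).Nonempty) (hπ : Function.Surjective π) {τ : ℝ≥0} (hτk : τ ≤ k)
    (hτ : (τ : ℝ≥0∞) < minDim π fun i => dimH (K i)) :
    ∃ (C : ∀ i, Set (EuclideanSpace ℝ (Fin (m i))))
      (ν : Measure (∀ i, EuclideanSpace ℝ (Fin (m i)))), (∀ i, C i ⊆ K i) ∧
      IsCompact (univ.pi C) ∧ IsProbabilityMeasure ν ∧ ν (univ.pi C)ᶜ = 0 ∧
      ∀ b : ℝ, 0 < b → ∃ M : ℝ≥0, ∀ j : ℕ,
        ∫⁻ l, correlation π ν l (2⁻¹ ^ j) ∂boundedParamMeasure m b ≤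
          M * (2⁻¹ ^ j : ℝ≥0∞) ^ (τ : ℝ) := by
  obtain ⟨σ, s, hσ, hs, hI⟩ := exists_exponents hπ hτk hτ
  choose C hCK hC hdist μ hμ using fun i => exists_isFrostman (hK i) (hne i) (hσ i)
  have hprob : ∀ i, IsProbabilityMeasure (μ i) := fun i => (hμ i).isProbabilityMeasure
  refine ⟨C, Measure.pi μ, hCK, isCompact_univ_pi hC, inferInstance, ?_, fun b hb => ?_⟩
  · rw [prob_compl_eq_zero_iff (MeasurableSet.univ_pi fun i => (hC i).isClosed.measurableSet),
      Measure.pi_pi]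
    refine Finset.prod_eq_one fun i _ => ?_
    rw [← prob_compl_eq_zero_iff (hC i).isClosed.measurableSet]
    exact (hμ i).measure_compl
  · obtain ⟨M, hM⟩ := exists_lintegral_correlation_le π hb hdist hμ hs hI
    refine ⟨M, fun j => ?_⟩
    have h1 := hM (2⁻¹ ^ j) (by positivity) (pow_le_one₀ (by positivity) (by
      rw [← NNReal.coe_le_coe]; norm_num))
    push_cast at h1
    exact h1

/-- The normalised correlations have bounded means, so by Fatou their lower limit is finite almost
everywhere. Good control along infinitely many scales suffices for positive measure. -/
theorem ae_volume_image_pos (hK : ∀ i, MeasurableSet (K i)) (hne : ∀ i, (K i).Nonempty)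
    (hπ : Function.Surjective π) (hk : (k : ℝ≥0∞) < minDim π fun i => dimH (K i)) :
    ∀ᵐ l ∂paramMeasure m, 0 < volume (projParam π l '' prodSet K) := by
  obtain ⟨C, ν, hCK, hC, hprob, hν, hM⟩ := exists_measure_lintegral_correlation_le (τ := k) hK hne
    hπ le_rfl (by exact_mod_cast hk)
  refine ae_paramMeasure_of_forall_boundedParamMeasure fun b hb => ?_
  obtain ⟨M, hM⟩ := hM b hb
  let c : ℕ → ℝ≥0∞ := fun j => (2⁻¹ ^ j : ℝ≥0∞) ^ k
  have hc0 : ∀ j, c j ≠ 0 := fun j => pow_ne_zero _ (pow_ne_zero _ (by simp))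
  have hct : ∀ j, c j ≠ ∞ := fun j => by simp [c]
  have hmeas : ∀ j : ℕ, Measurable fun l => (c j)⁻¹ * correlation π ν l (2⁻¹ ^ j) := fun j =>
    (measurable_correlation π ν _).const_mul _
  have hint : ∫⁻ l, liminf (fun j : ℕ => (c j)⁻¹ * correlation π ν l (2⁻¹ ^ j)) atTop
      ∂boundedParamMeasure m b ≠ ∞ := by
    refine ne_top_of_le_ne_top (ENNReal.coe_ne_top (r := M))
      ((lintegral_liminf_le hmeas).trans (liminf_le_of_frequently_le' ?_))
    refine Frequently.of_forall fun j => ?_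
    rw [lintegral_const_mul _ (measurable_correlation π ν _), mul_comm, ← div_eq_mul_inv,
      ENNReal.div_le_iff (hc0 j) (hct j)]
    have := hM j
    rwa [NNReal.coe_natCast, ENNReal.rpow_natCast] at this
  filter_upwards [ae_lt_top (.liminf hmeas) hint] with l hl
  obtain ⟨N, hlN, -⟩ := ENNReal.lt_iff_exists_nnreal_btwn.1 hl
  have hfreq := frequently_lt_of_liminf_lt (by isBoundedDefault) hlN
  have hm := continuous_projTuple_right π l
  have : IsProbabilityMeasure (ν.map (projTuple π l)) :=
    Measure.isProbabilityMeasure_map hm.measurable.aemeasurable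
  have hZ : IsCompact (projTuple π l '' univ.pi C) := hC.image hm
  have hνZ : ν.map (projTuple π l) (projTuple π l '' univ.pi C)ᶜ = 0 := by
    rw [Measure.map_apply hm.measurable hZ.isClosed.measurableSet.compl]
    exact measure_mono_null (fun x hx hxC => hx ⟨x, hxC, rfl⟩) hν
  refine (addHaar_pos_of_frequently_correlation_le volume hZ hνZ (M := N) ?_).trans_le
    (measure_mono (image_projTuple_pi_subset π l hCK))
  refine hfreq.mono fun j hj => ?_
  rw [map_projTuple_prod_eq_correlation, finrank_euclideanSpace, Fintype.card_fin]
  rw [mul_comm, ← div_eq_mul_inv] at hj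
  exact (ENNReal.div_le_iff (hc0 j) (hct j)).1 hj.le

/-- The gap `τ' < τ` turns the means of the normalised correlations into a convergent geometric
series of ratio `2^(-(τ - τ'))`. -/
theorem ae_le_dimH_image (hK : ∀ i, MeasurableSet (K i)) (hne : ∀ i, (K i).Nonempty)
    (hπ : Function.Surjective π) {τ' τ : ℝ≥0} (hτ' : τ' < τ) (hτk : τ ≤ k)
    (hτ : (τ : ℝ≥0∞) < minDim π fun i => dimH (K i)) :
    ∀ᵐ l ∂paramMeasure m, (τ' : ℝ≥0∞) ≤ dimH (projParam π l '' prodSet K) := by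
  obtain ⟨C, ν, hCK, hC, hprob, hν, hM⟩ := exists_measure_lintegral_correlation_le hK hne
    hπ hτk hτ
  refine ae_paramMeasure_of_forall_boundedParamMeasure fun b hb => ?_
  obtain ⟨M, hM⟩ := hM b hb
  let c : ℕ → ℝ≥0∞ := fun j => (2⁻¹ ^ j : ℝ≥0∞) ^ (τ' : ℝ)
  have hmeas : ∀ j : ℕ, Measurable fun l => (c j)⁻¹ * correlation π ν l (2⁻¹ ^ j) := fun j =>
    (measurable_correlation π ν _).const_mul _
  let q : ℝ≥0∞ := 2⁻¹ ^ ((τ : ℝ) - τ')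
  have hq : q < 1 := ENNReal.rpow_lt_one (by simp) (sub_pos.2 hτ')
  have hint : ∫⁻ l, ∑' j : ℕ, (c j)⁻¹ * correlation π ν l (2⁻¹ ^ j)
      ∂boundedParamMeasure m b ≠ ∞ := by
    rw [lintegral_tsum fun j => (hmeas j).aemeasurable]
    have hle : ∀ j : ℕ, ∫⁻ l, (c j)⁻¹ * correlation π ν l (2⁻¹ ^ j) ∂boundedParamMeasure m b ≤
        M * q ^ j := by
      intro j
      rw [lintegral_const_mul _ (measurable_correlation π ν _)]
      refine (mul_le_mul_right (hM j) _).trans_eq ?_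
      have h2 : (2⁻¹ ^ j : ℝ≥0∞) ≠ 0 := pow_ne_zero _ (by simp)
      have h3 : (2⁻¹ ^ j : ℝ≥0∞) ≠ ∞ := ENNReal.pow_ne_top (by simp)
      have h4 : q ^ j = (2⁻¹ ^ j : ℝ≥0∞) ^ ((τ : ℝ) - τ') := by
        simp only [q]
        rw [← ENNReal.rpow_natCast, ← ENNReal.rpow_natCast, ← ENNReal.rpow_mul,
          ← ENNReal.rpow_mul, mul_comm]
      rw [h4, sub_eq_neg_add, ENNReal.rpow_add _ _ h2 h3, ENNReal.rpow_neg]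
      ring
    refine ne_top_of_le_ne_top ?_ (ENNReal.tsum_le_tsum hle)
    rw [ENNReal.tsum_mul_left, ENNReal.tsum_geometric]
    exact ENNReal.mul_ne_top ENNReal.coe_ne_top (ENNReal.inv_ne_top.2 (tsub_pos_of_lt hq).ne')
  filter_upwards [ae_lt_top (Measurable.tsum hmeas) hint] with l hl
  have hm := continuous_projTuple_right π l
  have : IsProbabilityMeasure (ν.map (projTuple π l)) :=
    Measure.isProbabilityMeasure_map hm.measurable.aemeasurable
  have hZ : MeasurableSet (projTuple π l '' univ.pi C) := (hC.image hm).isClosed.measurableSet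
  have hνZ : ν.map (projTuple π l) (projTuple π l '' univ.pi C)ᶜ = 0 := by
    rw [Measure.map_apply hm.measurable hZ.compl]
    exact measure_mono_null (fun x hx hxC => hx ⟨x, hxC, rfl⟩) hν
  refine le_trans ?_ (dimH_mono (image_projTuple_pi_subset π l hCK))
  refine le_dimH_of_tsum_correlation_ne_top (ν := ν.map (projTuple π l)) hZ
    ((prob_compl_eq_zero_iff hZ).1 hνZ) ?_
  simp only [map_projTuple_prod_eq_correlation]
  exact hl.ne

/-- Rational exponents suffice, so only countably many null sets are discarded. -/
theorem ae_minDim_le_dimH_image (hK : ∀ i, MeasurableSet (K i)) (hne : ∀ i, (K i).Nonempty)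
    (hπ : Function.Surjective π) (hk : minDim π (fun i => dimH (K i)) ≤ k) :
    ∀ᵐ l ∂paramMeasure m,
      minDim π (fun i => dimH (K i)) ≤ dimH (projParam π l '' prodSet K) := by
  have h : ∀ᵐ l ∂paramMeasure m, ∀ q : ℚ,
      (Real.toNNReal q : ℝ≥0∞) < minDim π (fun i => dimH (K i)) →
      (Real.toNNReal q : ℝ≥0∞) ≤ dimH (projParam π l '' prodSet K) := by
    rw [ae_all_iff]
    intro q
    by_cases hq : (Real.toNNReal q : ℝ≥0∞) < minDim π (fun i => dimH (K i))
    · obtain ⟨τ, hτ, hτ'⟩ := ENNReal.lt_iff_exists_nnreal_btwn.1 hq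
      have hτk : τ ≤ k := by exact_mod_cast hτ'.le.trans hk
      exact (ae_le_dimH_image hK hne hπ (ENNReal.coe_lt_coe.1 hτ) hτk hτ').mono fun l hl _ => hl
    · exact Eventually.of_forall fun l h => absurd h hq
  filter_upwards [h] with l hl
  refine le_of_forall_lt fun a ha => ?_
  obtain ⟨q, -, hq, hq'⟩ := ENNReal.lt_iff_exists_rat_btwn.1 ha
  exact hq.trans_le (hl q hq')

end LowerBounds

/-! ### Upper bound for every parameter -/

section UpperBound

variable {n k : ℕ} {m : Fin n → ℕ}

/-- The set of points of `∏_{i ∈ J} K_i` regarded as a subset of the full product. -/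
def partialProd (K : ∀ i, Set (EuclideanSpace ℝ (Fin (m i)))) (J : Finset (Fin n)) :
    Set (ProdSpace m) :=
  {x | ∀ i, (i ∈ J → x i ∈ K i) ∧ (i ∉ J → x i = 0)}

/-- The coordinate projection of the product onto the factors indexed by `J`. -/
noncomputable def coordProj (m : Fin n → ℕ) (J : Finset (Fin n)) :
    ProdSpace m →ₗ[ℝ] ProdSpace m where
  toFun x := WithLp.toLp 2 fun i => if i ∈ J then x i else 0
  map_add' x y := by
    refine PiLp.ext fun i => ?_
    by_cases h : i ∈ J <;> simp [h]
  map_smul' c x := by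
    refine PiLp.ext fun i => ?_
    by_cases h : i ∈ J <;> simp [h]

theorem coordProj_apply (J : Finset (Fin n)) (x : ProdSpace m) (i : Fin n) :
    coordProj m J x i = if i ∈ J then x i else 0 := rfl

variable {K : ∀ i, Set (EuclideanSpace ℝ (Fin (m i)))}
  {π : ProdSpace m →ₗ[ℝ] EuclideanSpace ℝ (Fin k)}

theorem measurableSet_partialProd (hK : ∀ i, MeasurableSet (K i)) (J : Finset (Fin n)) :
    MeasurableSet (partialProd K J) := by
  have h : partialProd K J = ⋂ i, (fun x : ProdSpace m => x i) ⁻¹' (if i ∈ J then K i else {0}) := by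
    ext x
    simp only [partialProd, mem_ofPred_eq, mem_iInter, mem_preimage]
    refine forall_congr' fun i => ?_
    by_cases hi : i ∈ J <;> simp [hi]
  rw [h]
  refine MeasurableSet.iInter fun i => ?_
  refine (PiLp.continuous_apply 2 _ i).measurable ?_
  split_ifs
  · exact hK i
  · exact measurableSet_singleton 0

theorem partialProd_nonempty (hne : ∀ i, (K i).Nonempty) (J : Finset (Fin n)) :
    (partialProd K J).Nonempty := by
  choose y hy using hne
  refine ⟨coordProj m J (WithLp.toLp 2 y), fun i => ?_⟩
  rw [coordProj_apply]
  by_cases hi : i ∈ J <;> simp [hi, hy]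

theorem dimH_image_linearMap_le {E F : Type*} [NormedAddCommGroup E] [NormedSpace ℝ E]
    [FiniteDimensional ℝ E] [NormedAddCommGroup F] [NormedSpace ℝ F] (f : E →ₗ[ℝ] F) (A : Set E) :
    dimH (f '' A) ≤ dimH A :=
  (LinearMap.toContinuousLinearMap f).lipschitz.dimH_image_le A

theorem dimH_partialProd_add_le (hK : ∀ i, MeasurableSet (K i)) (hne : ∀ i, (K i).Nonempty)
    {J : Finset (Fin n)} {i : Fin n} (hi : i ∉ J) :
    dimH (partialProd K J) + dimH (K i) ≤ dimH (partialProd K (insert i J)) := by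
  refine (dimH_add_le_dimH_prod (measurableSet_partialProd hK J) (hK i)
    (partialProd_nonempty hne J) (hne i)).trans ?_
  -- The linear map `f` carries `partialProd K (insert i J)` onto a set containing the product, and
  -- linear maps do not raise dimension.
  let f : ProdSpace m →ₗ[ℝ] ProdSpace m × EuclideanSpace ℝ (Fin (m i)) :=
    (coordProj m J).prod (PiLp.projₗ 2 (fun i => EuclideanSpace ℝ (Fin (m i))) i)
  refine le_trans (dimH_mono ?_) (dimH_image_linearMap_le f _)
  rintro ⟨x, y⟩ ⟨hx, hy⟩
  refine ⟨WithLp.toLp 2 (Function.update x i y), fun j => ?_, ?_⟩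
  · by_cases hj : j = i
    · subst hj
      simpa using hy
    · simpa [hj] using hx j
  · refine Prod.ext (PiLp.ext fun j => ?_) ?_
    · change coordProj m J (WithLp.toLp 2 (Function.update x i y)) j = x j
      rw [coordProj_apply]
      by_cases hj : j ∈ J
      · have hji : j ≠ i := fun h => hi (h ▸ hj)
        simp [hj, hji]
      · rw [if_neg hj]
        exact ((hx j).2 hj).symm
    · change Function.update x.ofLp i y i = y
      simp

theorem dimH_partialProd_add_sum_le (hK : ∀ i, MeasurableSet (K i)) (hne : ∀ i, (K i).Nonempty)
    (I J : Finset (Fin n)) (hIJ : Disjoint I J) :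
    dimH (partialProd K I) + ∑ i ∈ J, dimH (K i) ≤ dimH (partialProd K (I ∪ J)) := by
  induction J using Finset.induction_on with
  | empty => simp
  | insert a J ha ih =>
    rw [Finset.disjoint_insert_right] at hIJ
    rw [Finset.sum_insert ha, Finset.union_insert]
    have h1 := dimH_partialProd_add_le hK hne (J := I ∪ J) (i := a)
      (by simp [hIJ.1, ha])
    refine le_trans ?_ h1
    rw [add_comm (dimH (K a)), ← add_assoc]
    gcongr
    exact ih hIJ.2

/-- Superadditivity bounds the full product below by the partial product plus the remaining
dimensions; additivity for the full product lets those finite remaining terms be cancelled. -/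
theorem dimH_partialProd_le (hK : ∀ i, MeasurableSet (K i)) (hne : ∀ i, (K i).Nonempty)
    (hdim : dimH (prodSet K) = ∑ i, dimH (K i)) (I : Finset (Fin n)) :
    dimH (partialProd K I) ≤ ∑ i ∈ I, dimH (K i) := by
  have h1 := dimH_partialProd_add_sum_le hK hne I Iᶜ disjoint_compl_right
  have h2 : partialProd K (I ∪ Iᶜ) = prodSet K := by
    ext x
    simp [partialProd, prodSet]
  rw [h2, hdim, ← Finset.sum_add_sum_compl I] at h1
  exact (ENNReal.add_le_add_iff_right
    (ENNReal.sum_ne_top.2 fun i _ => Real.dimH_ne_top _)).1 h1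

/-- Splitting `x` into its components in `I` and outside `I` places the image in a linear image of
the partial product plus `π(⨁_{i ∉ I} ℝ^{m_i})`. No exceptional parameters arise, because rotations
and scalings preserve each factor `ℝ^{m_i}`, even for `t_i = 0`. -/
theorem dimH_image_prodSet_le (hK : ∀ i, MeasurableSet (K i)) (hne : ∀ i, (K i).Nonempty)
    (hdim : dimH (prodSet K) = ∑ i, dimH (K i)) (l : Param m) :
    dimH (projParam π l '' prodSet K) ≤ minDim π fun i => dimH (K i) := by
  refine le_iInf₂ fun I _ => ?_
  have hsub : projParam π l '' prodSet K ⊆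
      projLinear π l '' partialProd K I + ((coordSubspace m Iᶜ).map π : Set _) := by
    rintro _ ⟨x, hx, rfl⟩
    refine ⟨_, ⟨coordProj m I x, fun i => ?_, rfl⟩, projParam π l (coordProj m Iᶜ x), ?_, ?_⟩
    · rw [coordProj_apply]
      by_cases hi : i ∈ I <;> simp [hi, hx i]
    · refine ⟨_, fun i hi => ?_, rfl⟩
      change (l i).1 • rot (l i).2 (coordProj m Iᶜ x i) = 0
      rw [coordProj_apply, if_neg hi]
      simp [rot]
    · change projParam π l _ + projParam π l _ = _
      rw [← projParam_add]
      congr 1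
      refine PiLp.ext fun i => ?_
      rw [PiLp.add_apply, coordProj_apply, coordProj_apply]
      by_cases hi : i ∈ I <;> simp [hi]
  calc dimH (projParam π l '' prodSet K)
      ≤ dimH (projLinear π l '' partialProd K I + ((coordSubspace m Iᶜ).map π : Set _)) :=
        dimH_mono hsub
    _ ≤ dimH (projLinear π l '' partialProd K I) +
        Module.finrank ℝ ((coordSubspace m Iᶜ).map π) := dimH_add_submodule_le _ _
    _ ≤ _ := by
        gcongr
        exact (dimH_image_linearMap_le _ _).trans (dimH_partialProd_le hK hne hdim I)

theorem minDim_le_of_eq_empty {i : Fin n} (hi : K i = ∅) :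
    minDim π (fun i => dimH (K i)) ≤ k := by
  refine (iInf₂_le {i} (Finset.singleton_nonempty i)).trans ?_
  rw [Finset.sum_singleton, hi, dimH_empty, zero_add]
  have h := Submodule.finrank_le ((coordSubspace m ({i} : Finset (Fin n))ᶜ).map π)
  rw [finrank_euclideanSpace, Fintype.card_fin] at h
  exact_mod_cast h

theorem minDim_eq_zero_of_sum_eq_zero (hn : 0 < n) {d : Fin n → ℝ≥0∞} (hd : ∑ i, d i = 0) :
    minDim π d = 0 := by
  have : Nonempty (Fin n) := ⟨⟨0, hn⟩⟩
  rw [← nonpos_iff_eq_zero]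
  refine (iInf₂_le Finset.univ Finset.univ_nonempty).trans ?_
  have h1 : coordSubspace m (Finset.univ : Finset (Fin n))ᶜ = ⊥ := by
    rw [eq_bot_iff]
    intro x hx
    exact PiLp.ext fun i => hx i (by simp)
  rw [hd, h1, Submodule.map_bot, finrank_bot]
  simp

end UpperBound
end Marstrand

/-! ### Conclusion -/

theorem theorem1 {n k : ℕ} (hn : 0 < n) (m : Fin n → ℕ)
    (K : (i : Fin n) → Set (EuclideanSpace ℝ (Fin (m i))))
    (hK : ∀ i, MeasurableSet (K i))
    (π : Marstrand.ProdSpace m →ₗ[ℝ] EuclideanSpace ℝ (Fin k))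
    (hπ : Function.Surjective π) :
    ((k : ℝ≥0∞) < Marstrand.minDim π (fun i => dimH (K i)) →
      ∀ᵐ l ∂(Marstrand.paramMeasure m),
        0 < volume (Marstrand.projParam π l '' Marstrand.prodSet K)) ∧
    (Marstrand.minDim π (fun i => dimH (K i)) ≤ (k : ℝ≥0∞) →
      dimH (Marstrand.prodSet K) = ∑ i, dimH (K i) →
      ∀ᵐ l ∂(Marstrand.paramMeasure m),
        dimH (Marstrand.projParam π l '' Marstrand.prodSet K) =
          Marstrand.minDim π (fun i => dimH (K i))) := by
  refine ⟨fun hk => ?_, fun hk hdim => ?_⟩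
  · refine Marstrand.ae_volume_image_pos hK (fun i => ?_) hπ hk
    rw [Set.nonempty_iff_ne_empty]
    -- An empty factor would make the term `I = {i}` at most `k`.
    exact fun hi => absurd hk (not_lt.2 (Marstrand.minDim_le_of_eq_empty hi))
  · by_cases hne : ∀ i, (K i).Nonempty
    · filter_upwards [Marstrand.ae_minDim_le_dimH_image hK hne hπ hk] with l hl
      exact le_antisymm (Marstrand.dimH_image_prodSet_le hK hne hdim l) hl
    · push Not at hne
      obtain ⟨i, hi⟩ := hne
      -- With an empty factor the additivity hypothesis makes all dimensions sum to 0, so the term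
      -- with `I` the full index set gives minimum 0, the dimension of the empty image.
      have hempty : Marstrand.prodSet K = ∅ := by
        rw [Set.eq_empty_iff_forall_notMem]
        intro x hx
        have h := hx i
        rw [hi] at h
        exact h
      rw [hempty, dimH_empty] at hdim
      rw [Marstrand.minDim_eq_zero_of_sum_eq_zero hn hdim.symm, hempty]
      simp
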